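/- Let $X$ be a smooth projective curve over an algebraically closed field $\mathbb{K}$ of characteristic $\neq 2$, let $x \in X$ be a closed point with local ring $\mathcal{O}$ and maximal ideal $\mathfrak{m}$, and for a vector bundle $V$ on $X$ put $V_x = \widehat V_x/\mathfrak{m}\widehat V_x$ and $V_{2x} = \widehat V_x/\mathfrak{m}^2\widehat V_x$, where $\widehat V_x$ is the stalk. For $n\in\{1,2\}$ and a submodule $N$ of $V_{nx}$ (where $V_{1x}=V_x$), the Hecke transform of $V$ with respect to $N$ is $\ker(V \to V_{nx}/N)$. Let $F$ and $G$ be vector bundles of rank $2$ on $X$ with an isomorphism $\delta:\det F \cong \det G$, and let $E = \mathcal{H}om(F,G)$ with the quadratic form $q$ given by the determinant, i.e. the unique form with $\Lambda^2\varphi = q(\varphi)\,\delta$. A submodule $L \subset E_{2x}$ over $\mathcal{O}/\mathfrak{m}^2$ is called Lagrangian if it is isotropic for the induced $\mathcal{O}/\mathfrak{m}^2$-valued quadratic form and $\dim_{\mathbb{K}} L = 4$. Let $\mathrm{O}\Sigma_i$ be the set of Lagrangian submodules $L$ whose image $\overline L$ in $E_x = \mathrm{Hom}(F_x,G_x)$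 has dimension $i$, and let $\mathcal{H}(E,L) = \ker(E \to E_{2x}/L)\otimes\mathcal{O}_X(x)$, with the quadratic form $\mathcal{H}(E,L)\to\mathcal{O}_X$ that agrees with $q$ on $X\setminus\{x\}$. Below, $\mathcal{H}(E,L)=\mathcal{H}om(F_1,G_1)$ means that $F_1$ and $G_1$ are vector bundles of rank $2$ and that, for a suitable isomorphism $\det F_1\cong\det G_1$, there is an isomorphism of bundles with quadratic forms between $\mathcal{H}(E,L)$ and $\mathcal{H}om(F_1,G_1)$ with its determinant form. 1. Let $L \in \mathrm{O}\Sigma_1$, and let $\varphi \in \mathrm{Hom}(F_x,G_x)$ be a generator of the line $\overline L$. Then $\operatorname{Ker}\varphi\subset F_x$ and $\operatorname{Im}\varphi\subset G_x$ are lines, and $$\mathcal{H}(E,L) = \mathcal{H}om(F',G'),$$ where $F' = \ker(F \to F_x/\operatorname{Ker}\varphi)$ and $G' = \ker(G \to G_x/\operatorname{Im}\varphi)$. 2. For $L \in \mathrm{O}\Sigma_2$ exactly one of the following holds: (a) $\overline L = \mathrm{Hom}(F_x,D)$ for a line $D \subset G_x$; (b) $\overline L = \{\varphi : \varphi(D)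 = 0\}=\mathrm{Hom}(F_x/D,G_x)$ for a line $D \subset F_x$. The sets of $L$ of type (a) and of type (b) are the two connected components of $\mathrm{O}\Sigma_2$, in the Zariski topology of the Grassmannian of $4$-dimensional subspaces of $E_{2x}$. * In case (a) there is a unique submodule $M \subset G_{2x}$ with $L = \mathrm{Hom}(F_{2x},M)$, and $\mathcal{H}(E,L) = \mathcal{H}om(F, G'(x))$, where $G' = \ker(G \to G_{2x}/M)$. * In case (b) there is a unique submodule $M \subset F_{2x}$ with $L = \mathrm{Hom}(F_{2x}/M, G_{2x})$, i.e. $L$ consists of the homomorphisms that vanish on $M$, and $\mathcal{H}(E,L) = \mathcal{H}om(F'(x), G)$, where $F' = \ker(F \to F_{2x}/M)$. -/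

import Mathlib

open CategoryTheory AlgebraicGeometry TopologicalSpace Opposite
universe u
noncomputable section
namespace OrthHecke
variable {X : Scheme.{u}}

/-- Restriction of functions from `U` to a smaller open set `V`. -/
def resO {U V : X.Opens} (h : V ≤ U) : Γ(X, U) →+* Γ(X, V) :=
  (X.presheaf.map (homOfLE h).op).hom

/-- Restriction of sections of an `𝒪_X`-module from `U` to a smaller open set `V`. -/
def res (M : X.Modules) {U V : X.Opens} (h : V ≤ U) : Γ(M, U) →+ Γ(M, V) :=
  (M.presheaf.map (homOfLE h).op).hom

theorem res_smul (M : X.Modules) {U V : X.Opens} (h : V ≤ U) (a : Γ(X, U)) (s : Γ(M, U)) :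
    res M h (a • s) = resO h a • res M h s :=
  Scheme.Modules.map_smul M (homOfLE h) a s

theorem resO_resO {U V W : X.Opens} (h : V ≤ U) (h' : W ≤ V) (a : Γ(X, U)) :
    resO h' (resO h a) = resO (h'.trans h) a := by
  unfold resO
  rw [← CommRingCat.comp_apply, ← X.presheaf.map_comp]; rfl

theorem res_res (M : X.Modules) {U V W : X.Opens} (h : V ≤ U) (h' : W ≤ V) (s : Γ(M, U)) :
    res M h' (res M h s) = res M (h'.trans h) s := by
  unfold res
  rw [← AddCommGrpCat.comp_apply, ← M.presheaf.map_comp]; rfl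

theorem res_self (M : X.Modules) {U : X.Opens} (h : U ≤ U) (s : Γ(M, U)) :
    res M h s = s := by
  have : (homOfLE h).op = 𝟙 (op U) := rfl
  unfold res
  rw [this, M.presheaf.map_id]; rfl

theorem resO_self {U : X.Opens} (h : U ≤ U) (s : Γ(X, U)) :
    resO h s = s := by
  have : (homOfLE h).op = 𝟙 (op U) := rfl
  unfold resO
  rw [this, X.presheaf.map_id]; rfl

theorem eq_of_locally (M : X.Modules) {U : X.Opens} (s t : Γ(M, U))
    (h : ∀ p ∈ U, ∃ (V : X.Opens) (hV : V ≤ U), p ∈ V ∧ res M hV s = res M hV t) : s = t := by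
  choose! V hV hp he using h
  refine TopCat.Sheaf.eq_of_locally_eq' (C := AddCommGrpCat) ⟨M.presheaf, M.isSheaf⟩ (fun p : U ↦ V p)
    U (fun p ↦ homOfLE (hV p p.2)) ?_ s t ?_
  · intro p hpU
    exact Opens.mem_iSup.2 ⟨⟨p, hpU⟩, hp p hpU⟩
  · intro p
    exact he p p.2

theorem exists_glue (M : X.Modules) {U : X.Opens} {ι : Type u} (V : ι → X.Opens)
    (hV : ∀ i, V i ≤ U) (hU : ∀ p ∈ U, ∃ i, p ∈ V i) (s : ∀ i, Γ(M, V i))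
    (hs : ∀ i j (W : X.Opens) (hi : W ≤ V i) (hj : W ≤ V j), res M hi (s i) = res M hj (s j)) :
    ∃ t : Γ(M, U), ∀ i, res M (hV i) t = s i := by
  obtain ⟨t, ht, -⟩ := TopCat.Sheaf.existsUnique_gluing' (C := AddCommGrpCat)
    ⟨M.presheaf, M.isSheaf⟩ V U (fun i ↦ homOfLE (hV i))
    (fun p hp ↦ Opens.mem_iSup.2 (hU p hp)) s (fun i j ↦ hs i j _ inf_le_left inf_le_right)
  exact ⟨t, ht⟩

/-- A presheaf of `𝒪_X`-modules whose sections are determined locally and can be glued is a sheaf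
of `𝒪_X`-modules. -/
def mkModules (P : X.PresheafOfModules)
    (hsep : ∀ (U : X.Opens) (s t : P.obj (op U)), (∀ p ∈ U, ∃ (V : X.Opens) (hV : V ≤ U),
      p ∈ V ∧ P.map (homOfLE hV).op s = P.map (homOfLE hV).op t) → s = t)
    (hglue : ∀ (U : X.Opens) (ι : Type u) (V : ι → X.Opens) (hV : ∀ i, V i ≤ U)
      (_ : ∀ p ∈ U, ∃ i, p ∈ V i) (s : ∀ i, P.obj (op (V i)))
      (_ : ∀ i j (W : X.Opens) (hi : W ≤ V i) (hj : W ≤ V j),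
        P.map (homOfLE hi).op (s i) = P.map (homOfLE hj).op (s j)),
      ∃ t : P.obj (op U), ∀ i, P.map (homOfLE (hV i)).op t = s i) : X.Modules :=
  ⟨P, by
    refine (TopCat.Presheaf.isSheaf_iff_isSheafUniqueGluing (C := AddCommGrpCat) P.presheaf).2 ?_
    intro ι V s hs
    obtain ⟨t, ht⟩ := hglue (iSup V) ι V (fun i ↦ le_iSup V i)
      (fun p hp ↦ Opens.mem_iSup.1 hp) s (by
        intro i j W hi hj
        have h1 := congrArg (P.presheaf.map (homOfLE (le_inf hi hj)).op) (hs i j)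
        have e1 : ∀ y, P.presheaf.map (homOfLE (le_inf hi hj)).op (P.presheaf.map (Opens.infLELeft (V i) (V j)).op y) = P.presheaf.map (homOfLE hi).op y := by
          intro y
          rw [← AddCommGrpCat.comp_apply, ← P.presheaf.map_comp]; rfl
        have e2 : ∀ y, P.presheaf.map (homOfLE (le_inf hi hj)).op (P.presheaf.map (Opens.infLERight (V i) (V j)).op y) = P.presheaf.map (homOfLE hj).op y := by
          intro y
          rw [← AddCommGrpCat.comp_apply, ← P.presheaf.map_comp]; rfl
        exact (e1 _).symm.trans (h1.trans (e2 _)))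
    refine ⟨t, ht, fun t' ht' ↦ hsep _ _ _ fun p hp ↦ ?_⟩
    obtain ⟨i, hi⟩ := Opens.mem_iSup.1 hp
    exact ⟨V i, le_iSup V i, hi, (ht' i).trans (ht i).symm⟩⟩

/-- The subsheaf of `𝒪_X`-modules of `M` with sections `N U ⊆ M(U)`, where membership in `N` is
stable under restriction and can be checked locally. -/
def subsheaf (M : X.Modules) (N : ∀ U : X.Opens, Submodule Γ(X, U) Γ(M, U))
    (hres : ∀ (U V : X.Opens) (h : V ≤ U) (s : Γ(M, U)), s ∈ N U → res M h s ∈ N V)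
    (hloc : ∀ (U : X.Opens) (s : Γ(M, U)),
      (∀ p ∈ U, ∃ (V : X.Opens) (h : V ≤ U), p ∈ V ∧ res M h s ∈ N V) → s ∈ N U) :
    X.Modules :=
  mkModules (PresheafOfModules.Submodule.toPresheafOfModules (M := M.val)
    { obj := fun U ↦ N U.unop
      map := fun f s hs ↦ hres _ _ (leOfHom f.unop) s hs })
    (fun U s t h ↦ Subtype.ext (eq_of_locally M _ _ fun p hp ↦ by
      obtain ⟨V, hV, hpV, e⟩ := h p hp
      exact ⟨V, hV, hpV, congrArg Subtype.val e⟩))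
    (fun U ι V hV hU s hs ↦ by
      obtain ⟨t, ht⟩ := exists_glue M V hV hU (fun i ↦ (s i).1) (fun i j W hi hj ↦
        congrArg Subtype.val (hs i j W hi hj))
      refine ⟨⟨t, hloc U t fun p hp ↦ ?_⟩, fun i ↦ Subtype.ext (ht i)⟩
      obtain ⟨i, hi⟩ := hU p hp
      refine ⟨V i, hV i, hi, ?_⟩
      rw [ht i]
      exact (s i).2)

/-- A morphism of sheaves of `𝒪_U`-modules `F|_U ⟶ G|_U`. -/
@[ext]
structure LocalHom (F G : X.Modules) (U : X.Opens) where
  toFun : ∀ V : X.Opens, V ≤ U → Γ(F, V) →ₗ[Γ(X, V)] Γ(G, V)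
  comm : ∀ (V W : X.Opens) (hV : V ≤ U) (h : W ≤ V) (s : Γ(F, V)),
    res G h (toFun V hV s) = toFun W (h.trans hV) (res F h s)

namespace LocalHom
variable {F G : X.Modules} {U : X.Opens}

instance : Zero (LocalHom F G U) := ⟨⟨fun _ _ ↦ 0, by intros; simp⟩⟩
instance : Add (LocalHom F G U) :=
  ⟨fun a b ↦ ⟨fun V h ↦ a.toFun V h + b.toFun V h, by intros; simp [a.comm, b.comm]⟩⟩
instance : Neg (LocalHom F G U) :=
  ⟨fun a ↦ ⟨fun V h ↦ -a.toFun V h, by intros; simp [a.comm]⟩⟩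
instance : Sub (LocalHom F G U) :=
  ⟨fun a b ↦ ⟨fun V h ↦ a.toFun V h - b.toFun V h, by intros; simp [a.comm, b.comm]⟩⟩
instance : SMul ℕ (LocalHom F G U) :=
  ⟨fun n a ↦ ⟨fun V h ↦ n • a.toFun V h, by intros; simp [a.comm]⟩⟩
instance : SMul ℤ (LocalHom F G U) :=
  ⟨fun n a ↦ ⟨fun V h ↦ n • a.toFun V h, by intros; simp [a.comm]⟩⟩
instance : SMul Γ(X, U) (LocalHom F G U) :=
  ⟨fun c a ↦ ⟨fun V h ↦ resO h c • a.toFun V h, by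
    intros; simp [a.comm, res_smul, resO_resO]⟩⟩

/-- The underlying family of linear maps. -/
def values (a : LocalHom F G U) (V : {V : X.Opens // V ≤ U}) : Γ(F, V.1) →ₗ[Γ(X, V.1)] Γ(G, V.1) :=
  a.toFun V.1 V.2

theorem values_injective : Function.Injective (values : LocalHom F G U → _) :=
  fun a b h ↦ LocalHom.ext (by funext V hV; exact congrFun h ⟨V, hV⟩)

instance : AddCommGroup (LocalHom F G U) :=
  values_injective.addCommGroup _ rfl (fun _ _ ↦ rfl) (fun _ ↦ rfl) (fun _ _ ↦ rfl)
    (fun _ _ ↦ rfl) (fun _ _ ↦ rfl)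

theorem add_toFun (a b : LocalHom F G U) (V : X.Opens) (h : V ≤ U) :
    (a + b).toFun V h = a.toFun V h + b.toFun V h := rfl
theorem zero_toFun (V : X.Opens) (h : V ≤ U) :
    (0 : LocalHom F G U).toFun V h = 0 := rfl
theorem smul_toFun (c : Γ(X, U)) (a : LocalHom F G U) (V : X.Opens) (h : V ≤ U) :
    (c • a).toFun V h = resO h c • a.toFun V h := rfl

instance : Module Γ(X, U) (LocalHom F G U) where
  one_smul a := by ext V h s; simp [smul_toFun]
  mul_smul c d a := by ext V h s; simp [smul_toFun, mul_smul]
  smul_zero c := by ext V h s; simp [smul_toFun, zero_toFun]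
  smul_add c a b := by ext V h s; simp [smul_toFun, add_toFun]
  add_smul c d a := by ext V h s; simp [smul_toFun, add_toFun, add_smul]
  zero_smul a := by ext V h s; simp [smul_toFun, zero_toFun]

/-- Restriction of a morphism `F|_U ⟶ G|_U` to a smaller open set. -/
def restrict {V : X.Opens} (h : V ≤ U) : LocalHom F G U →+ LocalHom F G V where
  toFun a := ⟨fun W hW ↦ a.toFun W (hW.trans h), fun _ _ _ _ _ ↦ a.comm _ _ _ _ _⟩
  map_zero' := rfl
  map_add' _ _ := rfl

end LocalHom

/-- The presheaf `U ↦ Hom(F|_U, G|_U)` of `𝒪_X`-modules. -/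
def homPresheaf (F G : X.Modules) : X.PresheafOfModules :=
  letI P : (X.Opens)ᵒᵖ ⥤ Ab :=
    { obj := fun U ↦ AddCommGrpCat.of (LocalHom F G U.unop)
      map := fun f ↦ AddCommGrpCat.ofHom (LocalHom.restrict (leOfHom f.unop))
      map_id := fun _ ↦ rfl
      map_comp := fun _ _ ↦ rfl }
  letI (U : (X.Opens)ᵒᵖ) : Module (X.ringCatSheaf.obj.obj U) (P.obj U) :=
    inferInstanceAs (Module Γ(X, U.unop) (LocalHom F G U.unop))
  PresheafOfModules.ofPresheaf P (fun U V f c a ↦ by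
    refine LocalHom.ext ?_
    funext W hW
    refine LinearMap.ext fun s ↦ ?_
    exact congrArg (· • a.toFun W (hW.trans (leOfHom f.unop)) s)
      (resO_resO (leOfHom f.unop) hW c).symm)

theorem exists_glueLocalHom (F G : X.Modules) (U : X.Opens) (ι : Type u) (V : ι → X.Opens) (hV : ∀ i, V i ≤ U)
    (hU : ∀ p ∈ U, ∃ i, p ∈ V i) (s : ∀ i, LocalHom F G (V i))
    (hs : ∀ i j (W : X.Opens) (hi : W ≤ V i) (hj : W ≤ V j),
        LocalHom.restrict hi (s i) = LocalHom.restrict hj (s j)) :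
    ∃ t : LocalHom F G U, ∀ i, LocalHom.restrict (hV i) t = s i := by
  have hs' : ∀ i j (W : X.Opens) (hi : W ≤ V i) (hj : W ≤ V j), (s i).toFun W hi = (s j).toFun W hj :=
    fun i j W hi hj ↦ congrArg (fun a ↦ a.toFun W le_rfl) (hs i j W hi hj)
  have key : ∀ (W : X.Opens) (hW : W ≤ U) (m : Γ(F, W)), ∃ t : Γ(G, W), ∀ i (W' : X.Opens) (h : W' ≤ W) (h' : W' ≤ V i),
      res G h t = (s i).toFun W' h' (res F h m) := by
    intro W hW m
    obtain ⟨t, ht⟩ := exists_glue G (fun i ↦ W ⊓ V i) (fun i ↦ inf_le_left)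
      (fun p hp ↦ (hU p (hW hp)).imp fun i hi ↦ ⟨hp, hi⟩)
      (fun i ↦ (s i).toFun (W ⊓ V i) inf_le_right (res F inf_le_left m)) (by
        intro i j W' hi hj
        rw [LocalHom.comm, LocalHom.comm, res_res, res_res, hs' i j])
    refine ⟨t, fun i W' h h' ↦ ?_⟩
    have := congrArg (res G (le_inf h h')) (ht i)
    rw [LocalHom.comm, res_res, res_res] at this
    exact this
  have uniq : ∀ (W : X.Opens) (hW : W ≤ U) (t t' : Γ(G, W)),
      (∀ i (W' : X.Opens) (h : W' ≤ W) (_ : W' ≤ V i), res G h t = res G h t') → t = t' := by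
    intro W hW t t' h
    refine eq_of_locally G _ _ fun p hp ↦ ?_
    obtain ⟨i, hi⟩ := hU p (hW hp)
    exact ⟨W ⊓ V i, inf_le_left, ⟨hp, hi⟩, h i _ _ inf_le_right⟩
  choose! f hf using key
  refine ⟨⟨fun W hW ↦ ⟨⟨f W, ?_⟩, ?_⟩, ?_⟩, ?_⟩
  · intro m m'
    refine uniq W hW _ _ fun i W' h h' ↦ ?_
    simp only [map_add, hf W hW _ i W' h h']
  · intro c m
    refine uniq W hW _ _ fun i W' h h' ↦ ?_
    simp [res_smul, hf W hW _ i W' h h']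
  · intro W W' hW h m
    refine uniq W' (h.trans hW) _ _ fun i W'' h' h'' ↦ ?_
    change res G h' (res G h (f W m)) = res G h' (f W' (res F h m))
    rw [res_res, hf W hW _ i W'' (h'.trans h) h'', hf W' (h.trans hW) _ i W'' h' h'', res_res]
  · intro i
    refine LocalHom.ext ?_
    funext W hW
    refine LinearMap.ext fun m ↦ ?_
    change f W m = _
    have := hf W (hW.trans (hV i)) m i W le_rfl hW
    rwa [res_self, res_self] at this

/-- The sheaf `ℋom(F, G)`, with sections `Hom(F|_U, G|_U)` over `U`. -/
def homSheaf (F G : X.Modules) : X.Modules :=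
  mkModules (homPresheaf F G)
    (fun U s t h ↦ by
      refine LocalHom.ext ?_
      funext W hW
      refine LinearMap.ext fun m ↦ ?_
      refine eq_of_locally G _ _ fun p hp ↦ ?_
      obtain ⟨V, hV, hpV, e⟩ := h p (hW hp)
      refine ⟨W ⊓ V, inf_le_left, ⟨hp, hpV⟩, ?_⟩
      have e' := congrArg (fun a : LocalHom F G V ↦ a.toFun (W ⊓ V) inf_le_right (res F inf_le_left m)) e
      exact (LocalHom.comm s _ _ _ _ _).trans (e'.trans (LocalHom.comm t _ _ _ _ _).symm))
    (fun U ι V hV hU s hs ↦ exists_glueLocalHom F G U ι V hV hU s hs)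

/-- The map `F(V) → G(V)` given by a section `φ` of `ℋom(F, G)` over `U ⊇ V`. -/
def ev {F G : X.Modules} {U : X.Opens} (φ : Γ(homSheaf F G, U)) {V : X.Opens} (h : V ≤ U) :
    Γ(F, V) →ₗ[Γ(X, V)] Γ(G, V) :=
  LocalHom.toFun φ V h

/-- The stalk of an `𝒪_X`-module at `x`, a module over the local ring `𝒪_{X,x}`. -/
def Stalk (M : X.Modules) (x : X) : Type u :=
  (TopCat.Presheaf.stalk M.presheaf x :)

instance (M : X.Modules) (x : X) : AddCommGroup (Stalk M x) :=
  inferInstanceAs (AddCommGroup (TopCat.Presheaf.stalk M.presheaf x :))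

instance (M : X.Modules) (x : X) : Module (X.presheaf.stalk x) (Stalk M x) :=
  PresheafOfModules.instModuleCarrierStalkCommRingCatCarrierAbPresheafOpensCarrier
    (R := X.presheaf) M.val x

/-- The germ at `x` of a section. -/
def germ (M : X.Modules) {U : X.Opens} {x : X} (hx : x ∈ U) : Γ(M, U) →+ Stalk M x :=
  (TopCat.Presheaf.germ M.presheaf U x hx).hom

theorem germ_smul (M : X.Modules) {U : X.Opens} {x : X} (hx : x ∈ U) (c : Γ(X, U)) (s : Γ(M, U)) :
    germ M hx (c • s) = X.presheaf.germ U x hx c • germ M hx s :=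
  PresheafOfModules.germ_smul (R := X.presheaf) M.val x U hx c s

theorem germ_resO {U V : X.Opens} {x : X} (h : V ≤ U) (hx : x ∈ V) (s : Γ(X, U)) :
    X.presheaf.germ V x hx (resO h s) = X.presheaf.germ U x (h hx) s :=
  TopCat.Presheaf.germ_res_apply X.presheaf (homOfLE h) x hx s

theorem germ_res (M : X.Modules) {U V : X.Opens} {x : X} (h : V ≤ U) (hx : x ∈ V) (s : Γ(M, U)) :
    germ M hx (res M h s) = germ M (h hx) s :=
  TopCat.Presheaf.germ_res_apply M.presheaf (homOfLE h) x hx s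

theorem exists_germ (M : X.Modules) {x : X} (m : Stalk M x) :
    ∃ (U : X.Opens) (hx : x ∈ U) (s : Γ(M, U)), germ M hx s = m := 
  TopCat.Presheaf.exists_germ_eq M.presheaf m

theorem germ_eq (M : X.Modules) {U V : X.Opens} {x : X} (hU : x ∈ U) (hV : x ∈ V) (s : Γ(M, U)) (t : Γ(M, V))
    (h : germ M hU s = germ M hV t) : 
    ∃ (W : X.Opens) (_ : x ∈ W) (h : W ≤ U) (h' : W ≤ V), res M h s = res M h' t := by
  obtain ⟨W, hW, i, j, e⟩ := TopCat.Presheaf.germ_eq M.presheaf x hU hV s t h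
  exact ⟨W, hW, leOfHom i, leOfHom j, e⟩

theorem germ_ev_congr (F G : X.Modules) {x : X} {U U' : X.Opens} (hU : x ∈ U) (hU' : x ∈ U')
    (φ : Γ(homSheaf F G, U)) (φ' : Γ(homSheaf F G, U')) (s : Γ(F, U)) (s' : Γ(F, U'))
    (h : germ _ hU φ = germ _ hU' φ') (h' : germ F hU s = germ F hU' s') :
    germ G hU (ev φ le_rfl s) = germ G hU' (ev φ' le_rfl s') := by
  obtain ⟨W, hW, i, i', e⟩ := germ_eq _ _ _ _ _ h
  obtain ⟨W', hW', j, j', e'⟩ := germ_eq _ _ _ _ _ h'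
  have hx : x ∈ W ⊓ W' := ⟨hW, hW'⟩
  have e1 : ev φ (inf_le_left.trans i : W ⊓ W' ≤ U) = ev φ' (inf_le_left.trans i') :=
    congrArg (fun a : LocalHom F G W ↦ a.toFun (W ⊓ W') inf_le_left) e
  have e2 := congrArg (res F (inf_le_right : W ⊓ W' ≤ W')) e'
  rw [res_res, res_res] at e2
  rw [← germ_res G (inf_le_left.trans i : W ⊓ W' ≤ U) hx,
    ← germ_res G (inf_le_left.trans i' : W ⊓ W' ≤ U') hx]
  congr 1
  refine (LocalHom.comm φ _ _ _ _ _).trans (Eq.trans ?_ (LocalHom.comm φ' _ _ _ _ _).symm)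
  exact (congrArg _ e2).trans (LinearMap.congr_fun e1 _)

theorem exists_germ₂ (M N : X.Modules) {x : X} (m : Stalk M x) (n : Stalk N x) :
    ∃ (U : X.Opens) (hx : x ∈ U) (s : Γ(M, U)) (t : Γ(N, U)), germ M hx s = m ∧ germ N hx t = n := by
  obtain ⟨U, hU, s, rfl⟩ := exists_germ M m
  obtain ⟨V, hV, t, rfl⟩ := exists_germ N n
  exact ⟨U ⊓ V, ⟨hU, hV⟩, res M inf_le_left s, res N inf_le_right t, germ_res _ _ _ _, germ_res _ _ _ _⟩

theorem exists_germ₃ (M N P : X.Modules) {x : X} (m : Stalk M x) (n : Stalk N x) (p : Stalk P x) :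
    ∃ (U : X.Opens) (hx : x ∈ U) (s : Γ(M, U)) (t : Γ(N, U)) (r : Γ(P, U)),
      germ M hx s = m ∧ germ N hx t = n ∧ germ P hx r = p := by
  obtain ⟨U, hU, s, t, rfl, rfl⟩ := exists_germ₂ M N m n
  obtain ⟨V, hV, r, rfl⟩ := exists_germ P p
  exact ⟨U ⊓ V, ⟨hU, hV⟩, res M inf_le_left s, res N inf_le_left t, res P inf_le_right r,
    germ_res _ _ _ _, germ_res _ _ _ _, germ_res _ _ _ _⟩

theorem exists_germ_scalar (M N : X.Modules) {x : X} (c : X.presheaf.stalk x) (m : Stalk M x) (n : Stalk N x) :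
    ∃ (U : X.Opens) (hx : x ∈ U) (a : Γ(X, U)) (s : Γ(M, U)) (t : Γ(N, U)),
      X.presheaf.germ U x hx a = c ∧ germ M hx s = m ∧ germ N hx t = n := by
  obtain ⟨U, hU, s, t, rfl, rfl⟩ := exists_germ₂ M N m n
  obtain ⟨V, hV, r, rfl⟩ := TopCat.Presheaf.exists_germ_eq X.presheaf c
  exact ⟨U ⊓ V, ⟨hU, hV⟩, resO inf_le_right r, res M inf_le_left s, res N inf_le_left t,
    germ_resO _ _ _, germ_res _ _ _ _, germ_res _ _ _ _⟩

/-- Evaluation of a germ of `ℋom(F, G)` at a germ of `F`: the germ of `φ` and the germ of `s` give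
the germ of `φ(s)`, see `stalkEvFun_germ`. -/
def stalkEvFun (F G : X.Modules) (x : X) (e : Stalk (homSheaf F G) x) (f : Stalk F x) : Stalk G x :=
  letI h := exists_germ₂ _ _ e f
  germ G h.choose_spec.choose (ev h.choose_spec.choose_spec.choose le_rfl
    h.choose_spec.choose_spec.choose_spec.choose)

theorem stalkEvFun_germ (F G : X.Modules) {x : X} {U : X.Opens} (hx : x ∈ U) (φ : Γ(homSheaf F G, U))
    (s : Γ(F, U)) : stalkEvFun F G x (germ _ hx φ) (germ F hx s) = germ G hx (ev φ le_rfl s) := by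
  have h := exists_germ₂ _ _ (germ _ hx φ) (germ F hx s)
  have := h.choose_spec.choose_spec.choose_spec.choose_spec
  exact germ_ev_congr _ _ _ _ _ _ _ _ this.1 this.2

/-- Evaluation `ℋom(F, G)_x × F_x → G_x` on stalks, as a bilinear map. -/
def stalkEv (F G : X.Modules) (x : X) :
    Stalk (homSheaf F G) x →ₗ[X.presheaf.stalk x] Stalk F x →ₗ[X.presheaf.stalk x] Stalk G x :=
  LinearMap.mk₂ _ (stalkEvFun F G x)
    (fun e e' f ↦ by
      obtain ⟨U, hx, φ, φ', s, rfl, rfl, rfl⟩ := exists_germ₃ _ _ _ e e' f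
      rw [← map_add, stalkEvFun_germ, stalkEvFun_germ, stalkEvFun_germ, ← map_add]; rfl)
    (fun c e f ↦ by
      obtain ⟨U, hx, a, φ, s, rfl, rfl, rfl⟩ := exists_germ_scalar _ _ c e f
      rw [← germ_smul, stalkEvFun_germ, stalkEvFun_germ, ← germ_smul]
      congr 1
      exact congrArg (· • ev φ le_rfl s) (resO_self le_rfl a))
    (fun e f f' ↦ by
      obtain ⟨U, hx, φ, s, s', rfl, rfl, rfl⟩ := exists_germ₃ _ _ _ e f f'
      rw [← map_add, stalkEvFun_germ, stalkEvFun_germ, stalkEvFun_germ, ← map_add, ← map_add])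
    (fun c e f ↦ by
      obtain ⟨U, hx, a, φ, s, rfl, rfl, rfl⟩ := exists_germ_scalar _ _ c e f
      rw [← germ_smul, stalkEvFun_germ, stalkEvFun_germ, ← germ_smul, ← map_smul])

/-- The `n`-th power of the maximal ideal of `𝒪_{X,x}`. -/
def mPow (x : X) (n : ℕ) : Ideal (X.presheaf.stalk x) := IsLocalRing.maximalIdeal (X.presheaf.stalk x) ^ n

/-- The module `M_{nx} = M_x ⊗ 𝒪_{X,x} / 𝔪^n = M_x / 𝔪^n M_x`, where `M_x` is the stalk. For `n = 1`
this is the fibre of `M` at `x`, for `n = 2` it is the module `M_{2x}` over the ring of dual numbers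
`𝒪_{X,x} / 𝔪^2`. Its submodules over `𝒪_{X,x}` are its submodules over `𝒪_{X,x} / 𝔪^n`. -/
def Thick (M : X.Modules) (x : X) (n : ℕ) : Type u :=
  Stalk M x ⧸ (mPow x n • ⊤ : Submodule (X.presheaf.stalk x) (Stalk M x))

namespace Thick
variable (M : X.Modules) (x : X) (n : ℕ)
instance : AddCommGroup (Thick M x n) :=
  inferInstanceAs (AddCommGroup (Stalk M x ⧸ (mPow x n • ⊤ : Submodule (X.presheaf.stalk x) (Stalk M x))))
instance : Module (X.presheaf.stalk x) (Thick M x n) :=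
  inferInstanceAs (Module (X.presheaf.stalk x) (Stalk M x ⧸ (mPow x n • ⊤ : Submodule (X.presheaf.stalk x) (Stalk M x))))

/-- The class in `M_{nx}` of a germ. -/
def mk : Stalk M x →ₗ[X.presheaf.stalk x] Thick M x n := Submodule.mkQ _

variable {M x n}
/-- A linear map on the stalk that kills `𝔪^n M_x` descends to `M_{nx}`. -/
def lift {N : Type*} [AddCommGroup N] [Module (X.presheaf.stalk x) N]
    (f : Stalk M x →ₗ[X.presheaf.stalk x] N)
    (h : ∀ c ∈ mPow x n, ∀ m, f (c • m) = 0) :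
    Thick M x n →ₗ[X.presheaf.stalk x] N :=
  Submodule.liftQ _ f (Submodule.smul_le.2 fun c hc m _ ↦ h c hc m)

theorem mk_surjective : Function.Surjective (mk M x n) := Submodule.mkQ_surjective _

theorem mk_smul_eq_zero (c) (hc : c ∈ mPow x n) (m : Stalk M x) : mk M x n (c • m) = 0 :=
  (Submodule.Quotient.mk_eq_zero _).2 (Submodule.smul_mem_smul hc trivial)

theorem lift_mk {N : Type*} [AddCommGroup N] [Module (X.presheaf.stalk x) N]
    (f : Stalk M x →ₗ[X.presheaf.stalk x] N)
    (h : ∀ c ∈ mPow x n, ∀ m, f (c • m) = 0) (m) : lift f h (mk M x n m) = f m := rfl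

variable (M x)
/-- The projection `M_{2x} → M_{1x}` to the fibre. -/
def π : Thick M x 2 →ₗ[X.presheaf.stalk x] Thick M x 1 :=
  lift (mk M x 1) fun c hc m ↦ mk_smul_eq_zero c (Ideal.pow_le_pow_right one_le_two hc) m

variable (n)
/-- Evaluation `ℋom(F, G)_{nx} × F_{nx} → G_{nx}`. -/
def eval (F G : X.Modules) :
    Thick (homSheaf F G) x n →ₗ[X.presheaf.stalk x] Thick F x n →ₗ[X.presheaf.stalk x] Thick G x n :=
  lift
    { toFun := fun e ↦ lift (mk G x n ∘ₗ stalkEv F G x e) fun c hc f ↦ by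
        rw [LinearMap.comp_apply, LinearMap.map_smul]
        exact mk_smul_eq_zero c hc _
      map_add' := fun e e' ↦ LinearMap.ext fun f ↦ by
        obtain ⟨f, rfl⟩ := mk_surjective f
        simp [lift_mk]
      map_smul' := fun e e' ↦ LinearMap.ext fun f ↦ by
        obtain ⟨f, rfl⟩ := mk_surjective f
        simp [lift_mk] }
    fun c hc e ↦ LinearMap.ext fun f ↦ by
      obtain ⟨f, rfl⟩ := mk_surjective f
      simp only [LinearMap.coe_mk, AddHom.coe_mk, lift_mk, LinearMap.comp_apply, LinearMap.map_smul, LinearMap.smul_apply]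
      rw [← LinearMap.map_smul, mk_smul_eq_zero c hc]; rfl

theorem eval_germ (F G : X.Modules) {U : X.Opens} (hx : x ∈ U) (φ : Γ(homSheaf F G, U))
    (s : Γ(F, U)) :
    eval x n F G (mk _ x n (germ _ hx φ)) (mk _ x n (germ F hx s)) =
      mk _ x n (germ G hx (ev φ le_rfl s)) :=
  congrArg (mk G x n) (stalkEvFun_germ F G hx φ s)

end Thick

section Twist

/-- The structure sheaf `𝒪_X` as a module over itself. -/
def structureSheaf (X : Scheme.{u}) : X.Modules := SheafOfModules.unit X.ringCatSheaf

/-- The functions on `U` that vanish at `x` (no condition if `x ∉ U`). -/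
def pointIdealAt (x : X) (U : X.Opens) : Ideal Γ(X, U) where
  carrier := {a | ∀ hx : x ∈ U, X.presheaf.germ U x hx a ∈
    IsLocalRing.maximalIdeal (X.presheaf.stalk x)}
  add_mem' ha hb hx := by
    rw [map_add]
    exact Ideal.add_mem _ (ha hx) (hb hx)
  zero_mem' hx := by
    rw [map_zero]
    exact Ideal.zero_mem _
  smul_mem' c a ha hx := by
    rw [smul_eq_mul, map_mul]
    exact Ideal.mul_mem_left _ _ (ha hx)

theorem resO_mem_pointIdealAt {x : X} {U V : X.Opens} (h : V ≤ U) {a : Γ(X, U)}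
    (ha : a ∈ pointIdealAt x U) : resO h a ∈ pointIdealAt x V := fun hx ↦ by
  rw [germ_resO]
  exact ha (h hx)

theorem mem_pointIdealAt_of_locally {x : X} {U : X.Opens} {a : Γ(X, U)}
    (ha : ∀ p ∈ U, ∃ (V : X.Opens) (h : V ≤ U), p ∈ V ∧ resO h a ∈ pointIdealAt x V) :
    a ∈ pointIdealAt x U := fun hx ↦ by
  obtain ⟨V, hV, hxV, hV'⟩ := ha x hx
  rw [← germ_resO hV hxV]
  exact hV' hxV

/-- The ideal sheaf `𝒪_X(-x)` of the point `x`. -/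
def pointIdeal (x : X) : X.Modules :=
  subsheaf (structureSheaf X) (fun U ↦ (pointIdealAt x U : Submodule Γ(X, U) Γ(X, U)))
    (fun _ _ h _ ha ↦ resO_mem_pointIdealAt h ha) (fun _ _ h ↦ mem_pointIdealAt_of_locally h)

/-- The inclusion `𝒪_X(-x) ⊆ 𝒪_X` on sections. -/
def pointIdeal.incl {x : X} {U : X.Opens} : Γ(pointIdeal x, U) →ₗ[Γ(X, U)] Γ(X, U) :=
  Submodule.subtype (R := Γ(X, U)) (M := Γ(X, U)) _

/-- The twist `M(x) = M ⊗ 𝒪_X(x)`. As `𝒪_X(x)` is the dual of the invertible sheaf `𝒪_X(-x)`, it is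
`ℋom(𝒪_X(-x), M)`. -/
def twist (M : X.Modules) (x : X) : X.Modules := homSheaf (pointIdeal x) M

/-- The Hecke transform of `M` at `x` with respect to a submodule `N ⊆ M_{nx}`: the kernel of
`M → M_{nx} / N`, that is, the sections of `M` whose value in `M_{nx}` lies in `N`. -/
def heckeTransform (M : X.Modules) (x : X) {n : ℕ} (N : Submodule (X.presheaf.stalk x) (Thick M x n)) : X.Modules :=
  subsheaf M
    (fun U ↦
      { carrier := {s | ∀ hx : x ∈ U, Thick.mk M x n (germ M hx s) ∈ N}
        add_mem' := fun {a b} ha hb hx ↦ by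
          rw [map_add, map_add]
          exact N.add_mem (ha hx) (hb hx)
        zero_mem' := fun hx ↦ by
          rw [map_zero, map_zero]
          exact N.zero_mem
        smul_mem' := fun c a ha hx ↦ by
          rw [germ_smul, LinearMap.map_smul]
          exact N.smul_mem _ (ha hx) })
    (fun U V h a ha hx ↦ by
      rw [germ_res]
      exact ha (h hx))
    (fun U a h hx ↦ by
      obtain ⟨V, hV, hxV, hV'⟩ := h x hx
      rw [← germ_res _ hV hxV]
      exact hV' hxV)

/-- The inclusion of the Hecke transform in `M`, on sections. -/
def heckeTransform.incl {M : X.Modules} {x : X} {n : ℕ}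
    {N : Submodule (X.presheaf.stalk x) (Thick M x n)} {U : X.Opens} :
    Γ(heckeTransform M x N, U) →ₗ[Γ(X, U)] Γ(M, U) :=
  Submodule.subtype _

end Twist

section Determinant

/-- The restriction `Λ² M(U) → Λ² M(V)`, sending `s ∧ t` to `s|_V ∧ t|_V`. -/
def wedgeRes (M : X.Modules) {U V : X.Opens} (h : V ≤ U) :
    ⋀[Γ(X, U)]^2 Γ(M, U) →ₛₗ[resO h] ⋀[Γ(X, V)]^2 Γ(M, V) :=
  letI : Module Γ(X, U) (⋀[Γ(X, V)]^2 Γ(M, V)) := Module.compHom _ (resO h)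
  letI f : ⋀[Γ(X, U)]^2 Γ(M, U) →ₗ[Γ(X, U)] ⋀[Γ(X, V)]^2 Γ(M, V) :=
    exteriorPower.alternatingMapLinearEquiv
    { toFun := fun v ↦ exteriorPower.ιMulti Γ(X, V) 2 fun i ↦ res M h (v i)
      map_update_add' := fun {_} v i a b ↦ by
        have e : ∀ c, (fun j ↦ res M h (Function.update v i c j)) =
            Function.update (fun j ↦ res M h (v j)) i (res M h c) := fun c ↦ by
          funext j
          by_cases hj : j = i
          · subst hj; simp
          · simp [hj]
        rw [e, e, e, map_add, AlternatingMap.map_update_add]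
      map_update_smul' := fun {_} v i a b ↦ by
        have e : ∀ c, (fun j ↦ res M h (Function.update v i c j)) =
            Function.update (fun j ↦ res M h (v j)) i (res M h c) := fun c ↦ by
          funext j
          by_cases hj : j = i
          · subst hj; simp
          · simp [hj]
        rw [e, e, res_smul, AlternatingMap.map_update_smul]; rfl
      map_eq_zero_of_eq' := fun v i j hv hij ↦
        AlternatingMap.map_eq_zero_of_eq _ _ (congrArg (res M h) hv) hij }
  { toFun := f
    map_add' := f.map_add
    map_smul' := f.map_smul }

theorem wedgeRes_ιMulti (M : X.Modules) {U V : X.Opens} (h : V ≤ U) (v : Fin 2 → Γ(M, U)) :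
    wedgeRes M h (exteriorPower.ιMulti Γ(X, U) 2 v) =
      exteriorPower.ιMulti Γ(X, V) 2 fun i ↦ res M h (v i) := by
  let _ : Module Γ(X, U) (⋀[Γ(X, V)]^2 Γ(M, V)) := Module.compHom _ (resO h)
  exact exteriorPower.alternatingMapLinearEquiv_apply_ιMulti _ _

theorem wedge_induction (M : X.Modules) {U : X.Opens} {p : ⋀[Γ(X, U)]^2 Γ(M, U) → Prop}
    (h0 : p 0) (hadd : ∀ a b, p a → p b → p (a + b)) (hsmul : ∀ (c : Γ(X, U)) a, p a → p (c • a))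
    (h : ∀ v, p (exteriorPower.ιMulti Γ(X, U) 2 v)) (a) : p a := by
  have ha : a ∈ Submodule.span Γ(X, U) (Set.range (exteriorPower.ιMulti Γ(X, U) 2 (M := Γ(M, U)))) := by
    rw [exteriorPower.ιMulti_span]; trivial
  induction ha using Submodule.span_induction with
  | mem a ha => obtain ⟨v, rfl⟩ := ha; exact h v
  | zero => exact h0
  | add a b _ _ ha hb => exact hadd a b ha hb
  | smul c a _ ha => exact hsmul c a ha

/-- The presheaf `U ↦ Λ² M(U)`. -/
def wedgePresheaf (M : X.Modules) : X.PresheafOfModules :=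
  letI P : (X.Opens)ᵒᵖ ⥤ Ab :=
    { obj := fun U ↦ AddCommGrpCat.of (⋀[Γ(X, U.unop)]^2 Γ(M, U.unop))
      map := fun f ↦ AddCommGrpCat.ofHom (wedgeRes M (leOfHom f.unop)).toAddMonoidHom
      map_id := fun U ↦ by
        refine AddCommGrpCat.hom_ext (AddMonoidHom.ext fun a ↦ ?_)
        change wedgeRes M _ a = a
        induction a using wedge_induction with
        | h0 => exact map_zero _
        | hadd a b ha hb => rw [map_add, ha, hb]
        | hsmul c a ha => rw [LinearMap.map_smulₛₗ, ha, resO_self]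
        | h v => rw [wedgeRes_ιMulti]; simp only [res_self]
      map_comp := fun f g ↦ by
        refine AddCommGrpCat.hom_ext (AddMonoidHom.ext fun a ↦ ?_)
        change wedgeRes M _ a = wedgeRes M _ (wedgeRes M _ a)
        induction a using wedge_induction with
        | h0 => simp only [map_zero]
        | hadd a b ha hb => simp only [map_add, ha, hb]
        | hsmul c a ha => simp only [LinearMap.map_smulₛₗ, ha, resO_resO]
        | h v => simp only [wedgeRes_ιMulti, res_res] }
  letI (U : (X.Opens)ᵒᵖ) : Module (X.ringCatSheaf.obj.obj U) (P.obj U) :=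
    inferInstanceAs (Module Γ(X, U.unop) (⋀[Γ(X, U.unop)]^2 Γ(M, U.unop)))
  PresheafOfModules.ofPresheaf P (fun U V f c a ↦
    (wedgeRes M (leOfHom f.unop)).map_smulₛₗ c a)

/-- The sheaf `Λ² M`, the sheaf associated to `U ↦ Λ² M(U)`. It is the determinant `det M` if `M` is
a vector bundle of rank two. -/
def det (M : X.Modules) : X.Modules :=
  (PresheafOfModules.sheafification (𝟙 X.ringCatSheaf.obj)).obj (wedgePresheaf M)

/-- The section `s ∧ t` of `Λ² M`. -/
def wedge {M : X.Modules} {U : X.Opens} (s t : Γ(M, U)) : Γ(det M, U) :=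
  ((PresheafOfModules.sheafificationAdjunction (𝟙 X.ringCatSheaf.obj)).unit.app
    (wedgePresheaf M)).app (op U) (exteriorPower.ιMulti Γ(X, U) 2 ![s, t])

end Determinant

section Bundles

/-- `M` is a vector bundle of rank `r`: every point has an open neighbourhood `U` over which `M` has a
frame, i.e. `r` sections that form a basis of `M(V)` over `𝒪_X(V)` for all open `V ⊆ U`. -/
def IsVectorBundle (M : X.Modules) (r : ℕ) : Prop :=
  ∀ p : X, ∃ (U : X.Opens) (_ : p ∈ U) (e : Fin r → Γ(M, U)), ∀ (V : X.Opens) (h : V ≤ U),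
    LinearIndependent Γ(X, V) (fun i ↦ res M h (e i)) ∧
      Submodule.span Γ(X, V) (Set.range fun i ↦ res M h (e i)) = ⊤

/-- A quadratic form `E → 𝒪_X` on an `𝒪_X`-module `E`. -/
@[ext]
structure QuadForm (E : X.Modules) where
  form : ∀ U : X.Opens, QuadraticForm Γ(X, U) Γ(E, U)
  form_res : ∀ (U V : X.Opens) (h : V ≤ U) (s : Γ(E, U)), form V (res E h s) = resO h (form U s)

/-- `q` is the determinant form on `ℋom(F, G)`, for bundles `F`, `G` of rank two whose determinants
are identified by `δ`: `φ(s) ∧ φ(t) = q(φ) • δ(s ∧ t)`, i.e. `Λ² φ = q(φ) δ`. -/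
def IsDetForm {F G : X.Modules} (δ : det F ≅ det G) (q : QuadForm (homSheaf F G)) : Prop :=
  ∀ (U : X.Opens) (φ : Γ(homSheaf F G, U)) (V : X.Opens) (h : V ≤ U) (s t : Γ(F, V)),
    wedge (ev φ h s) (ev φ h t) = resO h (q.form U φ) • δ.hom.app V (wedge s t)

end Bundles

section Lagrangian

variable (K : Type u) [Field K] [X.Over (Spec (.of K))]

/-- The structure of a `K`-algebra on the local ring of a `K`-scheme. -/
instance stalkAlgebra (x : X) : Algebra K (X.presheaf.stalk x) :=
  ((X.presheaf.germ ⊤ x trivial).hom.comp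
    ((X ↘ Spec (.of K)).appTop.hom.comp (Scheme.ΓSpecIso (.of K)).inv.hom)).toAlgebra

instance (M : X.Modules) (x : X) (n : ℕ) : Module K (Thick M x n) :=
  Module.compHom _ (algebraMap K (X.presheaf.stalk x))

instance (M : X.Modules) (x : X) (n : ℕ) : IsScalarTower K (X.presheaf.stalk x) (Thick M x n) :=
  ⟨fun c a m ↦ by rw [Algebra.smul_def, mul_smul]; rfl⟩

/-- `L ⊆ E_{2x}` is a Lagrangian submodule, for a bundle `E` of rank `r` with quadratic form `q`: it
has dimension `r` over `K`, and it is isotropic for the quadratic form on `E_{2x}` with values in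
`𝒪_{X,x} / 𝔪^2` that is induced by `q`, under which the class of a section `s` has as its value
the class of `q(s)`. -/
structure IsLagrangian {E : X.Modules} (q : QuadForm E) (x : X) (r : ℕ)
    (L : Submodule (X.presheaf.stalk x) (Thick E x 2)) : Prop where
  isotropic : ∀ (U : X.Opens) (hx : x ∈ U) (s : Γ(E, U)), Thick.mk E x 2 (germ E hx s) ∈ L →
    X.presheaf.germ U x hx (q.form U s) ∈ mPow x 2
  finrank_eq : Module.finrank K L = r

/-- The stratum `OΣ_i(E_{2x})`: the Lagrangian submodules of `E_{2x}` whose image in the fibre of `E`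
at `x` has dimension `i`. -/
def OSigma {E : X.Modules} (q : QuadForm E) (x : X) (r i : ℕ) :
    Set (Submodule (X.presheaf.stalk x) (Thick E x 2)) :=
  {L | IsLagrangian K q x r L ∧ Module.finrank K (L.map (Thick.π E x)) = i}

end Lagrangian

section Grassmannian

variable (K W : Type*) [Field K] [AddCommGroup W] [Module K W]

/-- The polynomial functions on a vector space. -/
def polynomialFunctions : Subalgebra K (W → K) :=
  Algebra.adjoin K (Set.range fun (l : Module.Dual K W) (w : W) ↦ l w)

/-- The linearly independent `d`-tuples of vectors. -/
def Frame (d : ℕ) : Type _ := {v : Fin d → W // LinearIndependent K v}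

/-- The Zariski topology on frames, as a subset of the affine space `W^d`. -/
instance (d : ℕ) : TopologicalSpace (Frame K W d) :=
  TopologicalSpace.generateFrom
    {S | ∃ p ∈ polynomialFunctions K (Fin d → W), S = {v | p v.1 ≠ 0}}

/-- The Grassmannian of `d`-dimensional subspaces of `W`. -/
def Grassmannian (d : ℕ) : Type _ := {N : Submodule K W // Module.finrank K N = d}

/-- The subspace spanned by a frame. -/
def Frame.span {d : ℕ} (v : Frame K W d) : Grassmannian K W d :=
  ⟨Submodule.span K (Set.range v.1), by rw [finrank_span_eq_card v.2, Fintype.card_fin]⟩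

/-- The Zariski topology on the Grassmannian, as the quotient of the space of frames. -/
instance (d : ℕ) : TopologicalSpace (Grassmannian K W d) :=
  TopologicalSpace.coinduced (Frame.span K W) inferInstance

end Grassmannian

section RankFour

variable {F G : X.Modules} {x : X} {n : ℕ}

/-- The submodule `Hom(F_{nx}, M)` of `ℋom(F, G)_{nx}`, for `M ⊆ G_{nx}`. -/
def homInto (F : X.Modules) (M : Submodule (X.presheaf.stalk x) (Thick G x n)) :
    Submodule (X.presheaf.stalk x) (Thick (homSheaf F G) x n) where
  carrier := {e | ∀ f, Thick.eval x n F G e f ∈ M}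
  add_mem' ha hb f := by rw [map_add]; exact M.add_mem (ha f) (hb f)
  zero_mem' f := by rw [map_zero]; exact M.zero_mem
  smul_mem' c a ha f := by rw [map_smul]; exact M.smul_mem c (ha f)

/-- The submodule `Hom(F_{nx} / M, G_{nx})` of `ℋom(F, G)_{nx}`, for `M ⊆ F_{nx}`. -/
def homKilling (G : X.Modules) (M : Submodule (X.presheaf.stalk x) (Thick F x n)) :
    Submodule (X.presheaf.stalk x) (Thick (homSheaf F G) x n) where
  carrier := {e | ∀ f ∈ M, Thick.eval x n F G e f = 0}
  add_mem' ha hb f hf := by rw [map_add, LinearMap.add_apply, ha f hf, hb f hf, add_zero]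
  zero_mem' f _ := by rw [map_zero]; rfl
  smul_mem' c a ha f hf := by rw [map_smul, LinearMap.smul_apply, ha f hf, smul_zero]

/-- The orthogonal Hecke transform `ℋ(E, L) = E'(x)`, where `E'` is the kernel of `E → E_{2x} / L`. -/
def hecke (E : X.Modules) (x : X) (L : Submodule (X.presheaf.stalk x) (Thick E x 2)) : X.Modules :=
  twist (heckeTransform E x L) x

/-- `qH` is the quadratic form on `ℋ(E, L) = E'(x)` induced by the form `q` on `E ⊇ E'`. A section `h`
of `E'(x) = ℋom(𝒪_X(-x), E')` is `a⁻¹ h(a)` as a rational section of `E`, so that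
`q(h(a)) = a² qH(h)` for all local sections `a` of `𝒪_X(-x)`. -/
def IsHeckeForm {E : X.Modules} (q : QuadForm E)
    (L : Submodule (X.presheaf.stalk x) (Thick E x 2)) (qH : QuadForm (hecke E x L)) : Prop :=
  ∀ (U : X.Opens) (h : Γ(hecke E x L, U)) (V : X.Opens) (hV : V ≤ U) (a : Γ(pointIdeal x, V)),
    q.form V (heckeTransform.incl (ev h hV a)) =
      pointIdeal.incl a ^ 2 * resO hV (qH.form U h)

/-- `ℋ(E, L) = ℋom(F₁, G₁)` as orthogonal bundles: `F₁` and `G₁` are bundles of rank two with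
isomorphic determinants, and `ℋom(F₁, G₁)` with the determinant form is isometric to `ℋ(E, L)` with
the form induced by that of `E`. -/
def HeckeEqHom {E : X.Modules} (q : QuadForm E)
    (L : Submodule (X.presheaf.stalk x) (Thick E x 2)) (F₁ G₁ : X.Modules) : Prop :=
  IsVectorBundle F₁ 2 ∧ IsVectorBundle G₁ 2 ∧
    ∃ (qH : QuadForm (hecke E x L)) (δ₁ : det F₁ ≅ det G₁) (q₁ : QuadForm (homSheaf F₁ G₁))
      (Ψ : homSheaf F₁ G₁ ≅ hecke E x L),
      IsHeckeForm q L qH ∧ IsDetForm δ₁ q₁ ∧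
        ∀ (U : X.Opens) (ψ : Γ(homSheaf F₁ G₁, U)), qH.form U (Ψ.hom.app U ψ) = q₁.form U ψ

variable (K : Type u) [Field K] [X.Over (Spec (.of K))]

/-- The image of `L` in the fibre `Hom(F_x, G_x)` is `Hom(F_x, D)` for a line `D ⊆ G_x`. -/
def HasImageLine (L : Submodule (X.presheaf.stalk x) (Thick (homSheaf F G) x 2)) : Prop :=
  ∃ D : Submodule (X.presheaf.stalk x) (Thick G x 1),
    Module.finrank K D = 1 ∧ L.map (Thick.π _ x) = homInto F D

/-- The image of `L` in the fibre `Hom(F_x, G_x)` is `Hom(F_x / D, G_x)` for a line `D ⊆ F_x`. -/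
def HasKernelLine (L : Submodule (X.presheaf.stalk x) (Thick (homSheaf F G) x 2)) : Prop :=
  ∃ D : Submodule (X.presheaf.stalk x) (Thick F x 1),
    Module.finrank K D = 1 ∧ L.map (Thick.π _ x) = homKilling G D

/-- A set of submodules of `E_{2x}`, as a set of points of the Grassmannian of `d`-dimensional
`K`-subspaces of `E_{2x}`. -/
def grassmannianSet {E : X.Modules} (d : ℕ)
    (S : Set (Submodule (X.presheaf.stalk x) (Thick E x 2))) :
    Set (Grassmannian K (Thick E x 2) d) :=
  {N | ∃ L ∈ S, L.restrictScalars K = N.1}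

end RankFour

end OrthHecke

end

open OrthHecke

noncomputable section
namespace OrthHecke

/-! All sheaves that occur are compared inside vector spaces over the function field. An `Emb`
embeds a sheaf in a constant sheaf `V`. The sheaf is then recovered from its lattices `Emb.lat` at
the points of the curve, and two sheaves with the same lattices in the same space are isomorphic by
the identity of that space (`Emb.exists_iso`). Homomorphism sheaves, Hecke transforms, twists and
determinants all have computable lattices: `Emb.mem_lat_hom`, `Emb.mem_lat_ofTransform`,
`Emb.mem_lat_ofTwist`, `Emb.mem_lat_ofDet`. If `V` and `W` are the generic fibres of `F` and `G`,
volume forms matched by `δ` define one quadratic form `Q` on `Hom(V, W)`, and every quadratic form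
in the statement is induced by `Q`. An equality of lattices therefore gives an isometry at once
(`heckeEqHom_of_lat`).

Away from `x` nothing changes. At `x` the local ring `R` is a discrete valuation ring with residue
field `K` and parameter `t`. In bases of the stalks, `ℋom(F, G)` becomes `M₂(R)` and `q` becomes the
determinant up to a unit. A Lagrangian `L` becomes a lattice `P` with `t² M₂(R) ⊆ P ⊆ M₂(R)` whose
elements have determinant divisible by `t²`. The dimension of `L` is the sum of the dimensions of
`P` mod `t` and of `t⁻¹P ∩ M₂(R)` mod `t` (`finrank_lagrangian`).

If the first of these dimensions is 1, the second space is the polar hyperplane of a matrix of rank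
one. Elimination gives bases in which `P` is defined by divisibility of the entries by `1, t, t, t²`
(`Residue.exists_normalForm_of_finrank_one`). If both dimensions are 2, the two spaces coincide and
form a plane of singular matrices, so all columns, or all rows, are proportional to one vector
(`eq_columnSpace_or_rowSpace`). Polarising the determinant lifts this proportionality from `t` to
`t²` (`Residue.eq_columnLattice`), and a change of basis makes `P` the matrices whose second row, or
second column, vanishes mod `t²`.

In each normal form the entries are divisible by powers `t^(n i j)` with `n i j = β i - α j + 1`.
This says that `t⁻¹P` is the lattice of homomorphisms from `F` rescaled by `t^α` to `G` rescaled by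
`t^β`, and the rescaled bundles are the Hecke transforms and twists of the theorem
(`heckeEqHom_of_coord`).

For the components, the spaces with columns proportional to `w` have a frame that is linear in `w`.
Two of them are joined by an affine line with at most one parameter removed, which is connected
(`isPreconnected_columnFamily`). The vanishing of the mixed minors of the reductions is a closed
condition that holds for the column type and fails for the row type; transposition exchanges the
roles (`exists_isClosed_columnFamily`). -/

/-! ### Local rings of smooth algebras of relative dimension one -/

open IsLocalRing in
-- The module of differentials is free on one generator, so an element of `p` is controlled modulo
-- `𝔪²` by a single derivative `d`. A function in `p` with invertible derivative then generates `𝔪`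
-- by Nakayama.
theorem isDiscreteValuationRing_of_isStandardSmooth {K A R : Type*} [CommRing K] [CommRing A]
    [CommRing R] [IsDomain R] [IsLocalRing R] [IsNoetherianRing R] [Algebra K A] [Algebra K R]
    [Algebra A R] [IsScalarTower K A R] (p : Ideal A) [p.IsPrime] [IsLocalization.AtPrime R p]
    (hinj : Function.Injective (algebraMap A R))
    (hb : Function.Bijective (algebraMap K (ResidueField R)))
    [Algebra.IsStandardSmoothOfRelativeDimension 1 K A] : IsDiscreteValuationRing R := by
  have hmem : ∀ a : A, algebraMap A R a ∈ maximalIdeal R ↔ a ∈ p := fun a ↦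
    (IsLocalization.AtPrime.to_map_mem_maximal_iff R p a)
  let e : K ≃+* ResidueField R := RingEquiv.ofBijective _ hb
  let s : A →+* K := e.symm.toRingHom.comp ((residue R).comp (algebraMap A R))
  have hs : ∀ a, algebraMap A R a - algebraMap K R (s a) ∈ maximalIdeal R := fun a ↦ by
    rw [← residue_eq_zero_iff, map_sub, sub_eq_zero]
    exact (e.apply_symm_apply _).symm
  have hsK : ∀ c : K, s (algebraMap K A c) = c := fun c ↦ by
    change e.symm (residue R (algebraMap A R (algebraMap K A c))) = c
    rw [← IsScalarTower.algebraMap_apply]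
    exact e.symm_apply_apply c
  have hsp : ∀ a ∈ p, s a = 0 := fun a ha ↦ by
    change e.symm (residue R (algebraMap A R a)) = 0
    rw [(residue_eq_zero_iff _).2 ((hmem a).2 ha), map_zero]
  -- The point derivation `a ↦ a - a(x)` modulo `𝔪²`, where `s a` is the value `a(x)`.
  let D : Derivation K A (maximalIdeal R).Cotangent := Derivation.mk'
    { toFun := fun a ↦ (maximalIdeal R).toCotangent ⟨_, hs a⟩
      map_add' := fun a b ↦ by
        rw [← map_add]; congr 1; ext; simp; ring
      map_smul' := fun c a ↦ by
        rw [RingHom.id_apply, ← algebraMap_smul R c (Ideal.toCotangent _ _), ← map_smul]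
        congr 1; ext; simp [Algebra.smul_def, hsK, ← IsScalarTower.algebraMap_apply]; ring }
    (fun a b ↦ by
      change (maximalIdeal R).toCotangent _ = a • (maximalIdeal R).toCotangent _ +
        b • (maximalIdeal R).toCotangent _
      rw [← algebraMap_smul R a, ← algebraMap_smul R b, ← map_smul, ← map_smul, ← map_add,
        Ideal.toCotangent_eq]
      have := Ideal.mul_mem_mul (hs a) (hs b)
      rw [← pow_two] at this
      convert neg_mem this using 1
      simp [Algebra.smul_def]; ring)
  have hD : ∀ a ∈ p, D a = 0 → algebraMap A R a ∈ maximalIdeal R ^ 2 := fun a ha h ↦ by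
    have h' : (maximalIdeal R).toCotangent ⟨_, hs a⟩ = 0 := h
    rw [Ideal.toCotangent_eq_zero] at h'
    simpa [hsp a ha] using h'
  have hpN : ∀ a ∈ p, ∀ n : (maximalIdeal R).Cotangent, a • n = 0 := fun a ha n ↦ by
    obtain ⟨n, rfl⟩ := Ideal.toCotangent_surjective _ n
    rw [← algebraMap_smul R a, ← map_smul, Ideal.toCotangent_eq_zero, pow_two]
    exact Ideal.mul_mem_mul ((hmem a).2 ha) n.2
  have : Nontrivial A := (algebraMap A R).domain_nontrivial
  have : Algebra.IsStandardSmooth K A :=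
    Algebra.IsStandardSmoothOfRelativeDimension.isStandardSmooth 1
  have hrank : Module.finrank A (Ω[A⁄K]) = 1 := Module.finrank_eq_of_rank_eq
    (Algebra.IsStandardSmoothOfRelativeDimension.rank_kaehlerDifferential 1)
  let w : Module.Basis (Fin 1) A (Ω[A⁄K]) := Module.finBasisOfFinrankEq A _ hrank
  let d : A → A := fun a ↦ w.repr (KaehlerDifferential.D K A a) 0
  have hd : ∀ a, KaehlerDifferential.D K A a = d a • w 0 := fun a ↦ by
    simpa using (w.sum_repr (KaehlerDifferential.D K A a)).symm
  -- `D` factors through the differentials, hence through `d`, and `p` kills the cotangent space.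
  have key : ∀ c ∈ p, d c ∈ p → algebraMap A R c ∈ maximalIdeal R ^ 2 := fun c hc hdc ↦ by
    refine hD c hc ?_
    rw [← D.liftKaehlerDifferential_comp_D, hd, map_smul, hpN _ hdc]
  have hmap : maximalIdeal R = p.map (algebraMap A R) :=
    (IsLocalization.AtPrime.map_eq_maximalIdeal p R).symm
  -- If no derivative is invertible, then `𝔪 = 𝔪²`, so `𝔪 = 0`. In that case `K → A` is surjective
  -- and there are no differentials, against rank one.
  by_cases H : ∀ a ∈ p, d a ∈ p
  · exfalso
    have h1 : maximalIdeal R ≤ ⊥ ⊔ maximalIdeal R • maximalIdeal R := by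
      rw [bot_sup_eq, smul_eq_mul, ← pow_two]
      conv_lhs => rw [hmap]
      exact Ideal.map_le_iff_le_comap.2 fun a ha ↦ key a ha (H a ha)
    have h2 := Submodule.le_of_le_smul_of_le_jacobson_bot (IsNoetherian.noetherian _)
      (maximalIdeal_le_jacobson _) h1
    have h3 : Function.Surjective (algebraMap K A) := fun a ↦ ⟨s a, hinj (by
      have := h2 (hs a)
      rw [Ideal.mem_bot, sub_eq_zero] at this
      rw [this, ← IsScalarTower.algebraMap_apply])⟩
    have := KaehlerDifferential.subsingleton_of_surjective K A h3
    rw [Module.finrank_zero_of_subsingleton] at hrank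
    exact zero_ne_one hrank
  · push Not at H
    obtain ⟨a, ha, hda⟩ := H
    have hu : IsUnit (algebraMap A R (d a)) := by
      rw [← notMem_maximalIdeal, hmem]; exact hda
    have h1 : maximalIdeal R ≤ Ideal.span {algebraMap A R a} ⊔ maximalIdeal R • maximalIdeal R := by
      conv_lhs => rw [hmap]
      refine Ideal.map_le_iff_le_comap.2 fun b hb ↦ ?_
      rw [Ideal.mem_comap, ← Ideal.unit_mul_mem_iff_mem _ hu]
      -- This combination is chosen because the first-order terms of its derivative cancel. Only
      -- multiples of `a` and `b` remain.
      have h2 := key (d b * a - d a * b) (sub_mem (p.mul_mem_left _ ha) (p.mul_mem_left _ hb)) (by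
        have : d (d b * a - d a * b) = a * d (d b) - b * d (d a) := by
          simp [d, mul_comm]
        rw [this]
        exact sub_mem (p.mul_mem_right _ ha) (p.mul_mem_right _ hb))
      have e : algebraMap A R (d a) * algebraMap A R b = algebraMap A R (d b) * algebraMap A R a -
          algebraMap A R (d b * a - d a * b) := by simp
      rw [e, smul_eq_mul, ← pow_two]
      exact sub_mem (Ideal.mem_sup_left (Ideal.mul_mem_left _ _ (Ideal.mem_span_singleton_self _)))
        (Ideal.mem_sup_right h2)
    have h2 := Submodule.le_of_le_smul_of_le_jacobson_bot (IsNoetherian.noetherian _)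
      (maximalIdeal_le_jacobson _) h1
    have h3 : maximalIdeal R = Ideal.span {algebraMap A R a} :=
      le_antisymm h2 (by rw [Ideal.span_singleton_le_iff_mem]; exact (hmem a).2 ha)
    have h4 : ¬ IsField R := fun hf ↦ by
      have := isField_iff_maximalIdeal_eq.1 hf
      have h5 := (hmem a).2 ha
      rw [this, Ideal.mem_bot, ← map_zero (algebraMap A R)] at h5
      apply hda
      rw [hinj h5]
      simp [d]
    have h6 : (maximalIdeal R).IsPrincipal := ⟨_, h3⟩
    exact ((IsDiscreteValuationRing.TFAE R h4).out 0 4).2 h6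

/-! ### Closed points of a smooth curve and their local parameters -/

section Curve
variable {K : Type u} [Field K] {X : Scheme.{u}} [X.Over (Spec (.of K))]

theorem isNoetherianRing_stalk [IsProper (X ↘ Spec (.of K))] (x : X) :
    IsNoetherianRing (X.presheaf.stalk x) := by
  have := LocallyOfFiniteType.isLocallyNoetherian (X ↘ Spec (.of K))
  infer_instance

/-- By the Nullstellensatz the residue field of a closed point is the base field. The work is to
identify the abstract isomorphism with the algebra structure that was put on the local ring. -/
theorem bijective_algebraMap_residueField [IsAlgClosed K] [IsProper (X ↘ Spec (.of K))] (x : X)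
    (hx : IsClosed {x}) :
    Function.Bijective (algebraMap K (IsLocalRing.ResidueField (X.presheaf.stalk x))) := by
  have e := SpecMap_residueFieldIsoBase_inv (X ↘ Spec (.of K)) x hx
  have h : X.fromSpecResidueField x ≫ (X ↘ Spec (.of K)) =
      Spec.map ((Scheme.ΓSpecIso (.of K)).inv ≫ (X ↘ Spec (.of K)).appTop ≫
        X.presheaf.germ ⊤ x trivial ≫ X.residue x) := by
    rw [← cancel_mono (Spec (.of K)).toSpecΓ]
    rw [Scheme.fromSpecResidueField, Category.assoc, Category.assoc, Scheme.toSpecΓ_naturality,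
      Scheme.fromSpecStalk_toSpecΓ_assoc, ← SpecMap_ΓSpecIso_hom]
    simp only [← Spec.map_comp, Category.assoc, Iso.hom_inv_id_assoc]
  rw [h] at e
  have e' := Spec.map_injective e
  have : Function.Bijective (residueFieldIsoBase (X ↘ Spec (.of K)) x hx).inv.hom :=
    ConcreteCategory.bijective_of_isIso (residueFieldIsoBase (X ↘ Spec (.of K)) x hx).inv
  rw [e'] at this
  exact this

theorem isDiscreteValuationRing_stalk [IsAlgClosed K] [IsIntegral X]
    [IsProper (X ↘ Spec (.of K))] [SmoothOfRelativeDimension 1 (X ↘ Spec (.of K))] (x : X)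
    (hx : IsClosed {x}) : IsDiscreteValuationRing (X.presheaf.stalk x) := by
  have := isNoetherianRing_stalk (K := K) x
  obtain ⟨U, hU, V, hV, hxV, hVU, h⟩ :=
    SmoothOfRelativeDimension.exists_isStandardSmoothOfRelativeDimension
      (n := 1) (f := X ↘ Spec (.of K)) x
  -- `Spec K` has only one point, so the chart lies over the whole base.
  obtain rfl : U = ⊤ := by
    have : Subsingleton (Spec (.of K)) := inferInstanceAs (Subsingleton (PrimeSpectrum K))
    exact top_unique fun y _ ↦ Subsingleton.elim ((X ↘ Spec (.of K)) x) y ▸ hVU hxV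
  algebraize [((X ↘ Spec (.of K)).appLE ⊤ V hVU).hom]
  let _ : Algebra Γ(X, V) (X.presheaf.stalk x) := (X.presheaf.germ V x hxV).hom.toAlgebra
  -- The smooth chart is an algebra over `Γ(Spec K, ⊤)`, a copy of `K`. The criterion is applied
  -- over this copy, and bijectivity to the residue field is transported from `K`.
  let _ : Algebra Γ(Spec (.of K), ⊤) (X.presheaf.stalk x) :=
    ((algebraMap Γ(X, V) (X.presheaf.stalk x)).comp (algebraMap Γ(Spec (.of K), ⊤) Γ(X, V))).toAlgebra
  have : IsScalarTower Γ(Spec (.of K), ⊤) Γ(X, V) (X.presheaf.stalk x) := .of_algebraMap_eq' rfl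
  have : IsLocalization.AtPrime (X.presheaf.stalk x) (hV.primeIdealOf ⟨x, hxV⟩).asIdeal :=
    hV.isLocalization_stalk ⟨x, hxV⟩
  refine isDiscreteValuationRing_of_isStandardSmooth (K := Γ(Spec (.of K), ⊤)) (A := Γ(X, V))
    (hV.primeIdealOf ⟨x, hxV⟩).asIdeal (germ_injective_of_isIntegral X x hxV) ?_
  have e : (algebraMap Γ(Spec (.of K), ⊤) (X.presheaf.stalk x)).comp
      (Scheme.ΓSpecIso (.of K)).inv.hom = algebraMap K (X.presheaf.stalk x) := by
    ext c
    change X.presheaf.germ V x hxV (Scheme.Hom.appLE _ ⊤ V hVU _) =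
      X.presheaf.germ ⊤ x trivial (Scheme.Hom.appTop _ _)
    rw [Scheme.Hom.appLE, CommRingCat.comp_apply]
    exact TopCat.Presheaf.germ_res_apply X.presheaf _ x hxV _
  have hb := bijective_algebraMap_residueField (K := K) x hx
  have hi : Function.Bijective (Scheme.ΓSpecIso (.of K)).inv.hom :=
    ConcreteCategory.bijective_of_isIso (Scheme.ΓSpecIso (.of K)).inv
  refine (Function.Bijective.of_comp_iff _ hi).1 ?_
  convert hb using 1
  exact congrArg (fun f : K →+* X.presheaf.stalk x ↦ (IsLocalRing.residue _ ∘ f)) e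

/-- In an affine neighbourhood the prime `P` of `x` is finitely generated, so one denominator `s ∉
P` satisfies `s P ⊆ (a)`, where `a` generates the maximal ideal. Where `s` is invertible, a zero of
`a` is a zero of `P`, hence lies in the closure of `x`, which is `x` alone. -/
theorem exists_uniformizer_nhd [IsAlgClosed K] [IsIntegral X]
    [IsProper (X ↘ Spec (.of K))] [SmoothOfRelativeDimension 1 (X ↘ Spec (.of K))] (x : X)
    (hx : IsClosed {x}) : ∃ (U : X.Opens) (hxU : x ∈ U) (t : Γ(X, U)),
      IsLocalRing.maximalIdeal (X.presheaf.stalk x) = Ideal.span {X.presheaf.germ U x hxU t} ∧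
      ∀ (p : X) (hp : p ∈ U), p ≠ x → IsUnit (X.presheaf.germ U p hp t) := by
  have hdvr := isDiscreteValuationRing_stalk (K := K) x hx
  have := LocallyOfFiniteType.isLocallyNoetherian (X ↘ Spec (.of K))
  obtain ⟨_, ⟨V, hV, rfl⟩, hxV, -⟩ :=
    X.isBasis_affineOpens.exists_subset_of_mem_open (Set.mem_univ x) isOpen_univ
  have hxV : x ∈ V := hxV
  have : IsNoetherianRing Γ(X, V) := IsLocallyNoetherian.component_noetherian ⟨V, hV⟩
  set P := (hV.primeIdealOf ⟨x, hxV⟩).asIdeal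
  let _ : Algebra Γ(X, V) (X.presheaf.stalk x) := (X.presheaf.germ V x hxV).hom.toAlgebra
  have : IsLocalization.AtPrime (X.presheaf.stalk x) P := hV.isLocalization_stalk ⟨x, hxV⟩
  have hinj : Function.Injective (algebraMap Γ(X, V) (X.presheaf.stalk x)) :=
    germ_injective_of_isIntegral X x hxV
  have hmem : ∀ a, algebraMap Γ(X, V) (X.presheaf.stalk x) a ∈
      IsLocalRing.maximalIdeal (X.presheaf.stalk x) ↔ a ∈ P := fun a ↦
    IsLocalization.AtPrime.to_map_mem_maximal_iff (X.presheaf.stalk x) P a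
  have hunit : ∀ s : P.primeCompl, IsUnit (algebraMap Γ(X, V) (X.presheaf.stalk x) s) :=
    fun s ↦ IsLocalization.map_units _ s
  obtain ⟨a, ha⟩ : ∃ a, IsLocalRing.maximalIdeal (X.presheaf.stalk x) =
      Ideal.span {algebraMap Γ(X, V) (X.presheaf.stalk x) a} := by
    obtain ⟨w, hw⟩ := IsDiscreteValuationRing.exists_irreducible (X.presheaf.stalk x)
    obtain ⟨⟨a, s⟩, h⟩ := IsLocalization.surj P.primeCompl w
    refine ⟨a, ?_⟩
    rw [hw.maximalIdeal_eq, ← h, Ideal.span_singleton_mul_right_unit (hunit s)]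
  have hfg : P.FG := IsNoetherian.noetherian P
  -- The product of the denominators for a finite set of generators of `P`.
  obtain ⟨s, hsP, hs⟩ : ∃ s ∉ P, ∀ g ∈ P, a ∣ s * g := by
    have h1 : ∀ g ∈ P, ∃ s ∉ P, a ∣ s * g := fun g hg ↦ by
      have := (hmem g).2 hg
      rw [ha, Ideal.mem_span_singleton] at this
      obtain ⟨c, hc⟩ := this
      obtain ⟨⟨r, s⟩, h⟩ := IsLocalization.surj P.primeCompl c
      refine ⟨s, s.2, r, hinj ?_⟩
      rw [map_mul, map_mul, ← h, hc]; ring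
    obtain ⟨S, hS⟩ := hfg
    have hSP : ∀ g ∈ S, g ∈ P := fun g hg ↦ hS ▸ Submodule.subset_span hg
    choose! f hf hf' using h1
    refine ⟨∏ g ∈ S, f g, fun h ↦ ?_, fun g hg ↦ ?_⟩
    · obtain ⟨g, hg, h⟩ := (Ideal.IsPrime.prod_mem_iff (p := P)).1 h
      exact hf g (hSP g hg) h
    · rw [← hS] at hg
      induction hg using Submodule.span_induction with
      | mem g hg =>
        exact (hf' g (hSP g hg)).trans (mul_dvd_mul_right (Finset.dvd_prod_of_mem f hg) g)
      | zero => simp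
      | add g g' _ _ h h' => rw [mul_add]; exact dvd_add h h'
      | smul c g _ h => rw [smul_eq_mul, mul_left_comm]; exact h.mul_left c
  have hle : X.basicOpen s ≤ V := X.basicOpen_le s
  have hxs : x ∈ X.basicOpen s := by
    rw [Scheme.mem_basicOpen X s x hxV]
    exact hunit ⟨s, hsP⟩
  refine ⟨X.basicOpen s, hxs, resO hle a, ?_, fun p hp hpx ↦ ?_⟩
  · rw [germ_resO]; exact ha
  · rw [germ_resO]
    by_contra hnu
    have hpV : p ∈ V := hle hp
    have hps : IsUnit (X.presheaf.germ V p hpV s) := (Scheme.mem_basicOpen X s p hpV).1 hp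
    have h1 : ∀ g ∈ P, ¬ IsUnit (X.presheaf.germ V p hpV g) := fun g hg hu ↦ by
      obtain ⟨c, hc⟩ := hs g hg
      have := congrArg (X.presheaf.germ V p hpV) hc
      rw [map_mul, map_mul] at this
      exact hnu (isUnit_of_mul_isUnit_left (this ▸ hps.mul hu))
    have h2 : p ∈ closure {x} := by
      rw [mem_closure_iff]
      intro W hW hpW
      obtain ⟨g, hg, hpg⟩ := hV.exists_basicOpen_le (V := ⟨W, hW⟩) ⟨p, hpW⟩ hpV
      refine ⟨x, ?_, rfl⟩
      by_contra hxW
      have h3 : g ∈ P := by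
        rw [← hmem, IsLocalRing.mem_maximalIdeal, mem_nonunits_iff]
        exact fun h ↦ hxW (hg ((Scheme.mem_basicOpen X g x hxV).2 h))
      exact h1 g h3 ((Scheme.mem_basicOpen X g p hpV).1 hpg)
    rw [hx.closure_eq] at h2
    exact hpx h2

end Curve

/-! ### Sheaves as families of lattices over the function field -/

section Lattices
variable {X : Scheme.{u}} [IsIntegral X]

theorem genericPoint_mem {p : X} {U : X.Opens} (hp : p ∈ U) : genericPoint X ∈ U :=
  (genericPoint_specializes p).mem_open U.2 hp

/-- The rational functions that are regular at `p`. -/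
def reg (p : X) : Subring X.functionField :=
  (algebraMap (X.presheaf.stalk p) X.functionField).range

theorem algebraMap_germ {U : X.Opens} {p : X} (hp : p ∈ U) (a : Γ(X, U)) :
    algebraMap (X.presheaf.stalk p) X.functionField (X.presheaf.germ U p hp a) =
      X.presheaf.germ U _ (genericPoint_mem hp) a := by
  have : Nonempty U := ⟨⟨p, hp⟩⟩
  exact Scheme.algebraMap_germ_eq_germToFunctionField X hp a

theorem germ_mem_reg {U : X.Opens} {p : X} (hp : p ∈ U) (a : Γ(X, U)) :
    X.presheaf.germ U _ (genericPoint_mem hp) a ∈ reg p :=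
  ⟨X.presheaf.germ U p hp a, algebraMap_germ hp a⟩

theorem exists_of_mem_reg {p : X} {c : X.functionField} (hc : c ∈ reg p) :
    ∃ (U : X.Opens) (hp : p ∈ U) (a : Γ(X, U)),
      X.presheaf.germ U _ (genericPoint_mem hp) a = c := by
  obtain ⟨c, rfl⟩ := hc
  obtain ⟨U, hU, a, rfl⟩ := X.presheaf.exists_germ_eq c
  exact ⟨U, hU, a, (algebraMap_germ hU a).symm⟩

theorem subsingleton_sections (M : X.Modules) {U : X.Opens} (hU : genericPoint X ∉ U) :
    Subsingleton Γ(M, U) :=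
  ⟨fun s t ↦ eq_of_locally M s t fun _ hp ↦ (hU (genericPoint_mem hp)).elim⟩

theorem subsingleton_functions {U : X.Opens} (hU : genericPoint X ∉ U) :
    Subsingleton Γ(X, U) :=
  subsingleton_sections (structureSheaf X) hU

/-- An open set without the generic point is empty, so its ring of functions is trivial. The
quantified hypothesis avoids splitting this case off at every use. -/
theorem function_ext {U : X.Opens} {a b : Γ(X, U)}
    (h : ∀ hU : genericPoint X ∈ U, X.presheaf.germ U _ hU a = X.presheaf.germ U _ hU b) :
    a = b := by
  by_cases hU : genericPoint X ∈ U
  · exact germ_injective_of_isIntegral X _ hU (h hU)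
  · exact (subsingleton_functions hU).elim _ _

variable (M N : X.Modules) (V W : Type u) [AddCommGroup V] [Module X.functionField V]
  [AddCommGroup W] [Module X.functionField W]

/-- An embedding of an `𝒪_X`-module in the constant sheaf of a vector space over the function
field. -/
structure Emb where
  j : ∀ {U : X.Opens}, genericPoint X ∈ U → Γ(M, U) →+ V
  j_smul : ∀ {U : X.Opens} (h : genericPoint X ∈ U) (a : Γ(X, U)) (s : Γ(M, U)),
    j h (a • s) = X.presheaf.germ U _ h a • j h s
  j_res : ∀ {U U' : X.Opens} (i : U' ≤ U) (h : genericPoint X ∈ U') (s : Γ(M, U)),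
    j h (res M i s) = j (i h) s
  inj : ∀ {U : X.Opens} (h : genericPoint X ∈ U) (s : Γ(M, U)), j h s = 0 → s = 0

variable {M N V W}

namespace Emb

theorem j_injective (E : Emb M V) {U : X.Opens} (h : genericPoint X ∈ U) :
    Function.Injective (E.j h) :=
  (injective_iff_map_eq_zero _).2 (E.inj h)

theorem section_ext (E : Emb M V) {U : X.Opens} {s t : Γ(M, U)}
    (h : ∀ hU : genericPoint X ∈ U, E.j hU s = E.j hU t) : s = t := by
  by_cases hU : genericPoint X ∈ U
  · exact E.j_injective hU (h hU)
  · exact (subsingleton_sections M hU).elim _ _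

/-- The lattice of `M` at `p`: the values of the sections of `M` near `p`. -/
def lat (E : Emb M V) (p : X) : AddSubgroup V where
  carrier := {v | ∃ (U : X.Opens) (hp : p ∈ U) (s : Γ(M, U)), E.j (genericPoint_mem hp) s = v}
  add_mem' := by
    rintro _ _ ⟨U, hU, s, rfl⟩ ⟨U', hU', s', rfl⟩
    refine ⟨U ⊓ U', ⟨hU, hU'⟩, res M inf_le_left s + res M inf_le_right s', ?_⟩
    rw [map_add, E.j_res, E.j_res]
  zero_mem' := ⟨⊤, trivial, 0, map_zero _⟩
  neg_mem' := by
    rintro _ ⟨U, hU, s, rfl⟩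
    exact ⟨U, hU, -s, map_neg _ _⟩

theorem j_mem_lat (E : Emb M V) {U : X.Opens} {p : X} (hp : p ∈ U) (h : genericPoint X ∈ U)
    (s : Γ(M, U)) : E.j h s ∈ E.lat p := ⟨U, hp, s, rfl⟩

theorem smul_mem_lat (E : Emb M V) {p : X} {c : X.functionField} (hc : c ∈ reg p) {v : V}
    (hv : v ∈ E.lat p) : c • v ∈ E.lat p := by
  obtain ⟨U, hU, s, rfl⟩ := hv
  obtain ⟨U', hU', a, rfl⟩ := exists_of_mem_reg hc
  refine ⟨U ⊓ U', ⟨hU, hU'⟩, (resO inf_le_right a : Γ(X, U ⊓ U')) •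
    (res M inf_le_left s : Γ(M, U ⊓ U')), ?_⟩
  rw [E.j_smul, E.j_res, germ_resO]

/-- The local representatives of `v` agree on overlaps, since they have the same value in `V` and
the embedding is injective, so they glue. -/
theorem exists_section (E : Emb M V) {U : X.Opens} (h : genericPoint X ∈ U) {v : V}
    (hv : ∀ p ∈ U, v ∈ E.lat p) : ∃ s : Γ(M, U), E.j h s = v := by
  choose U' hp s hs using fun p : U ↦ hv p p.2
  obtain ⟨t, ht⟩ := exists_glue M (U := U) (fun p ↦ U ⊓ U' p) (fun p ↦ inf_le_left)
    (fun p hpU ↦ ⟨⟨p, hpU⟩, hpU, hp _⟩) (fun p ↦ res M inf_le_right (s p))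
    (fun p q W hi hj ↦ E.section_ext fun hW ↦ by
      simp only [E.j_res, hs])
  refine ⟨t, ?_⟩
  have := congrArg (E.j (show genericPoint X ∈ U ⊓ U' ⟨_, h⟩ from
    ⟨h, genericPoint_mem (hp ⟨_, h⟩)⟩)) (ht ⟨_, h⟩)
  rwa [E.j_res, E.j_res, hs] at this

/-- A linear map that is compatible with the lattices on `U` gives a morphism on `U`. -/
theorem exists_localHom (E : Emb M V) (E' : Emb N W) (T : V →ₗ[X.functionField] W) {U : X.Opens}
    (hT : ∀ p ∈ U, ∀ v ∈ E.lat p, T v ∈ E'.lat p) :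
    ∃ φ : LocalHom M N U, ∀ (U' : X.Opens) (i : U' ≤ U) (h : genericPoint X ∈ U') (s : Γ(M, U')),
      E'.j h (φ.toFun U' i s) = T (E.j h s) := by
  have key : ∀ (U' : X.Opens) (_ : U' ≤ U) (s : Γ(M, U')), ∃ t : Γ(N, U'),
      ∀ h : genericPoint X ∈ U', E'.j h t = T (E.j h s) := fun U' i s ↦ by
    by_cases h : genericPoint X ∈ U'
    · obtain ⟨t, ht⟩ := E'.exists_section h (v := T (E.j h s))
        (fun p hp ↦ hT p (i hp) _ (E.j_mem_lat hp h s))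
      exact ⟨t, fun _ ↦ ht⟩
    -- On the empty open set any value will do.
    · exact ⟨0, fun h' ↦ (h h').elim⟩
  choose! f hf using key
  refine ⟨⟨fun U' i ↦ ⟨⟨f U', fun s t ↦ ?_⟩, fun c s ↦ ?_⟩, fun U' U'' i i' s ↦ ?_⟩,
    fun U' i h s ↦ hf U' i s h⟩
  · refine E'.section_ext fun h ↦ ?_
    simp only [map_add, hf U' i _ h]
  · refine E'.section_ext fun h ↦ ?_
    simp only [E.j_smul, E'.j_smul, map_smul, hf U' i _ h, RingHom.id_apply]
  · refine E'.section_ext fun h ↦ ?_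
    change E'.j h (res N i' (f U' s)) = E'.j h (f U'' (res M i' s))
    rw [E'.j_res, hf U' i _ (i' h), hf U'' (i'.trans i) _ h, E.j_res]

end Emb

/-- A family of linear maps on sections as a morphism of sheaves. -/
def LocalHom.toHom (φ : LocalHom M N ⊤) : M ⟶ N :=
  ⟨{ app := fun U ↦ ModuleCat.ofHom (φ.toFun U.unop le_top)
     naturality := fun {U U'} f ↦ by
      refine ModuleCat.hom_ext (LinearMap.ext fun s ↦ ?_)
      exact (φ.comm U.unop U'.unop le_top (leOfHom f.unop) s).symm }⟩

namespace Emb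

theorem hom_ext {E : Emb N W} {f g : M ⟶ N}
    (h : ∀ (U : X.Opens) (hU : genericPoint X ∈ U) (s : Γ(M, U)),
      E.j hU (f.app U s) = E.j hU (g.app U s)) : f = g := by
  refine Scheme.Modules.hom_ext _ _ fun U ↦ AddCommGrpCat.hom_ext (AddMonoidHom.ext fun s ↦ ?_)
  exact E.section_ext fun hU ↦ h U hU s

theorem exists_hom (E : Emb M V) (E' : Emb N W) (T : V →ₗ[X.functionField] W)
    (hT : ∀ p, ∀ v ∈ E.lat p, T v ∈ E'.lat p) :
    ∃ f : M ⟶ N, ∀ (U : X.Opens) (h : genericPoint X ∈ U) (s : Γ(M, U)),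
      E'.j h (f.app U s) = T (E.j h s) := by
  obtain ⟨φ, hφ⟩ := exists_localHom E E' T (U := ⊤) fun p _ ↦ hT p
  exact ⟨φ.toHom, fun U h s ↦ hφ U le_top h s⟩

/-- Sheaves with the same lattices are isomorphic. -/
theorem exists_iso (E : Emb M V) (E' : Emb N V) (hT : ∀ p, E.lat p = E'.lat p) :
    ∃ f : M ≅ N, ∀ (U : X.Opens) (h : genericPoint X ∈ U) (s : Γ(M, U)),
      E'.j h (f.hom.app U s) = E.j h s := by
  obtain ⟨f, hf⟩ := exists_hom E E' LinearMap.id fun p v hv ↦ hT p ▸ hv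
  obtain ⟨g, hg⟩ := exists_hom E' E LinearMap.id fun p v hv ↦ (hT p).symm ▸ hv
  refine ⟨⟨f, g, hom_ext (E := E) fun U h s ↦ ?_, hom_ext (E := E') fun U h s ↦ ?_⟩, hf⟩
  · exact (hg U h _).trans (hf U h s)
  · exact (hf U h _).trans (hg U h s)

/-- The structure sheaf in the function field. -/
def ofStructureSheaf : Emb (structureSheaf X) X.functionField where
  j h := (X.presheaf.germ _ _ h).hom.toAddMonoidHom
  j_smul h a s := map_mul (X.presheaf.germ _ _ h).hom a s
  j_res i h s := germ_resO i h s
  inj h _ hs := function_ext fun _ ↦ hs.trans (map_zero (X.presheaf.germ _ _ h).hom).symm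

theorem lat_ofStructureSheaf (p : X) (c : X.functionField) :
    c ∈ (ofStructureSheaf (X := X)).lat p ↔ c ∈ reg p := by
  constructor
  · rintro ⟨U, hp, a, rfl⟩
    exact germ_mem_reg hp a
  · intro hc
    obtain ⟨U, hp, a, rfl⟩ := exists_of_mem_reg hc
    exact ⟨U, hp, a, rfl⟩

end Emb

theorem exists_function {U : X.Opens} (h : genericPoint X ∈ U) {c : X.functionField}
    (hc : ∀ p ∈ U, c ∈ reg p) : ∃ a : Γ(X, U), X.presheaf.germ U _ h a = c :=
  Emb.ofStructureSheaf.exists_section h fun p hp ↦ (Emb.lat_ofStructureSheaf p c).2 (hc p hp)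

end Lattices

/-! ### Frames of vector bundles and bases of lattices -/

section Frames
variable {X : Scheme.{u}} {M : X.Modules} {r : ℕ}

/-- The sections `e` of `M` over `U` form a frame. -/
def IsFrame (M : X.Modules) {U : X.Opens} (e : Fin r → Γ(M, U)) : Prop :=
  ∀ (V : X.Opens) (h : V ≤ U),
    LinearIndependent Γ(X, V) (fun i ↦ res M h (e i)) ∧
      Submodule.span Γ(X, V) (Set.range fun i ↦ res M h (e i)) = ⊤

namespace IsFrame

theorem eq_zero {U : X.Opens} {e : Fin r → Γ(M, U)} (he : IsFrame M e) {V : X.Opens} (h : V ≤ U)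
    {c : Fin r → Γ(X, V)} (hc : ∑ i, c i • res M h (e i) = 0) (i : Fin r) : c i = 0 :=
  Fintype.linearIndependent_iff.1 (he V h).1 c hc i

theorem exists_eq {U : X.Opens} {e : Fin r → Γ(M, U)} (he : IsFrame M e) {V : X.Opens} (h : V ≤ U)
    (s : Γ(M, V)) : ∃ c : Fin r → Γ(X, V), ∑ i, c i • res M h (e i) = s := by
  have : s ∈ Submodule.span Γ(X, V) (Set.range fun i ↦ res M h (e i)) := by
    rw [(he V h).2]; trivial
  exact (Submodule.mem_span_range_iff_exists_fun _).1 this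

theorem restrict {U : X.Opens} {e : Fin r → Γ(M, U)} (he : IsFrame M e) {V : X.Opens} (h : V ≤ U) :
    IsFrame M fun i ↦ res M h (e i) := fun W hW ↦ by
  simpa only [res_res] using he W (hW.trans h)

end IsFrame

theorem exists_germs {x : X} {U : X.Opens} (hx : x ∈ U) (c : Fin r → X.presheaf.stalk x) :
    ∃ (V : X.Opens) (hV : x ∈ V) (_ : V ≤ U) (a : Fin r → Γ(X, V)),
      ∀ i, X.presheaf.germ V x hV (a i) = c i := by
  choose V hV a ha using fun i ↦ X.presheaf.exists_germ_eq (c i)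
  have hW : ∀ i, Finset.univ.inf V ≤ V i := fun i ↦ Finset.inf_le (Finset.mem_univ i)
  have hx' : x ∈ Finset.univ.inf V := by
    rw [← SetLike.mem_coe, Opens.coe_finset_inf]
    simpa using hV
  have hx'' : x ∈ U ⊓ Finset.univ.inf V := ⟨hx, hx'⟩
  exact ⟨U ⊓ Finset.univ.inf V, hx'', inf_le_left,
    fun i ↦ resO (inf_le_right.trans (hW i)) (a i), fun i ↦ (germ_resO _ hx'' _).trans (ha i)⟩

/-- The germs of a frame form a basis of the stalk. -/
theorem IsFrame.exists_basis_stalk {U : X.Opens} {e : Fin r → Γ(M, U)} (he : IsFrame M e) {x : X}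
    (hx : x ∈ U) : ∃ b : Module.Basis (Fin r) (X.presheaf.stalk x) (Stalk M x),
      ∀ i, b i = germ M hx (e i) := by
  have hli : LinearIndependent (X.presheaf.stalk x) fun i ↦ germ M hx (e i) := by
    rw [Fintype.linearIndependent_iff]
    intro c hc i
    obtain ⟨V, hV, hVU, a, ha⟩ := exists_germs hx c
    have h1 : germ M hV (∑ i, a i • res M hVU (e i)) = germ M hV 0 := by
      rw [map_sum, map_zero, ← hc]
      exact Finset.sum_congr rfl fun i _ ↦ by rw [germ_smul, germ_res, ha]
    obtain ⟨W, hW, h, _, h2⟩ := germ_eq M hV hV _ _ h1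
    rw [map_zero, map_sum] at h2
    simp only [res_smul, res_res] at h2
    rw [← ha, ← germ_resO h hW, he.eq_zero (h.trans hVU) h2 i, map_zero]
  have hsp : ⊤ ≤ Submodule.span (X.presheaf.stalk x) (Set.range fun i ↦ germ M hx (e i)) := by
    rintro m -
    obtain ⟨V, hV, s, rfl⟩ := exists_germ M m
    obtain ⟨c, hc⟩ := he.exists_eq (V := U ⊓ V) inf_le_left (res M inf_le_right s)
    have hx' : x ∈ U ⊓ V := ⟨hx, hV⟩
    rw [← germ_res M (inf_le_right : U ⊓ V ≤ V) hx' s, ← hc, map_sum]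
    refine Submodule.sum_mem _ fun i _ ↦ ?_
    rw [germ_smul, germ_res]
    exact Submodule.smul_mem _ _ (Submodule.subset_span ⟨i, rfl⟩)
  exact ⟨Module.Basis.mk hli hsp, fun i ↦ Module.Basis.mk_apply _ _ _⟩

variable [IsIntegral X]

/-- A vector bundle, embedded in its generic stalk. -/
def IsVectorBundle.emb (hM : IsVectorBundle M r) : Emb M (Stalk M (genericPoint X)) where
  j h := germ M h
  j_smul h a s := germ_smul M h a s
  j_res i h s := germ_res M i h s
  inj {U} h s hs := by
    refine eq_of_locally M _ _ fun p hp ↦ ?_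
    obtain ⟨V, hV, e, he⟩ := hM p
    refine ⟨U ⊓ V, inf_le_left, ⟨hp, hV⟩, ?_⟩
    obtain ⟨c, hc⟩ := IsFrame.exists_eq he (V := U ⊓ V) inf_le_right (res M inf_le_left s)
    have hη : genericPoint X ∈ U ⊓ V := genericPoint_mem ⟨hp, hV⟩
    obtain ⟨b, hb⟩ := IsFrame.exists_basis_stalk he (genericPoint_mem hV)
    have h1 := congrArg (germ M hη) hc
    rw [germ_res, hs, map_sum] at h1
    simp only [germ_smul, germ_res, ← hb] at h1
    have h2 := Fintype.linearIndependent_iff.1 b.linearIndependent _ h1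
    rw [← hc, map_zero]
    refine Finset.sum_eq_zero fun i _ ↦ ?_
    have : c i = 0 := function_ext fun hU ↦ by rw [map_zero]; exact h2 i
    rw [this, zero_smul]

theorem IsVectorBundle.finrank_stalk (hM : IsVectorBundle M r) :
    Module.finrank X.functionField (Stalk M (genericPoint X)) = r := by
  obtain ⟨V, hV, e, he⟩ := hM (genericPoint X)
  obtain ⟨b, -⟩ := IsFrame.exists_basis_stalk he hV
  rw [Module.finrank_eq_card_basis b, Fintype.card_fin]

namespace Emb
variable {V : Type u} [AddCommGroup V] [Module X.functionField V]

/-- The lattices of `M` at the points of `U` are spanned by the basis `b`. -/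
def Framed (E : Emb M V) (U : X.Opens) (b : Module.Basis (Fin r) X.functionField V) : Prop :=
  ∀ p ∈ U, ∀ v, v ∈ E.lat p ↔ ∀ i, b.repr v i ∈ reg p

/-- A relation over the function field already holds over some open set, so the frame stays
independent, and by the dimension of `V` it is a basis. Coordinates of sections are functions, which
makes them regular at each point. -/
theorem exists_framed [NeZero r] (E : Emb M V) (hr : Module.finrank X.functionField V = r)
    {U : X.Opens} (h : genericPoint X ∈ U) {e : Fin r → Γ(M, U)} (he : IsFrame M e) :
    ∃ b : Module.Basis (Fin r) X.functionField V, (∀ i, b i = E.j h (e i)) ∧ E.Framed U b := by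
  have hli : LinearIndependent X.functionField fun i ↦ E.j h (e i) := by
    rw [Fintype.linearIndependent_iff]
    intro c hc i
    obtain ⟨V, hV, hVU, a, ha⟩ := exists_germs h c
    have h1 : ∑ i, a i • res M hVU (e i) = 0 := by
      refine E.inj hV _ ?_
      rw [map_sum, ← hc]
      exact Finset.sum_congr rfl fun i _ ↦ by rw [E.j_smul, E.j_res, ha]
    rw [← ha, he.eq_zero hVU h1 i, map_zero]
  let b := basisOfLinearIndependentOfCardEqFinrank hli (by rw [hr, Fintype.card_fin])
  have hb : ∀ i, b i = E.j h (e i) := fun i ↦ by simp [b]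
  refine ⟨b, hb, fun p hp v ↦ ⟨?_, fun hv ↦ ?_⟩⟩
  · rintro ⟨W, hW, s, rfl⟩ i
    obtain ⟨c, hc⟩ := he.exists_eq (V := U ⊓ W) inf_le_left (res M inf_le_right s)
    have hη : genericPoint X ∈ U ⊓ W := genericPoint_mem ⟨hp, hW⟩
    rw [← E.j_res inf_le_right hη, ← hc, map_sum]
    simp only [E.j_smul, E.j_res, ← hb]
    rw [b.repr_sum_self]
    exact germ_mem_reg (⟨hp, hW⟩ : p ∈ U ⊓ W) (c i)
  · rw [← b.sum_repr v]
    refine AddSubgroup.sum_mem _ fun i _ ↦ E.smul_mem_lat (hv i) ?_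
    rw [hb]
    exact E.j_mem_lat hp h _

/-- The basis vectors lie in every lattice over `U`, hence come from sections. The coordinates of a
section over `V` are regular at every point of `V`, hence are functions on `V`. -/
theorem Framed.exists_isFrame {E : Emb M V} {U : X.Opens}
    {b : Module.Basis (Fin r) X.functionField V} (hb : E.Framed U b) (h : genericPoint X ∈ U) :
    ∃ e : Fin r → Γ(M, U), IsFrame M e ∧ ∀ i, E.j h (e i) = b i := by
  have h1 : ∀ i, ∃ s : Γ(M, U), E.j h s = b i := fun i ↦ E.exists_section h fun p hp ↦ by
    rw [hb p hp]
    intro i'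
    rw [b.repr_self, Finsupp.single_apply]
    split_ifs
    exacts [one_mem _, zero_mem _]
  choose e he using h1
  refine ⟨e, fun V hV ↦ ?_, he⟩
  by_cases hη : genericPoint X ∈ V
  · constructor
    · rw [Fintype.linearIndependent_iff]
      intro c hc i
      have h2 := congrArg (E.j hη) hc
      rw [map_sum, map_zero] at h2
      simp only [E.j_smul, E.j_res, he] at h2
      have h3 := Fintype.linearIndependent_iff.1 b.linearIndependent _ h2 i
      exact function_ext fun _ ↦ by rw [map_zero]; exact h3
    · rw [eq_top_iff]
      rintro s -
      have h2 : ∀ i, ∃ a : Γ(X, V), X.presheaf.germ V _ hη a = b.repr (E.j hη s) i := fun i ↦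
        exists_function hη fun p hp ↦ (hb p (hV hp) _).1 (E.j_mem_lat hp hη s) i
      choose a ha using h2
      have h3 : s = ∑ i, a i • res M hV (e i) := E.j_injective hη (by
        rw [map_sum]
        simp only [E.j_smul, E.j_res, he, ha]
        exact (b.sum_repr _).symm)
      rw [h3]
      exact Submodule.sum_mem _ fun i _ ↦ Submodule.smul_mem _ _ (Submodule.subset_span ⟨i, rfl⟩)
  · have := subsingleton_functions hη
    have := subsingleton_sections M hη
    exact ⟨Fintype.linearIndependent_iff.2 fun _ _ _ ↦ Subsingleton.elim _ _,
      Subsingleton.elim _ _⟩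

theorem isVectorBundle {E : Emb M V} (h : ∀ p, ∃ (U : X.Opens) (_ : p ∈ U)
    (b : Module.Basis (Fin r) X.functionField V), E.Framed U b) : IsVectorBundle M r := fun p ↦ by
  obtain ⟨U, hp, b, hb⟩ := h p
  obtain ⟨e, he, -⟩ := hb.exists_isFrame (genericPoint_mem hp)
  exact ⟨U, hp, e, he⟩

theorem exists_framed_at [NeZero r] (E : Emb M V) (hM : IsVectorBundle M r)
    (hr : Module.finrank X.functionField V = r) (p : X) : ∃ (U : X.Opens) (_ : p ∈ U)
    (b : Module.Basis (Fin r) X.functionField V), E.Framed U b := by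
  obtain ⟨U, hp, e, he⟩ := hM p
  obtain ⟨b, -, hb⟩ := E.exists_framed hr (genericPoint_mem hp) he
  exact ⟨U, hp, b, hb⟩

/-- Membership of a fixed vector in the lattice is an open condition on the point. -/
theorem exists_forall_mem_lat (E : Emb M V) {x : X} (v : Fin r → V) (hv : ∀ i, v i ∈ E.lat x) :
    ∃ (U : X.Opens) (_ : x ∈ U), ∀ p ∈ U, ∀ i, v i ∈ E.lat p := by
  choose U hU s hs using hv
  refine ⟨Finset.univ.inf U, ?_, fun p hp i ↦ ?_⟩
  · rw [← SetLike.mem_coe, Opens.coe_finset_inf]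
    simpa using hU
  · have hp' : p ∈ U i := (Finset.inf_le (Finset.mem_univ i) : Finset.univ.inf U ≤ U i) hp
    rw [← hs i]
    exact E.j_mem_lat hp' _ _

theorem mem_lat_of_basis (E : Emb M V) {p : X} (b : Module.Basis (Fin r) X.functionField V)
    (hb : ∀ i, b i ∈ E.lat p) {v : V} (hv : ∀ i, b.repr v i ∈ reg p) : v ∈ E.lat p := by
  rw [← b.sum_repr v]
  exact AddSubgroup.sum_mem _ fun i _ ↦ E.smul_mem_lat (hv i) (hb i)

theorem repr_self_mem_reg (b : Module.Basis (Fin r) X.functionField V) (p : X) (i i' : Fin r) :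
    b.repr (b i) i' ∈ reg p := by
  rw [b.repr_self, Finsupp.single_apply]
  split_ifs
  exacts [one_mem _, zero_mem _]

/-- A basis of the lattice at `x` is a basis of the lattices near `x`. -/
theorem exists_framed_of_lat [NeZero r] (E : Emb M V) (hM : IsVectorBundle M r)
    (hr : Module.finrank X.functionField V = r) {x : X}
    {b : Module.Basis (Fin r) X.functionField V}
    (hb : ∀ v, v ∈ E.lat x ↔ ∀ i, b.repr v i ∈ reg x) :
    ∃ (U : X.Opens) (_ : x ∈ U), E.Framed U b := by
  obtain ⟨U, hU, c, hc⟩ := E.exists_framed_at hM hr x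
  have h1 : ∀ i, b i ∈ E.lat x := fun i ↦ (hb _).2 (repr_self_mem_reg b x i)
  obtain ⟨U', hU', h2⟩ := E.exists_forall_mem_lat b h1
  -- The transition matrix from a local frame `c` to `b` is regular at `x`, hence on a
  -- neighbourhood; there `b` spans the lattices as `c` does.
  have h3 : ∀ i i', b.repr (c i) i' ∈ reg x := fun i ↦
    (hb _).1 ((hc x hU _).2 (repr_self_mem_reg c x i))
  choose W hW a ha using fun q : Fin r × Fin r ↦ exists_of_mem_reg (h3 q.1 q.2)
  have hWx : x ∈ Finset.univ.inf W := by
    rw [← SetLike.mem_coe, Opens.coe_finset_inf]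
    simpa using fun i i' ↦ hW (i, i')
  refine ⟨(U ⊓ U') ⊓ Finset.univ.inf W, ⟨⟨hU, hU'⟩, hWx⟩, fun p hp v ↦ ⟨fun hv i ↦ ?_,
    E.mem_lat_of_basis b (h2 p hp.1.2)⟩⟩
  rw [← c.sum_repr v, map_sum, Finsupp.finsetSum_apply]
  refine Subring.sum_mem _ fun i' _ ↦ ?_
  rw [map_smul, Finsupp.smul_apply]
  refine Subring.mul_mem _ ((hc p hp.1.1 v).1 hv i') ?_
  rw [← ha (i', i)]
  exact germ_mem_reg ((Finset.inf_le (Finset.mem_univ (i', i)) : Finset.univ.inf W ≤ _) hp.2) _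

end Emb

end Frames

/-! ### Lattices of stalks, homomorphism sheaves and Hecke transforms -/

section Constructions
variable {X : Scheme.{u}} [IsIntegral X] {M F G : X.Modules} {r : ℕ}
  {V W : Type u} [AddCommGroup V] [Module X.functionField V]
  [AddCommGroup W] [Module X.functionField W]

namespace Emb

theorem j_eq_of_germ_eq (E : Emb M V) {x : X} {U U' : X.Opens} (hU : x ∈ U) (hU' : x ∈ U')
    {s : Γ(M, U)} {s' : Γ(M, U')} (h : germ M hU s = germ M hU' s') :
    E.j (genericPoint_mem hU) s = E.j (genericPoint_mem hU') s' := by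
  obtain ⟨W, hW, i, i', e⟩ := germ_eq M hU hU' s s' h
  have := congrArg (E.j (genericPoint_mem hW)) e
  rwa [E.j_res, E.j_res] at this

/-- The embedding of the stalk at `x`. -/
def stalkMap (E : Emb M V) (x : X) : Stalk M x →+ V :=
  AddMonoidHom.mk'
    (fun m ↦ E.j (genericPoint_mem (exists_germ M m).choose_spec.choose)
      (exists_germ M m).choose_spec.choose_spec.choose)
    (fun m m' ↦ by
      obtain ⟨U, hU, s, t, rfl, rfl⟩ := exists_germ₂ M M m m'
      have h : ∀ s : Γ(M, U), E.j (genericPoint_mem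
          (exists_germ M (germ M hU s)).choose_spec.choose)
          (exists_germ M (germ M hU s)).choose_spec.choose_spec.choose =
            E.j (genericPoint_mem hU) s := fun s ↦
        E.j_eq_of_germ_eq _ _ (exists_germ M (germ M hU s)).choose_spec.choose_spec.choose_spec
      rw [← map_add, h, h, h, map_add])

theorem stalkMap_germ (E : Emb M V) {x : X} {U : X.Opens} (hU : x ∈ U) (s : Γ(M, U)) :
    E.stalkMap x (germ M hU s) = E.j (genericPoint_mem hU) s :=
  E.j_eq_of_germ_eq _ _ (exists_germ M (germ M hU s)).choose_spec.choose_spec.choose_spec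

theorem stalkMap_smul (E : Emb M V) {x : X} (c : X.presheaf.stalk x) (m : Stalk M x) :
    E.stalkMap x (c • m) = algebraMap _ X.functionField c • E.stalkMap x m := by
  obtain ⟨U, hU, a, s, -, rfl, rfl, -⟩ := exists_germ_scalar M M c m m
  rw [← germ_smul, stalkMap_germ, stalkMap_germ, E.j_smul, algebraMap_germ]

theorem stalkMap_injective (E : Emb M V) (x : X) : Function.Injective (E.stalkMap x) := by
  rw [injective_iff_map_eq_zero]
  intro m hm
  obtain ⟨U, hU, s, rfl⟩ := exists_germ M m
  rw [stalkMap_germ] at hm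
  rw [E.inj _ s hm, map_zero]

theorem mem_lat_iff_stalkMap (E : Emb M V) {x : X} {v : V} :
    v ∈ E.lat x ↔ ∃ m, E.stalkMap x m = v := by
  constructor
  · rintro ⟨U, hU, s, rfl⟩
    exact ⟨germ M hU s, E.stalkMap_germ hU s⟩
  · rintro ⟨m, rfl⟩
    obtain ⟨U, hU, s, rfl⟩ := exists_germ M m
    rw [stalkMap_germ]
    exact E.j_mem_lat hU _ s

/-- A basis of the stalk over the local ring, as a basis over the function field. -/
theorem exists_basis_of_stalk [NeZero r] (E : Emb M V)
    (hr : Module.finrank X.functionField V = r) {x : X}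
    (b : Module.Basis (Fin r) (X.presheaf.stalk x) (Stalk M x)) :
    ∃ c : Module.Basis (Fin r) X.functionField V, (∀ i, c i = E.stalkMap x (b i)) ∧
      (∀ m i, c.repr (E.stalkMap x m) i = algebraMap _ X.functionField (b.repr m i)) ∧
      ∀ v, v ∈ E.lat x ↔ ∀ i, c.repr v i ∈ reg x := by
  have hli : LinearIndependent X.functionField fun i ↦ E.stalkMap x (b i) := by
    have h1 : LinearIndependent (X.presheaf.stalk x) (fun i ↦ b i) := b.linearIndependent
    rw [Fintype.linearIndependent_iff]
    intro a ha
    classical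
    -- Clearing denominators turns a relation over the function field into one over the local ring.
    obtain ⟨d, hd⟩ := IsLocalization.exist_integer_multiples_of_finset
      (nonZeroDivisors (X.presheaf.stalk x)) (Finset.univ.image a)
    choose a' ha' using fun i ↦ hd (a i) (Finset.mem_image_of_mem a (Finset.mem_univ i))
    have h2 : ∑ i, a' i • b i = 0 := by
      refine (injective_iff_map_eq_zero _).1 (E.stalkMap_injective x) _ ?_
      rw [map_sum]
      simp only [stalkMap_smul, ha', Algebra.smul_def, mul_smul]
      rw [← Finset.smul_sum, ha, smul_zero]
    intro i
    have h3 := ha' i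
    rw [Fintype.linearIndependent_iff.1 h1 a' h2 i, map_zero, Algebra.smul_def] at h3
    refine (mul_eq_zero.1 h3.symm).resolve_left ?_
    exact IsFractionRing.to_map_ne_zero_of_mem_nonZeroDivisors d.2
  let c := basisOfLinearIndependentOfCardEqFinrank hli (by rw [hr, Fintype.card_fin])
  have hc : ∀ i, c i = E.stalkMap x (b i) := fun i ↦ by simp [c]
  have hrepr : ∀ m i, c.repr (E.stalkMap x m) i = algebraMap _ X.functionField (b.repr m i) := by
    intro m i
    conv_lhs => rw [← b.sum_repr m, map_sum]
    simp only [stalkMap_smul, ← hc]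
    rw [c.repr_sum_self]
  refine ⟨c, hc, hrepr, fun v ↦ ⟨fun hv i ↦ ?_, fun hv ↦ E.mem_lat_of_basis c (fun i ↦ ?_) hv⟩⟩
  · obtain ⟨m, rfl⟩ := E.mem_lat_iff_stalkMap.1 hv
    rw [hrepr]
    exact ⟨_, rfl⟩
  · rw [hc, mem_lat_iff_stalkMap]
    exact ⟨_, rfl⟩

section Hom

/-- A frame near the generic point is a basis of `V`, so the values on sections determine a linear
map. -/
theorem linearMap_ext [NeZero r] (E : Emb F V) (hF : IsVectorBundle F r)
    (hr : Module.finrank X.functionField V = r) {U : X.Opens} (h : genericPoint X ∈ U)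
    {T T' : V →ₗ[X.functionField] W}
    (hT : ∀ (U' : X.Opens) (_ : U' ≤ U) (h : genericPoint X ∈ U') (s : Γ(F, U')),
      T (E.j h s) = T' (E.j h s)) : T = T' := by
  obtain ⟨U', h', e, he⟩ := hF (genericPoint X)
  have hη : genericPoint X ∈ U ⊓ U' := ⟨h, h'⟩
  obtain ⟨b, hb, -⟩ := E.exists_framed hr hη (IsFrame.restrict he inf_le_right)
  refine b.ext fun i ↦ ?_
  rw [hb]
  exact hT _ inf_le_left _ _

/-- The map is prescribed on a frame over a neighbourhood `U₁` of the generic point. Agreement on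
sections over `U'` may be checked over `U' ⊓ U₁`, because the embeddings are compatible with
restriction. -/
theorem exists_evalMap [NeZero r] (E : Emb F V) (E' : Emb G W) (hF : IsVectorBundle F r)
    (hr : Module.finrank X.functionField V = r) {U : X.Opens} (h : genericPoint X ∈ U)
    (φ : Γ(homSheaf F G, U)) : ∃ T : V →ₗ[X.functionField] W,
      ∀ (U' : X.Opens) (i : U' ≤ U) (h : genericPoint X ∈ U') (s : Γ(F, U')),
        E'.j h (ev φ i s) = T (E.j h s) := by
  obtain ⟨U₁, h₁, e, he⟩ := hF (genericPoint X)
  have hη : genericPoint X ∈ U ⊓ U₁ := ⟨h, h₁⟩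
  obtain ⟨b, hb, -⟩ := E.exists_framed hr hη (IsFrame.restrict he inf_le_right)
  refine ⟨b.constr X.functionField fun i ↦
    E'.j hη (ev φ inf_le_left (res F inf_le_right (e i))), fun U' i h' s ↦ ?_⟩
  have h1 : U' ⊓ U₁ ≤ U ⊓ U₁ := inf_le_inf_right _ i
  have h'η : genericPoint X ∈ U' ⊓ U₁ := ⟨h', h₁⟩
  obtain ⟨c, hc⟩ := IsFrame.exists_eq he (V := U' ⊓ U₁) inf_le_right (res F inf_le_left s)
  have h2 : res G inf_le_left (ev φ i s) =
      ev φ (inf_le_left.trans i : U' ⊓ U₁ ≤ U) (res F inf_le_left s) :=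
    LocalHom.comm φ _ _ _ _ _
  have h3 : ∀ k, ev φ (inf_le_left.trans i : U' ⊓ U₁ ≤ U) (res F inf_le_right (e k)) =
      res G h1 (ev φ inf_le_left (res F inf_le_right (e k))) := fun k ↦ by
    refine Eq.trans ?_ (LocalHom.comm φ _ _ _ _ _).symm
    rw [res_res]; rfl
  rw [← E'.j_res inf_le_left h'η, h2, ← E.j_res inf_le_left h'η, ← hc, map_sum, map_sum, map_sum,
    map_sum]
  refine Finset.sum_congr rfl fun k _ ↦ ?_
  rw [map_smul, E'.j_smul, h3, E'.j_res, E.j_smul, map_smul]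
  congr 1
  rw [E.j_res, ← E.j_res (inf_le_right : U ⊓ U₁ ≤ U₁) hη, ← hb, b.constr_basis]

variable [NeZero r] (E : Emb F V) (E' : Emb G W) (hF : IsVectorBundle F r)
  (hr : Module.finrank X.functionField V = r)

/-- Homomorphisms of bundles as linear maps over the function field. -/
def hom : Emb (homSheaf F G) (V →ₗ[X.functionField] W) where
  j h := AddMonoidHom.mk' (fun φ ↦ (exists_evalMap E E' hF hr h φ).choose) fun φ ψ ↦ by
    refine E.linearMap_ext hF hr h fun U' i h' s ↦ ?_
    rw [LinearMap.add_apply, ← (exists_evalMap E E' hF hr h φ).choose_spec U' i,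
      ← (exists_evalMap E E' hF hr h ψ).choose_spec U' i,
      ← (exists_evalMap E E' hF hr h (φ + ψ)).choose_spec U' i, ← map_add]
    rfl
  j_smul h c φ := by
    refine E.linearMap_ext hF hr h fun U' i h' s ↦ ?_
    refine ((exists_evalMap E E' hF hr h (c • φ)).choose_spec U' i h' s).symm.trans ?_
    change E'.j h' (resO i c • ev φ i s) = _
    rw [E'.j_smul, germ_resO, (exists_evalMap E E' hF hr h φ).choose_spec U' i]
    rfl
  j_res i h φ := by
    refine E.linearMap_ext hF hr h fun U' i' h' s ↦ ?_
    refine ((exists_evalMap E E' hF hr h (res _ i φ)).choose_spec U' i' h' s).symm.trans ?_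
    exact (exists_evalMap E E' hF hr (i h) φ).choose_spec U' (i'.trans i) h' s
  inj h φ hφ := by
    refine LocalHom.ext ?_
    funext U' i
    refine LinearMap.ext fun s ↦ E'.section_ext fun h' ↦ ?_
    refine ((exists_evalMap E E' hF hr h φ).choose_spec U' i h' s).trans ?_
    rw [show (exists_evalMap E E' hF hr h φ).choose = 0 from hφ]
    exact (map_zero _).symm

theorem hom_j_apply {U U' : X.Opens} (h : genericPoint X ∈ U) (φ : Γ(homSheaf F G, U))
    (i : U' ≤ U) (h' : genericPoint X ∈ U') (s : Γ(F, U')) :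
    (hom E E' hF hr).j h φ (E.j h' s) = E'.j h' (ev φ i s) :=
  ((exists_evalMap E E' hF hr h φ).choose_spec U' i h' s).symm

theorem hom_stalkMap_apply {x : X} (φ : Stalk (homSheaf F G) x) (m : Stalk F x) :
    (hom E E' hF hr).stalkMap x φ (E.stalkMap x m) = E'.stalkMap x (stalkEv F G x φ m) := by
  obtain ⟨U, hU, φ, s, rfl, rfl⟩ := exists_germ₂ _ _ φ m
  rw [stalkMap_germ, stalkMap_germ, hom_j_apply E E' hF hr _ φ le_rfl]
  exact ((congrArg _ (stalkEvFun_germ F G hU φ s)).trans (E'.stalkMap_germ hU _)).symm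

/-- If `T` respects the lattices at `p`, the finitely many images of a frame of `F` lie in the
lattices of `G` near `p`. Hence `T` respects the lattices on a neighbourhood and is a section there.
-/
theorem mem_lat_hom {p : X} {T : V →ₗ[X.functionField] W} :
    T ∈ (hom E E' hF hr).lat p ↔ ∀ v ∈ E.lat p, T v ∈ E'.lat p := by
  constructor
  · rintro ⟨U, hU, φ, rfl⟩ _ ⟨U', hU', s, rfl⟩
    have hη : p ∈ U ⊓ U' := ⟨hU, hU'⟩
    rw [← E.j_res (inf_le_right : U ⊓ U' ≤ U') (genericPoint_mem hη),
      hom_j_apply E E' hF hr _ φ inf_le_left]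
    exact E'.j_mem_lat hη _ _
  · intro hT
    obtain ⟨U, hU, b, hb⟩ := E.exists_framed_at hF hr p
    have h1 : ∀ i, T (b i) ∈ E'.lat p := fun i ↦
      hT _ ((hb p hU _).2 (repr_self_mem_reg b p i))
    obtain ⟨U', hU', h2⟩ := E'.exists_forall_mem_lat (fun i ↦ T (b i)) h1
    have hp : p ∈ U ⊓ U' := ⟨hU, hU'⟩
    obtain ⟨φ, hφ⟩ := exists_localHom E E' T (U := U ⊓ U') fun q hq v hv ↦ by
      rw [← b.sum_repr v, map_sum]
      refine AddSubgroup.sum_mem _ fun i _ ↦ ?_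
      rw [map_smul]
      exact E'.smul_mem_lat ((hb q hq.1 v).1 hv i) (h2 q hq.2 i)
    refine ⟨U ⊓ U', hp, φ, ?_⟩
    refine E.linearMap_ext hF hr (genericPoint_mem hp) fun U'' i h s ↦ ?_
    exact (hom_j_apply E E' hF hr _ _ i h s).trans (hφ U'' i h s)

end Hom

section Hecke
variable {x : X} {n : ℕ} (N : Submodule (X.presheaf.stalk x) (Thick M x n))

/-- The Hecke transform, embedded like the original sheaf. -/
def ofTransform (E : Emb M V) : Emb (heckeTransform M x N) V where
  j h := (E.j h).comp heckeTransform.incl.toAddMonoidHom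
  j_smul h a s := E.j_smul h a (heckeTransform.incl s)
  j_res i h s := E.j_res i h (heckeTransform.incl s)
  inj h _ hs := Subtype.ext (E.inj h _ hs)

/-- The complement of a closed point. -/
def puncture (hx : IsClosed {x}) : X.Opens := ⟨{x}ᶜ, hx.isOpen_compl⟩

/-- On the complement of `x` the condition that defines the Hecke transform is vacuous. -/
theorem lat_ofTransform_of_ne (hx : IsClosed {x}) (E : Emb M V) {p : X} (hp : p ≠ x) :
    (ofTransform N E).lat p = E.lat p := by
  ext v
  constructor
  · rintro ⟨U, hU, s, rfl⟩
    exact E.j_mem_lat hU _ _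
  · rintro ⟨U, hU, s, rfl⟩
    have hpU : p ∈ U ⊓ puncture hx := ⟨hU, hp⟩
    exact ⟨U ⊓ puncture hx, hpU, ⟨res M inf_le_left s, fun h ↦ (h.2 rfl).elim⟩,
      E.j_res inf_le_left (genericPoint_mem hpU) s⟩

theorem mem_lat_ofTransform (E : Emb M V) {v : V} : v ∈ (ofTransform N E).lat x ↔
    ∃ m, Thick.mk M x n m ∈ N ∧ E.stalkMap x m = v := by
  constructor
  · rintro ⟨U, hU, s, rfl⟩
    exact ⟨germ M hU (heckeTransform.incl s), s.2 hU, E.stalkMap_germ hU _⟩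
  · rintro ⟨m, hm, rfl⟩
    obtain ⟨U, hU, s, rfl⟩ := exists_germ M m
    exact ⟨U, hU, ⟨s, fun _ ↦ hm⟩, (E.stalkMap_germ hU s).symm⟩

end Hecke

end Emb

end Constructions

/-! ### Local parameters and the twist by a point -/

section Twisting
variable {X : Scheme.{u}} [IsIntegral X] {x : X}

/-- A local parameter at `x`, defined on a neighbourhood in which it vanishes only at `x`. -/
structure LocalParameter (x : X) where
  U : X.Opens
  mem : x ∈ U
  t : Γ(X, U)
  maximalIdeal_eq : IsLocalRing.maximalIdeal (X.presheaf.stalk x) =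
    Ideal.span {X.presheaf.germ U x mem t}
  isUnit : ∀ (p : X) (hp : p ∈ U), p ≠ x → IsUnit (X.presheaf.germ U p hp t)
  ne_zero : t ≠ 0

namespace LocalParameter
variable (P : LocalParameter x)

/-- The local parameter as a germ. -/
def stalk : X.presheaf.stalk x := X.presheaf.germ P.U x P.mem P.t

/-- The local parameter as a rational function. -/
def τ : X.functionField := X.presheaf.germ P.U _ (genericPoint_mem P.mem) P.t

theorem algebraMap_stalk : algebraMap _ X.functionField P.stalk = P.τ := algebraMap_germ _ _

theorem τ_ne_zero : P.τ ≠ 0 := fun h ↦ P.ne_zero (function_ext fun _ ↦ by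
  rw [map_zero]; exact h)

theorem τ_mem_reg {p : X} (hp : p ∈ P.U) : P.τ ∈ reg p := germ_mem_reg hp _

theorem τ_inv_mem_reg {p : X} (hp : p ∈ P.U) (hpx : p ≠ x) : P.τ⁻¹ ∈ reg p := by
  obtain ⟨u, hu⟩ := P.isUnit p hp hpx
  refine ⟨↑u⁻¹, eq_inv_of_mul_eq_one_left ?_⟩
  have : P.τ = algebraMap _ X.functionField (u : X.presheaf.stalk p) := by
    rw [hu, algebraMap_germ]; rfl
  rw [this, ← map_mul, Units.inv_mul, map_one]

theorem τ_zpow_mem_reg {p : X} (hp : p ∈ P.U) (hpx : p ≠ x) (n : ℤ) : P.τ ^ n ∈ reg p := by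
  cases n with
  | ofNat n => simpa using Subring.pow_mem _ (P.τ_mem_reg hp) n
  | negSucc n =>
    rw [zpow_negSucc, ← inv_pow]
    exact Subring.pow_mem _ (P.τ_inv_mem_reg hp hpx) _

/-- Powers of the maximal ideal become regularity conditions in the function field, where negative
exponents are available. -/
theorem mem_mPow_iff {a : X.presheaf.stalk x} (n : ℕ) :
    a ∈ mPow x n ↔ P.τ ^ (-n : ℤ) * algebraMap _ X.functionField a ∈ reg x := by
  have hτ := pow_ne_zero n P.τ_ne_zero
  rw [mPow, P.maximalIdeal_eq, Ideal.span_singleton_pow, Ideal.mem_span_singleton, zpow_neg,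
    zpow_natCast]
  constructor
  · rintro ⟨c, rfl⟩
    refine ⟨c, ?_⟩
    change _ = _ * algebraMap _ _ (P.stalk ^ n * c)
    rw [map_mul, map_pow, P.algebraMap_stalk, inv_mul_cancel_left₀ hτ]
  · rintro ⟨c, hc⟩
    refine ⟨c, IsFractionRing.injective (X.presheaf.stalk x) X.functionField ?_⟩
    change _ = algebraMap _ _ (P.stalk ^ n * c)
    rw [map_mul, map_pow, P.algebraMap_stalk, hc, mul_inv_cancel_left₀ hτ]

/-- The local parameter as a section of `𝒪_X(-x)`. -/
def ideal : Γ(pointIdeal x, P.U) :=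
  ⟨P.t, fun _ ↦ by rw [P.maximalIdeal_eq]; exact Ideal.mem_span_singleton_self _⟩

end LocalParameter

omit [IsIntegral X] in
theorem mem_inf {U U' : X.Opens} {p : X} (h : p ∈ U) (h' : p ∈ U') : p ∈ U ⊓ U' := ⟨h, h'⟩

namespace Emb

/-- The ideal sheaf `𝒪_X(-x)` in the function field. -/
def ofPointIdeal (x : X) : Emb (pointIdeal x) X.functionField where
  j h := (X.presheaf.germ _ _ h).hom.toAddMonoidHom.comp pointIdeal.incl.toAddMonoidHom
  j_smul h a s := map_mul (X.presheaf.germ _ _ h).hom a (pointIdeal.incl s)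
  j_res i h s := germ_resO i h (pointIdeal.incl s)
  inj h _ hs := Subtype.ext
    (function_ext fun _ ↦ hs.trans (map_zero (X.presheaf.germ _ _ h).hom).symm)

theorem lat_ofPointIdeal_le {p : X} {c : X.functionField} (hc : c ∈ (ofPointIdeal x).lat p) :
    c ∈ reg p := by
  obtain ⟨U, hU, a, rfl⟩ := hc
  exact germ_mem_reg hU _

theorem lat_ofPointIdeal_self (P : LocalParameter x) {c : X.functionField}
    (hc : c ∈ (ofPointIdeal x).lat x) : P.τ⁻¹ * c ∈ reg x := by
  obtain ⟨U, hU, a, rfl⟩ := hc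
  have h1 : X.presheaf.germ U x hU (pointIdeal.incl a) ∈ mPow x 1 := by
    rw [mPow, pow_one]; exact a.2 hU
  rw [P.mem_mPow_iff, algebraMap_germ] at h1
  rwa [Nat.cast_one, zpow_neg_one] at h1

variable {M : X.Modules} {V : Type u} [AddCommGroup V] [Module X.functionField V]

/-- Both sides are `φ(ab)`. Consequently the quotient `φ(a) / a` does not depend on `a`. -/
theorem twist_j_aux (E : Emb M V) {U U₁ U₂ : X.Opens} (φ : Γ(twist M x, U)) (i : U₁ ≤ U)
    (i' : U₂ ≤ U) (h : genericPoint X ∈ U₁) (h' : genericPoint X ∈ U₂) (a : Γ(pointIdeal x, U₁))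
    (b : Γ(pointIdeal x, U₂)) :
    (ofPointIdeal x).j h a • E.j h' (ev φ i' b) = (ofPointIdeal x).j h' b • E.j h (ev φ i a) := by
  have hη : genericPoint X ∈ U₁ ⊓ U₂ := ⟨h, h'⟩
  have e1 : E.j h (ev φ i a) =
      E.j hη (ev φ (inf_le_left.trans i) (res _ inf_le_left a)) := by
    rw [← E.j_res (inf_le_left : U₁ ⊓ U₂ ≤ U₁) hη]
    exact congrArg _ (LocalHom.comm φ _ _ _ _ _)
  have e2 : E.j h' (ev φ i' b) =
      E.j hη (ev φ (inf_le_left.trans i) (res _ inf_le_right b)) := by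
    rw [← E.j_res (inf_le_right : U₁ ⊓ U₂ ≤ U₂) hη]
    exact congrArg _ (LocalHom.comm φ _ _ _ _ _)
  have e3 : pointIdeal.incl (res _ inf_le_left a : Γ(pointIdeal x, U₁ ⊓ U₂)) •
      (res _ inf_le_right b : Γ(pointIdeal x, U₁ ⊓ U₂)) =
      pointIdeal.incl (res _ inf_le_right b : Γ(pointIdeal x, U₁ ⊓ U₂)) •
      (res _ inf_le_left a : Γ(pointIdeal x, U₁ ⊓ U₂)) :=
    Subtype.ext (mul_comm (G := Γ(X, U₁ ⊓ U₂)) _ _)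
  have e4 := congrArg (fun s ↦ E.j hη (ev φ (inf_le_left.trans i) s)) e3
  simp only [map_smul, E.j_smul] at e4
  rw [e1, e2, ← (ofPointIdeal x).j_res (inf_le_left : U₁ ⊓ U₂ ≤ U₁) hη,
    ← (ofPointIdeal x).j_res (inf_le_right : U₁ ⊓ U₂ ≤ U₂) hη]
  exact e4

/-- The twist `M(x)`, where a section `φ : 𝒪_X(-x) → M` is `a⁻¹ φ(a)` for all `a ≠ 0`. -/
def ofTwist (P : LocalParameter x) (E : Emb M V) : Emb (twist M x) V where
  j {U} h := AddMonoidHom.mk' (fun φ ↦ P.τ⁻¹ • E.j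
      (mem_inf h (genericPoint_mem P.mem))
      (ev φ inf_le_left (res _ inf_le_right P.ideal))) fun φ ψ ↦ by
    rw [← smul_add, ← map_add]; rfl
  j_smul {U} h a φ := by
    refine Eq.trans ?_ (smul_comm P.τ⁻¹ _ (_ : V))
    refine congrArg (fun v : V ↦ P.τ⁻¹ • v) ?_
    refine (E.j_smul _ (resO inf_le_left a) _).trans ?_
    rw [germ_resO]
    rfl
  j_res {U U'} i h φ := by
    refine congrArg (fun v : V ↦ P.τ⁻¹ • v) ?_
    have h1 : U' ⊓ P.U ≤ U ⊓ P.U := inf_le_inf_right _ i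
    rw [← E.j_res h1 (mem_inf h (genericPoint_mem P.mem))]
    congr 1
    refine Eq.trans ?_ (LocalHom.comm φ _ _ _ _ _).symm
    rw [res_res]; rfl
  inj {U} h φ hφ := by
    have h0 := (smul_eq_zero.1 hφ).resolve_left (inv_ne_zero P.τ_ne_zero)
    refine LocalHom.ext ?_
    funext U' i
    refine LinearMap.ext fun a ↦ E.section_ext fun h' ↦ ?_
    have h1 := twist_j_aux E φ inf_le_left i (mem_inf h (genericPoint_mem P.mem)) h'
      (res _ inf_le_right P.ideal) a
    rw [h0, smul_zero, (ofPointIdeal x).j_res] at h1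
    exact ((smul_eq_zero.1 h1).resolve_left P.τ_ne_zero).trans (map_zero _).symm

theorem j_smul_ofTwist (P : LocalParameter x) (E : Emb M V) {U U' : X.Opens}
    (h : genericPoint X ∈ U) (φ : Γ(twist M x, U)) (i : U' ≤ U) (h' : genericPoint X ∈ U')
    (a : Γ(pointIdeal x, U')) :
    (ofPointIdeal x).j h' a • (ofTwist P E).j h φ = E.j h' (ev φ i a) := by
  have h1 := twist_j_aux E φ inf_le_left i (mem_inf h (genericPoint_mem P.mem)) h'
      (res _ inf_le_right P.ideal) a
  rw [(ofPointIdeal x).j_res] at h1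
  change _ • P.τ⁻¹ • (_ : V) = _
  rw [smul_comm, ← h1]
  exact inv_smul_smul₀ P.τ_ne_zero _

/-- The section is multiplication by `v`. At `x` every section `c` of the ideal is a multiple of
`τ`, and `c v = (c / τ) (τ v)` lies in the lattice. -/
theorem exists_twist_section (P : LocalParameter x) (E : Emb M V) {U : X.Opens} (v : V)
    (h : genericPoint X ∈ U) (hv : ∀ p ∈ U, p ≠ x → v ∈ E.lat p)
    (hv' : x ∈ U → P.τ • v ∈ E.lat x) : ∃ φ : Γ(twist M x, U), (ofTwist P E).j h φ = v := by
  obtain ⟨φ, hφ⟩ := exists_localHom (ofPointIdeal x) E (LinearMap.toSpanSingleton _ _ v) (U := U)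
    fun p hp c hc ↦ by
      rw [LinearMap.toSpanSingleton_apply]
      by_cases hpx : p = x
      · subst hpx
        have := E.smul_mem_lat (lat_ofPointIdeal_self P hc) (hv' hp)
        rwa [smul_smul, mul_right_comm, inv_mul_cancel₀ P.τ_ne_zero, one_mul] at this
      · exact E.smul_mem_lat (lat_ofPointIdeal_le hc) (hv p hp hpx)
  refine ⟨φ, ?_⟩
  have hη : genericPoint X ∈ U ⊓ P.U := (mem_inf h (genericPoint_mem P.mem))
  have h1 := hφ (U ⊓ P.U) inf_le_left hη (res _ inf_le_right P.ideal)
  rw [(ofPointIdeal x).j_res, LinearMap.toSpanSingleton_apply] at h1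
  change P.τ⁻¹ • E.j hη _ = v
  refine (congrArg _ h1).trans ?_
  exact inv_smul_smul₀ P.τ_ne_zero _

theorem lat_ofTwist_of_ne (hx : IsClosed {x}) (P : LocalParameter x) (E : Emb M V) {p : X}
    (hp : p ≠ x) : (ofTwist P E).lat p = E.lat p := by
  ext v
  constructor
  · rintro ⟨U, hU, φ, rfl⟩
    have hpU : p ∈ U ⊓ puncture hx := ⟨hU, hp⟩
    -- Away from `x` the constant function `1` is a section of the ideal sheaf.
    have h1 := j_smul_ofTwist P E (genericPoint_mem hU) φ inf_le_left (genericPoint_mem hpU)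
      ⟨(1 : Γ(X, U ⊓ puncture hx)), fun h ↦ (h.2 rfl).elim⟩
    have h2 : (ofPointIdeal x).j (genericPoint_mem hpU) ⟨(1 : Γ(X, U ⊓ puncture hx)), fun h ↦ (h.2 rfl).elim⟩ = 1 :=
      map_one (X.presheaf.germ _ _ _).hom
    rw [h2, one_smul] at h1
    rw [h1]
    exact E.j_mem_lat hpU _ _
  · rintro ⟨U, hU, s, rfl⟩
    have hpU : p ∈ U ⊓ puncture hx := ⟨hU, hp⟩
    obtain ⟨φ, hφ⟩ := exists_twist_section P E (E.j (genericPoint_mem hU) s)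
      (genericPoint_mem hpU) (fun q hq _ ↦ E.j_mem_lat hq.1 _ s) (fun h ↦ (h.2 rfl).elim)
    exact ⟨_, hpU, φ, hφ⟩

theorem mem_lat_ofTwist (P : LocalParameter x) (E : Emb M V) {v : V} :
    v ∈ (ofTwist P E).lat x ↔ P.τ • v ∈ E.lat x := by
  constructor
  · rintro ⟨U, hU, φ, rfl⟩
    refine (smul_inv_smul₀ P.τ_ne_zero (_ : V)).symm ▸ ?_
    exact E.j_mem_lat (mem_inf hU P.mem) _ _
  · rintro ⟨U, hU, s, hs⟩
    have hxU : x ∈ U ⊓ P.U := ⟨hU, P.mem⟩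
    -- Near `x` but away from it `τ` is invertible, so `v` lies in the lattice as soon as `τ v`
    -- does.
    obtain ⟨φ, hφ⟩ := exists_twist_section P E v (genericPoint_mem hxU) (fun p hp hpx ↦ by
      rw [← inv_smul_smul₀ P.τ_ne_zero v, ← hs]
      exact E.smul_mem_lat (P.τ_inv_mem_reg hp.2 hpx) (E.j_mem_lat hp.1 _ s))
      (fun _ ↦ hs ▸ E.j_mem_lat hU _ s)
    exact ⟨_, hxU, φ, hφ⟩

end Emb

end Twisting

/-! ### Sections and lattices of the determinant -/

section DeterminantSections
variable {X : Scheme.{u}} {M N : X.Modules}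

/-- The map from `Λ² M(U)` to the sections of `Λ² M`. -/
def toDet (M : X.Modules) (U : X.Opens) : ⋀[Γ(X, U)]^2 Γ(M, U) →ₗ[Γ(X, U)] Γ(det M, U) :=
  (((PresheafOfModules.sheafificationAdjunction (𝟙 X.ringCatSheaf.obj)).unit.app
    (wedgePresheaf M)).app (op U)).hom

theorem toDet_ιMulti {U : X.Opens} (v : Fin 2 → Γ(M, U)) :
    toDet M U (exteriorPower.ιMulti Γ(X, U) 2 v) = wedge (v 0) (v 1) := by
  have : v = ![v 0, v 1] := by ext i; fin_cases i <;> rfl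
  conv_lhs => rw [this]
  rfl

theorem res_toDet {U V : X.Opens} (h : V ≤ U) (a : ⋀[Γ(X, U)]^2 Γ(M, U)) :
    res (det M) h (toDet M U a) = toDet M V (wedgeRes M h a) :=
  (PresheafOfModules.naturality_apply
    ((PresheafOfModules.sheafificationAdjunction (𝟙 X.ringCatSheaf.obj)).unit.app
      (wedgePresheaf M)) (homOfLE h).op a).symm

theorem res_wedge {U V : X.Opens} (h : V ≤ U) (s t : Γ(M, U)) :
    res (det M) h (wedge s t) = wedge (res M h s) (res M h t) := by
  have := res_toDet h (exteriorPower.ιMulti Γ(X, U) 2 ![s, t])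
  rwa [wedgeRes_ιMulti, toDet_ιMulti, toDet_ιMulti] at this

/-- The map from a presheaf to its sheafification is locally injective. Together with local
surjectivity, `exists_toDet`, this reduces sections of the determinant to elements of exterior
squares. -/
theorem toDet_eq {U : X.Opens} {a b : ⋀[Γ(X, U)]^2 Γ(M, U)} (h : toDet M U a = toDet M U b)
    {p : X} (hp : p ∈ U) : ∃ (V : X.Opens) (hV : V ≤ U), p ∈ V ∧ wedgeRes M hV a = wedgeRes M hV b := by
  obtain ⟨V, f, h, hp⟩ := Presheaf.equalizerSieve_mem (Opens.grothendieckTopology X)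
    (toSheafify (Opens.grothendieckTopology X) (wedgePresheaf M).presheaf) (X := op U) a b h p hp
  exact ⟨V, leOfHom f, hp, h⟩

theorem exists_toDet {U : X.Opens} (y : Γ(det M, U)) {p : X} (hp : p ∈ U) :
    ∃ (V : X.Opens) (hV : V ≤ U) (_ : p ∈ V) (a : ⋀[Γ(X, V)]^2 Γ(M, V)),
      toDet M V a = res (det M) hV y := by
  obtain ⟨V, f, ⟨a, h⟩, hp⟩ := Presheaf.imageSieve_mem (Opens.grothendieckTopology X)
    (toSheafify (Opens.grothendieckTopology X) (wedgePresheaf M).presheaf) (U := op U) y p hp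
  exact ⟨V, leOfHom f, hp, a, h⟩

/-- `Λ² M` is generated by `e₀ ∧ e₁`, for a frame `e` of `M`. -/
theorem IsFrame.exists_smul_wedge {U : X.Opens} {e : Fin 2 → Γ(M, U)} (he : IsFrame M e)
    {V : X.Opens} (h : V ≤ U) (a : ⋀[Γ(X, V)]^2 Γ(M, V)) :
    ∃ c : Γ(X, V), a = c • exteriorPower.ιMulti Γ(X, V) 2 fun i ↦ res M h (e i) := by
  induction a using wedge_induction with
  | h0 => exact ⟨0, (zero_smul _ _).symm⟩
  | hadd a b ha hb =>
    obtain ⟨c, rfl⟩ := ha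
    obtain ⟨d, rfl⟩ := hb
    exact ⟨c + d, (add_smul _ _ _).symm⟩
  | hsmul c a ha =>
    obtain ⟨d, rfl⟩ := ha
    exact ⟨c * d, (mul_smul _ _ _).symm⟩
  | h v =>
    let b : Module.Basis (Fin 2) Γ(X, V) Γ(M, V) := Module.Basis.mk (he V h).1 (he V h).2.ge
    have hb : (fun i ↦ res M h (e i)) = b := by ext i; simp [b]
    rw [hb]
    refine ⟨b.det v, ?_⟩
    have h1 : b.det v • exteriorPower.ιMulti Γ(X, V) 2 (M := Γ(M, V)) b =
        exteriorPower.ιMulti Γ(X, V) 2 v := by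
      refine congrArg (· v) (Module.Basis.ext_alternating b
        (f := (LinearMap.toSpanSingleton Γ(X, V) _
          (exteriorPower.ιMulti Γ(X, V) 2 (M := Γ(M, V)) b)).compAlternatingMap b.det) fun w hw ↦ ?_)
      -- An injective pair of indices is a permutation, so both alternating maps change by the same
      -- sign.
      obtain ⟨σ, rfl⟩ : ∃ σ : Equiv.Perm (Fin 2), w = σ :=
        ⟨Equiv.ofBijective w (Finite.injective_iff_bijective.1 hw), rfl⟩
      have e : (fun i ↦ b (σ i)) = b ∘ σ := rfl
      rw [e, AlternatingMap.map_perm, AlternatingMap.map_perm]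
      simp [b.det_self]
    exact h1.symm

variable [IsIntegral X] {V W : Type u} [AddCommGroup V] [Module X.functionField V]
  [AddCommGroup W] [Module X.functionField W]

namespace Emb

/-- The value of an alternating form on `Λ² M(U)`. -/
theorem exists_wedgeForm (E : Emb M V) (ω : V [⋀^Fin 2]→ₗ[X.functionField] X.functionField)
    {U : X.Opens} (h : genericPoint X ∈ U) : ∃ f : ⋀[Γ(X, U)]^2 Γ(M, U) →+ X.functionField,
      (∀ (c : Γ(X, U)) a, f (c • a) = X.presheaf.germ U _ h c * f a) ∧
      ∀ v, f (exteriorPower.ιMulti Γ(X, U) 2 v) = ω fun i ↦ E.j h (v i) := by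
  -- The function field is regarded as a `Γ(X, U)`-module, so that the universal property of the
  -- exterior square applies.
  let _ : Module Γ(X, U) X.functionField := Module.compHom _ (X.presheaf.germ U _ h).hom
  let f : ⋀[Γ(X, U)]^2 Γ(M, U) →ₗ[Γ(X, U)] X.functionField :=
    exteriorPower.alternatingMapLinearEquiv
    { toFun := fun v ↦ ω fun i ↦ E.j h (v i)
      map_update_add' := fun {_} v i a b ↦ by
        have e : ∀ c, (fun j ↦ E.j h (Function.update v i c j)) =
            Function.update (fun j ↦ E.j h (v j)) i (E.j h c) := fun c ↦ by
          funext j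
          by_cases hj : j = i
          · subst hj; simp
          · simp [hj]
        rw [e, e, e, map_add, AlternatingMap.map_update_add]
      map_update_smul' := fun {_} v i a b ↦ by
        have e : ∀ c, (fun j ↦ E.j h (Function.update v i c j)) =
            Function.update (fun j ↦ E.j h (v j)) i (E.j h c) := fun c ↦ by
          funext j
          by_cases hj : j = i
          · subst hj; simp
          · simp [hj]
        rw [e, e, E.j_smul, AlternatingMap.map_update_smul]; rfl
      map_eq_zero_of_eq' := fun v i j hv hij ↦
        AlternatingMap.map_eq_zero_of_eq _ _ (congrArg (E.j h) hv) hij }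
  exact ⟨f.toAddMonoidHom, f.map_smul, exteriorPower.alternatingMapLinearEquiv_apply_ιMulti _⟩

/-- The value of an alternating form on `Λ² M(U)`. -/
def wedgeForm (E : Emb M V) (ω : V [⋀^Fin 2]→ₗ[X.functionField] X.functionField)
    {U : X.Opens} (h : genericPoint X ∈ U) : ⋀[Γ(X, U)]^2 Γ(M, U) →+ X.functionField :=
  (E.exists_wedgeForm ω h).choose

variable (E : Emb M V) (ω : V [⋀^Fin 2]→ₗ[X.functionField] X.functionField)

theorem wedgeForm_smul {U : X.Opens} (h : genericPoint X ∈ U) (c : Γ(X, U)) (a) :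
    E.wedgeForm ω h (c • a) = X.presheaf.germ U _ h c * E.wedgeForm ω h a :=
  (E.exists_wedgeForm ω h).choose_spec.1 c a

theorem wedgeForm_ιMulti {U : X.Opens} (h : genericPoint X ∈ U) (v : Fin 2 → Γ(M, U)) :
    E.wedgeForm ω h (exteriorPower.ιMulti Γ(X, U) 2 v) = ω fun i ↦ E.j h (v i) :=
  (E.exists_wedgeForm ω h).choose_spec.2 v

theorem wedgeForm_res {U U' : X.Opens} (i : U' ≤ U) (h : genericPoint X ∈ U')
    (a : ⋀[Γ(X, U)]^2 Γ(M, U)) : E.wedgeForm ω h (wedgeRes M i a) = E.wedgeForm ω (i h) a := by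
  induction a using wedge_induction with
  | h0 => rw [map_zero, map_zero, map_zero]
  | hadd a b ha hb => rw [map_add, map_add, map_add, ha, hb]
  | hsmul c a ha => rw [LinearMap.map_smulₛₗ, wedgeForm_smul, wedgeForm_smul, ha, germ_resO]
  | h v =>
    rw [wedgeRes_ιMulti, wedgeForm_ιMulti, wedgeForm_ιMulti]
    simp only [E.j_res]

/-- Near the generic point `y` is represented in an exterior square. Two representatives agree after
shrinking, and shrinking does not change the value of `ω`. -/
theorem exists_detForm {U : X.Opens} (h : genericPoint X ∈ U) (y : Γ(det M, U)) :
    ∃ c : X.functionField, ∀ (U' : X.Opens) (i : U' ≤ U) (h' : genericPoint X ∈ U')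
      (a : ⋀[Γ(X, U')]^2 Γ(M, U')), toDet M U' a = res (det M) i y → E.wedgeForm ω h' a = c := by
  obtain ⟨V, hV, hηV, b, hb⟩ := exists_toDet y h
  refine ⟨E.wedgeForm ω hηV b, fun U' i h' a ha ↦ ?_⟩
  have hη : genericPoint X ∈ U' ⊓ V := ⟨h', hηV⟩
  have h1 : toDet M (U' ⊓ V) (wedgeRes M inf_le_left a) =
      toDet M (U' ⊓ V) (wedgeRes M inf_le_right b) := by
    rw [← res_toDet, ← res_toDet, ha, hb, res_res, res_res]
  obtain ⟨V', hV', hηV', h2⟩ := toDet_eq h1 hη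
  rw [← E.wedgeForm_res ω inf_le_left hη, ← E.wedgeForm_res ω (inf_le_right : U' ⊓ V ≤ V) hη,
    ← E.wedgeForm_res ω hV' hηV', h2, E.wedgeForm_res]

/-- The value of an alternating form on a section of `Λ² M`. -/
def detForm {U : X.Opens} (h : genericPoint X ∈ U) (y : Γ(det M, U)) : X.functionField :=
  (E.exists_detForm ω h y).choose

theorem detForm_eq {U U' : X.Opens} (h : genericPoint X ∈ U) (i : U' ≤ U)
    (h' : genericPoint X ∈ U') {y : Γ(det M, U)} {a : ⋀[Γ(X, U')]^2 Γ(M, U')}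
    (ha : toDet M U' a = res (det M) i y) : E.detForm ω h y = E.wedgeForm ω h' a :=
  ((E.exists_detForm ω h y).choose_spec U' i h' a ha).symm

theorem detForm_res {U U' : X.Opens} (i : U' ≤ U) (h : genericPoint X ∈ U') (y : Γ(det M, U)) :
    E.detForm ω h (res _ i y) = E.detForm ω (i h) y := by
  obtain ⟨V, hV, hηV, b, hb⟩ := exists_toDet (res _ i y) h
  rw [E.detForm_eq ω h hV hηV hb]
  exact (E.detForm_eq ω (i h) (hV.trans i) hηV (by rw [hb, res_res])).symm

theorem detForm_add {U : X.Opens} (h : genericPoint X ∈ U) (y z : Γ(det M, U)) :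
    E.detForm ω h (y + z) = E.detForm ω h y + E.detForm ω h z := by
  obtain ⟨V, hV, hηV, a, ha⟩ := exists_toDet y h
  obtain ⟨V', hV', hηV', b, hb⟩ := exists_toDet z h
  have hη : genericPoint X ∈ V ⊓ V' := ⟨hηV, hηV'⟩
  rw [E.detForm_eq ω h (inf_le_left.trans hV) hη (y := y) (a := wedgeRes M inf_le_left a)
    (by rw [← res_toDet, ha, res_res]),
    E.detForm_eq ω h (inf_le_left.trans hV) hη (y := z) (a := wedgeRes M inf_le_right b)
    (by rw [← res_toDet, hb, res_res]), ← map_add]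
  refine E.detForm_eq ω h (inf_le_left.trans hV) hη ?_
  rw [map_add, map_add, ← res_toDet, ← res_toDet, ha, hb, res_res, res_res]

theorem detForm_smul {U : X.Opens} (h : genericPoint X ∈ U) (c : Γ(X, U)) (y : Γ(det M, U)) :
    E.detForm ω h (c • y) = X.presheaf.germ U _ h c * E.detForm ω h y := by
  obtain ⟨V, hV, hηV, a, ha⟩ := exists_toDet y h
  rw [E.detForm_eq ω h hV hηV ha, E.detForm_eq ω h hV hηV (a := resO hV c • a)
    (by rw [map_smul, ha, res_smul]), wedgeForm_smul, germ_resO]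

theorem detForm_wedge {U : X.Opens} (h : genericPoint X ∈ U) (s t : Γ(M, U)) :
    E.detForm ω h (wedge s t) = ω ![E.j h s, E.j h t] := by
  rw [E.detForm_eq ω h le_rfl h (y := wedge s t)
    (a := exteriorPower.ιMulti Γ(X, U) 2 ![s, t]) ?_, wedgeForm_ιMulti]
  · congr 1
    ext i
    fin_cases i <;> rfl
  · rw [toDet_ιMulti, res_self]; rfl

/-- The determinant of a bundle of rank two, embedded by an alternating form. -/
def ofDet (hM : IsVectorBundle M 2) (hr : Module.finrank X.functionField V = 2) (hω : ω ≠ 0) :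
    Emb (det M) X.functionField where
  j h := AddMonoidHom.mk' (E.detForm ω h) (E.detForm_add ω h)
  j_smul h c y := E.detForm_smul ω h c y
  j_res i h y := E.detForm_res ω i h y
  inj {U} h y hy := by
    refine eq_of_locally _ _ _ fun p hp ↦ ?_
    obtain ⟨U', hpU', e, he⟩ := hM p
    obtain ⟨V', hV', hpV', a, ha⟩ := exists_toDet y hp
    have hp' : p ∈ V' ⊓ U' := ⟨hpV', hpU'⟩
    refine ⟨V' ⊓ U', inf_le_left.trans hV', hp', ?_⟩
    obtain ⟨c, hc⟩ := IsFrame.exists_smul_wedge he inf_le_right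
      (wedgeRes M (inf_le_left : V' ⊓ U' ≤ V') a)
    have hη := genericPoint_mem hp'
    obtain ⟨b, hb, -⟩ := E.exists_framed hr hη (IsFrame.restrict he inf_le_right)
    have h1 : toDet M _ (wedgeRes M (inf_le_left : V' ⊓ U' ≤ V') a) =
        res _ (inf_le_left.trans hV') y := by rw [← res_toDet, ha, res_res]
    have h2 := E.detForm_eq ω h _ hη h1
    rw [show E.detForm ω h y = 0 from hy, hc, wedgeForm_smul, wedgeForm_ιMulti] at h2
    simp only [← hb] at h2
    -- Locally `y = c · e₀ ∧ e₁`, and `ω` does not vanish on a basis, so `c` has germ zero.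
    have h3 := (mul_eq_zero.1 h2.symm).resolve_right ((ω.map_basis_ne_zero_iff b).2 hω)
    have h4 : c = 0 := function_ext fun _ ↦ by rw [map_zero]; exact h3
    rw [← h1, hc, h4, zero_smul, map_zero, map_zero]

variable {ω}

theorem ofDet_j_wedge (hM : IsVectorBundle M 2) (hr : Module.finrank X.functionField V = 2)
    (hω : ω ≠ 0) {U : X.Opens} (h : genericPoint X ∈ U) (s t : Γ(M, U)) :
    (E.ofDet ω hM hr hω).j h (wedge s t) = ω ![E.j h s, E.j h t] :=
  E.detForm_wedge ω h s t

/-- The basis extends to a frame near `p`, whose wedge generates the determinant there and has value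
`ω b`. -/
theorem mem_lat_ofDet (hM : IsVectorBundle M 2) (hr : Module.finrank X.functionField V = 2)
    (hω : ω ≠ 0) {p : X} {b : Module.Basis (Fin 2) X.functionField V}
    (hb : ∀ v, v ∈ E.lat p ↔ ∀ i, b.repr v i ∈ reg p) {c : X.functionField} :
    c ∈ (E.ofDet ω hM hr hω).lat p ↔ c / ω b ∈ reg p := by
  have hωb := (ω.map_basis_ne_zero_iff b).2 hω
  obtain ⟨U, hU, hbU⟩ := E.exists_framed_of_lat hM hr hb
  obtain ⟨e, he, hbe⟩ := hbU.exists_isFrame (genericPoint_mem hU)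
  constructor
  · rintro ⟨U', hU', y, rfl⟩
    obtain ⟨V', hV', hpV', a, ha⟩ := exists_toDet y hU'
    have hp' : p ∈ V' ⊓ U := ⟨hpV', hU⟩
    obtain ⟨c, hc⟩ := IsFrame.exists_smul_wedge he inf_le_right
      (wedgeRes M (inf_le_left : V' ⊓ U ≤ V') a)
    have hη := genericPoint_mem hp'
    have h1 : toDet M _ (wedgeRes M (inf_le_left : V' ⊓ U ≤ V') a) =
        res _ (inf_le_left.trans hV') y := by rw [← res_toDet, ha, res_res]
    have h2 := E.detForm_eq ω (genericPoint_mem hU') _ hη h1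
    rw [hc, wedgeForm_smul, wedgeForm_ιMulti] at h2
    simp only [E.j_res, hbe] at h2
    change E.detForm ω (genericPoint_mem hU') y / _ ∈ _
    rw [h2, mul_div_cancel_right₀ _ hωb]
    exact germ_mem_reg hp' c
  · intro hc
    have h1 : c = (c / ω b) • ω b := by rw [smul_eq_mul, div_mul_cancel₀ _ hωb]
    rw [h1]
    refine smul_mem_lat _ hc ⟨U, hU, wedge (e 0) (e 1), ?_⟩
    rw [ofDet_j_wedge, hbe, hbe]
    congr 1
    ext i
    fin_cases i <;> rfl

end Emb

end DeterminantSections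

/-! ### Quadratic forms from the generic fibre -/

section QuadraticForms
variable {X : Scheme.{u}} [IsIntegral X] {M : X.Modules} {V W : Type u} [AddCommGroup V]
  [Module X.functionField V] [AddCommGroup W] [Module X.functionField W]

/-- A quadratic form on the generic fibre that is regular on the lattices induces a quadratic
form on the sheaf. -/
theorem Emb.exists_quadForm (E : Emb M V) (Q : QuadraticForm X.functionField V)
    (hQ : ∀ p, ∀ v ∈ E.lat p, Q v ∈ reg p) :
    ∃ q : QuadForm M, ∀ (U : X.Opens) (h : genericPoint X ∈ U) (s : Γ(M, U)),
      X.presheaf.germ U _ h (q.form U s) = Q (E.j h s) := by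
  have key : ∀ (U : X.Opens) (s : Γ(M, U)), ∃ a : Γ(X, U), ∀ h : genericPoint X ∈ U,
      X.presheaf.germ U _ h a = Q (E.j h s) := fun U s ↦ by
    by_cases h : genericPoint X ∈ U
    · obtain ⟨a, ha⟩ := exists_function h (c := Q (E.j h s))
        fun p hp ↦ hQ p _ (E.j_mem_lat hp h s)
      exact ⟨a, fun _ ↦ ha⟩
    · exact ⟨0, fun h' ↦ (h h').elim⟩
  choose f hf using key
  -- Polarisation commutes with germs, so the axioms of a quadratic form are inherited from `Q`.
  have hp : ∀ (U : X.Opens) (h : genericPoint X ∈ U) (s t : Γ(M, U)),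
      X.presheaf.germ U _ h (QuadraticMap.polar (f U) s t) =
        QuadraticMap.polar Q (E.j h s) (E.j h t) := fun U h s t ↦ by
    simp only [QuadraticMap.polar, map_sub, hf, map_add]
  refine ⟨⟨fun U ↦ QuadraticMap.ofPolar (f U) (fun a s ↦ function_ext fun h ↦ ?_)
    (fun s s' t ↦ function_ext fun h ↦ ?_) (fun a s t ↦ function_ext fun h ↦ ?_),
    fun U U' i s ↦ function_ext fun h ↦ ?_⟩, fun U h s ↦ hf U s h⟩
  · rw [hf, E.j_smul, QuadraticMap.map_smul, smul_eq_mul, smul_eq_mul, map_mul, map_mul, hf]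
  · rw [hp, map_add, QuadraticMap.polar_add_left, map_add, hp, hp]
  · rw [hp, E.j_smul, QuadraticMap.polar_smul_left, smul_eq_mul, smul_eq_mul, map_mul, hp]
  · exact (hf U' _ h).trans (((congrArg Q (E.j_res i h s)).trans (hf U s (i h)).symm).trans
      (germ_resO i h _).symm)

variable {k : Type*} {V W : Type*} [Field k] [AddCommGroup V] [Module k V] [AddCommGroup W]
  [Module k W]

omit [IsIntegral X] in
theorem AlternatingMap.eq_smul_of_basis
    {ω : V [⋀^Fin 2]→ₗ[k] k} (hω : ω ≠ 0) (ω' : V [⋀^Fin 2]→ₗ[k] k)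
    (b : Module.Basis (Fin 2) k V) : ω' = (ω' b / ω b) • ω := by
  have h := (ω.map_basis_ne_zero_iff b).2 hω
  rw [ω'.eq_smul_basis_det b]
  conv_rhs => rw [ω.eq_smul_basis_det b]
  rw [smul_smul]
  simp [b.det_self, h]

/-- The form `q` on `Hom(V, W)` with `Λ² T = q(T)`, for planes `V`, `W` with volume forms. -/
theorem exists_detQuad (hV : Module.finrank k V = 2) {ω : V [⋀^Fin 2]→ₗ[k] k} (hω : ω ≠ 0)
    (ω' : W [⋀^Fin 2]→ₗ[k] k) : ∃ Q : QuadraticForm k (V →ₗ[k] W),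
      ∀ T v w, ω' ![T v, T w] = Q T * ω ![v, w] := by
  have : Module.Finite k V := Module.finite_of_finrank_eq_succ hV
  let b : Module.Basis (Fin 2) k V := Module.finBasisOfFinrankEq k V hV
  -- `Q(T) = ω'(T b₀, T b₁) / ω(b)` is the diagonal of a bilinear form, which need not be symmetric.
  let B : LinearMap.BilinForm k (V →ₗ[k] W) := LinearMap.mk₂ k
    (fun T S ↦ (ω b)⁻¹ * ω' ![T (b 0), S (b 1)])
    (fun T T' S ↦ by
      have := ω'.map_update_add ![0, S (b 1)] 0 (T (b 0)) (T' (b 0))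
      have e : ∀ c, Function.update ![0, S (b 1)] 0 c = ![c, S (b 1)] := fun c ↦ by
        ext i; fin_cases i <;> rfl
      rw [e, e, e] at this
      rw [LinearMap.add_apply, this, mul_add])
    (fun c T S ↦ by
      have := ω'.map_update_smul ![0, S (b 1)] 0 c (T (b 0))
      have e : ∀ c, Function.update ![0, S (b 1)] 0 c = ![c, S (b 1)] := fun c ↦ by
        ext i; fin_cases i <;> rfl
      rw [e, e] at this
      rw [LinearMap.smul_apply, this, smul_eq_mul, smul_eq_mul, mul_left_comm])
    (fun T S S' ↦ by
      have := ω'.map_update_add ![T (b 0), 0] 1 (S (b 1)) (S' (b 1))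
      have e : ∀ c, Function.update ![T (b 0), 0] 1 c = ![T (b 0), c] := fun c ↦ by
        ext i; fin_cases i <;> rfl
      rw [e, e, e] at this
      rw [LinearMap.add_apply, this, mul_add])
    (fun c T S ↦ by
      have := ω'.map_update_smul ![T (b 0), 0] 1 c (S (b 1))
      have e : ∀ c, Function.update ![T (b 0), 0] 1 c = ![T (b 0), c] := fun c ↦ by
        ext i; fin_cases i <;> rfl
      rw [e, e] at this
      rw [LinearMap.smul_apply, this, smul_eq_mul, smul_eq_mul, mul_left_comm])
  refine ⟨B.toQuadraticMap, fun T v w ↦ ?_⟩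
  -- The pullback of `ω'` along `T` is a multiple of `ω`; the multiple is read off on `b`.
  have h1 := AlternatingMap.eq_smul_of_basis hω (ω'.compLinearMap T) b
  have h2 := congrArg (· ![v, w]) h1
  have e1 : (⇑T ∘ ![v, w]) = ![T v, T w] := by ext i; fin_cases i <;> rfl
  have e2 : (⇑T ∘ b) = ![T (b 0), T (b 1)] := by ext i; fin_cases i <;> rfl
  simp only [AlternatingMap.compLinearMap_apply, AlternatingMap.smul_apply, smul_eq_mul] at h2
  change ω' (⇑T ∘ ![v, w]) = ω' (⇑T ∘ b) / _ * _ at h2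
  rw [e1, e2] at h2
  rw [h2]
  change _ = (ω b)⁻¹ * ω' ![T (b 0), T (b 1)] * _
  ring

theorem detQuad_eq {ω : V [⋀^Fin 2]→ₗ[k] k} (hω : ω ≠ 0) {ω' : W [⋀^Fin 2]→ₗ[k] k}
    {Q : QuadraticForm k (V →ₗ[k] W)} (hQ : ∀ T v w, ω' ![T v, T w] = Q T * ω ![v, w])
    (b : Module.Basis (Fin 2) k V) (T : V →ₗ[k] W) : Q T = ω' ![T (b 0), T (b 1)] / ω b := by
  have e : (b : Fin 2 → V) = ![b 0, b 1] := by ext i; fin_cases i <;> rfl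
  have h := (ω.map_basis_ne_zero_iff b).2 hω
  rw [eq_div_iff h, hQ]
  congr 2

end QuadraticForms

/-! ### The determinant form of two bundles with isomorphic determinants -/

section DeterminantForm
variable {X : Scheme.{u}} [IsIntegral X] {F G : X.Modules} {V W : Type u} [AddCommGroup V]
  [Module X.functionField V] [AddCommGroup W] [Module X.functionField W]
  (EF : Emb F V) (EG : Emb G W)
  (hF : IsVectorBundle F 2) (hG : IsVectorBundle G 2) (hV : Module.finrank X.functionField V = 2)
  (hW : Module.finrank X.functionField W = 2)
  {ω : V [⋀^Fin 2]→ₗ[X.functionField] X.functionField}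
  {ω' : W [⋀^Fin 2]→ₗ[X.functionField] X.functionField} (hω : ω ≠ 0) (hω' : ω' ≠ 0)

omit [IsIntegral X] in
theorem res_app {M N : X.Modules} (f : M ⟶ N) {U U' : X.Opens} (i : U' ≤ U) (s : Γ(M, U)) :
    res N i (f.app U s) = f.app U' (res M i s) :=
  (PresheafOfModules.naturality_apply f.val (homOfLE i).op s).symm

/-- An isomorphism `det F ≅ det G` is given by volume forms on the generic fibres. -/
theorem exists_volumeForm (δ : det F ≅ det G) :
    ∃ (ω : V [⋀^Fin 2]→ₗ[X.functionField] X.functionField) (hω : ω ≠ 0),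
      ∀ (U : X.Opens) (h : genericPoint X ∈ U) (y : Γ(det F, U)),
        (EG.ofDet ω' hG hW hω').j h (δ.hom.app U y) = (EF.ofDet ω hF hV hω).j h y := by
  obtain ⟨U₀, h₀, e, he⟩ := hF (genericPoint X)
  obtain ⟨b, hb, -⟩ := EF.exists_framed hV h₀ he
  have hbe : (b : Fin 2 → V) = ![EF.j h₀ (e 0), EF.j h₀ (e 1)] := by
    ext i; fin_cases i <;> exact hb _
  have hdet : b.det ≠ 0 := fun h ↦ by
    have := b.det_self
    rw [h] at this
    exact zero_ne_one this
  set c := (EG.ofDet ω' hG hW hω').j h₀ (δ.hom.app U₀ (wedge (e 0) (e 1))) with hc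
  have hc0 : c ≠ 0 := fun h ↦ by
    have h1 := Emb.inj _ _ _ h
    have h2 : wedge (e 0) (e 1) = 0 := by
      have h3 := congrArg (fun y ↦ δ.inv.app U₀ y) h1
      simp only [map_zero] at h3
      rw [← h3, ← AddCommGrpCat.comp_apply, ← Scheme.Modules.Hom.comp_app, δ.hom_inv_id]
      rfl
    have h3 := EF.ofDet_j_wedge hF hV hdet h₀ (e 0) (e 1)
    rw [h2, map_zero, ← hbe, b.det_self] at h3
    exact zero_ne_one h3
  have hcω : c • b.det ≠ 0 := smul_ne_zero hc0 hdet
  refine ⟨c • b.det, hcω, fun U h y ↦ ?_⟩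
  obtain ⟨U₁, i₁, h₁, a, ha⟩ := exists_toDet y h
  have hη : genericPoint X ∈ U₁ ⊓ U₀ := ⟨h₁, h₀⟩
  obtain ⟨d, hd⟩ := IsFrame.exists_smul_wedge he (inf_le_right : U₁ ⊓ U₀ ≤ U₀)
    (wedgeRes F inf_le_left a)
  have h1 : res (det F) (inf_le_left.trans i₁ : U₁ ⊓ U₀ ≤ U) y =
      d • res (det F) inf_le_right (wedge (e 0) (e 1)) := by
    rw [res_wedge, ← res_res _ i₁ inf_le_left, ← ha, res_toDet, hd, map_smul, toDet_ιMulti]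
  rw [← (EG.ofDet ω' hG hW hω').j_res (inf_le_left.trans i₁ : U₁ ⊓ U₀ ≤ U) hη,
    ← (EF.ofDet _ hF hV hcω).j_res (inf_le_left.trans i₁ : U₁ ⊓ U₀ ≤ U) hη, res_app, h1,
    Scheme.Modules.Hom.app_smul, Emb.j_smul, Emb.j_smul, ← res_app, Emb.j_res, Emb.j_res, ← hc,
    EF.ofDet_j_wedge hF hV hcω, ← hbe, AlternatingMap.smul_apply, b.det_self, smul_eq_mul,
    smul_eq_mul, smul_eq_mul, mul_one]

variable {EF EG hF hG hV hW hω hω'} {δ : det F ≅ det G}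
  (hδ : ∀ (U : X.Opens) (h : genericPoint X ∈ U) (y : Γ(det F, U)),
    (EG.ofDet ω' hG hW hω').j h (δ.hom.app U y) = (EF.ofDet ω hF hV hω).j h y)
  {Q : QuadraticForm X.functionField (V →ₗ[X.functionField] W)}
  (hQ : ∀ T v w, ω' ![T v, T w] = Q T * ω ![v, w])
include hδ

theorem lat_det_eq (p : X) :
    (EF.ofDet ω hF hV hω).lat p = (EG.ofDet ω' hG hW hω').lat p := by
  ext c
  constructor
  · rintro ⟨U, hU, y, rfl⟩
    exact ⟨U, hU, δ.hom.app U y, hδ U _ y⟩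
  · rintro ⟨U, hU, y, rfl⟩
    refine ⟨U, hU, δ.inv.app U y, (hδ U _ _).symm.trans ?_⟩
    rw [← AddCommGrpCat.comp_apply, ← Scheme.Modules.Hom.comp_app, δ.inv_hom_id]
    rfl

include hQ

/-- After embedding both determinants, the condition `Λ²φ = q(φ) δ` becomes the defining relation of
`Q`. One frame at the generic point determines the coefficient. -/
theorem isDetForm_iff {q : QuadForm (homSheaf F G)} : IsDetForm δ q ↔
    ∀ (U : X.Opens) (h : genericPoint X ∈ U) (φ : Γ(homSheaf F G, U)),
      X.presheaf.germ U _ h (q.form U φ) = Q ((EF.hom EG hF hV).j h φ) := by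
  constructor
  · intro hq U h φ
    obtain ⟨U₀, h₀, e, he⟩ := hF (genericPoint X)
    have hη : genericPoint X ∈ U ⊓ U₀ := ⟨h, h₀⟩
    obtain ⟨b, hb, -⟩ := EF.exists_framed hV hη (IsFrame.restrict he inf_le_right)
    have h1 := congrArg ((EG.ofDet ω' hG hW hω').j hη) (hq U φ (U ⊓ U₀) inf_le_left
      (res F inf_le_right (e 0)) (res F inf_le_right (e 1)))
    rw [Emb.ofDet_j_wedge, Emb.j_smul, hδ, Emb.ofDet_j_wedge, ← Emb.hom_j_apply EF EG hF hV h,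
      ← Emb.hom_j_apply EF EG hF hV h, hQ, germ_resO] at h1
    have hbe : (b : Fin 2 → V) = ![EF.j hη (res F inf_le_right (e 0)),
        EF.j hη (res F inf_le_right (e 1))] := by
      ext i; fin_cases i <;> exact hb _
    rw [← hbe] at h1
    exact (mul_right_cancel₀ ((ω.map_basis_ne_zero_iff b).2 hω) h1).symm
  · intro hq U φ U' i s t
    refine (EG.ofDet ω' hG hW hω').section_ext fun h ↦ ?_
    rw [Emb.ofDet_j_wedge, Emb.j_smul, hδ, Emb.ofDet_j_wedge,
      ← Emb.hom_j_apply EF EG hF hV (i h), ← Emb.hom_j_apply EF EG hF hV (i h), hQ, germ_resO, hq]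
    rfl

/-- In local frames `Q T` is the determinant of a regular matrix times `ω'(b') / ω(b)`. That ratio
is regular because the determinants have the same lattices. -/
theorem detQuad_mem_reg {p : X} {T : V →ₗ[X.functionField] W}
    (hT : T ∈ (EF.hom EG hF hV).lat p) : Q T ∈ reg p := by
  obtain ⟨U, hU, b, hb⟩ := EF.exists_framed_at hF hV p
  obtain ⟨U', hU', b', hb'⟩ := EG.exists_framed_at hG hW p
  have hω'b := (ω'.map_basis_ne_zero_iff b').2 hω'
  have hωb := (ω.map_basis_ne_zero_iff b).2 hω
  rw [Emb.mem_lat_hom] at hT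
  have h1 : ω b / ω' b' ∈ reg p := by
    rw [← EG.mem_lat_ofDet hG hW hω' (hb' p hU'), ← lat_det_eq hδ,
      EF.mem_lat_ofDet hF hV hω (hb p hU), div_self hωb]
    exact one_mem _
  have h2 : ω' b' / ω b ∈ reg p := by
    rw [← EF.mem_lat_ofDet hF hV hω (hb p hU), lat_det_eq hδ,
      EG.mem_lat_ofDet hG hW hω' (hb' p hU'), div_self hω'b]
    exact one_mem _
  rw [detQuad_eq hω hQ b, ω'.eq_smul_basis_det b']
  have h3 : b'.det ![T (b 0), T (b 1)] ∈ reg p := by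
    rw [Module.Basis.det_apply, Matrix.det_fin_two]
    have h4 : ∀ i j, b'.repr (T (b i)) j ∈ reg p := fun i ↦
      (hb' p hU' _).1 (hT _ ((hb p hU _).2 (Emb.repr_self_mem_reg b p i)))
    simp only [Module.Basis.toMatrix_apply]
    exact sub_mem (mul_mem (h4 _ _) (h4 _ _)) (mul_mem (h4 _ _) (h4 _ _))
  rw [AlternatingMap.smul_apply, smul_eq_mul, mul_comm, mul_div_assoc]
  exact mul_mem h3 h2

theorem existsUnique_isDetForm : ∃! q : QuadForm (homSheaf F G), IsDetForm δ q := by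
  obtain ⟨q, hq⟩ := (EF.hom EG hF hV).exists_quadForm Q fun p T hT ↦ detQuad_mem_reg hδ hQ hT
  refine ⟨q, (isDetForm_iff hδ hQ).2 hq, fun q' hq' ↦ QuadForm.ext ?_⟩
  funext U
  ext φ
  refine function_ext fun h ↦ ?_
  rw [(isDetForm_iff hδ hQ).1 hq', hq]

end DeterminantForm

/-! ### A lattice criterion for orthogonal Hecke transforms -/

section HeckeCriterion
variable {X : Scheme.{u}} [IsIntegral X] {x : X} {F G F₁ G₁ : X.Modules} {V W : Type u}
  [AddCommGroup V] [Module X.functionField V] [AddCommGroup W] [Module X.functionField W]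
  {EF : Emb F V} {EG : Emb G W} {EF₁ : Emb F₁ V} {EG₁ : Emb G₁ W}
  {hF : IsVectorBundle F 2} {hG : IsVectorBundle G 2} {hV : Module.finrank X.functionField V = 2}
  {hW : Module.finrank X.functionField W = 2}
  {ω : V [⋀^Fin 2]→ₗ[X.functionField] X.functionField}
  {ω' : W [⋀^Fin 2]→ₗ[X.functionField] X.functionField} {hω : ω ≠ 0} {hω' : ω' ≠ 0}
  {δ : det F ≅ det G}
  (hδ : ∀ (U : X.Opens) (h : genericPoint X ∈ U) (y : Γ(det F, U)),
    (EG.ofDet ω' hG hW hω').j h (δ.hom.app U y) = (EF.ofDet ω hF hV hω).j h y)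
  {Q : QuadraticForm X.functionField (V →ₗ[X.functionField] W)}
  (hQ : ∀ T v w, ω' ![T v, T w] = Q T * ω ![v, w])
  {q : QuadForm (homSheaf F G)} (hq : IsDetForm δ q) (P : LocalParameter x)
  {L : Submodule (X.presheaf.stalk x) (Thick (homSheaf F G) x 2)}
include hδ hQ hq

/-- The orthogonal Hecke transform is `ℋom(F₁, G₁)` if this holds for the lattices. -/
theorem heckeEqHom_of_lat (hF₁ : IsVectorBundle F₁ 2) (hG₁ : IsVectorBundle G₁ 2)
    (hdet : ∀ p, (EF₁.ofDet ω hF₁ hV hω).lat p = (EG₁.ofDet ω' hG₁ hW hω').lat p)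
    (hlat : ∀ p, (EF₁.hom EG₁ hF₁ hV).lat p =
      (Emb.ofTwist P (Emb.ofTransform L (EF.hom EG hF hV))).lat p) :
    HeckeEqHom q L F₁ G₁ := by
  -- Both `δ₁` and `Ψ` are the identity on the ambient spaces, and `q₁` and `qH` are both induced by
  -- `Q`. The isometry property is therefore automatic.
  obtain ⟨δ₁, hδ₁⟩ := Emb.exists_iso _ _ hdet
  obtain ⟨q₁, hq₁, -⟩ := existsUnique_isDetForm hδ₁ hQ
  obtain ⟨Ψ, hΨ⟩ := Emb.exists_iso _ _ hlat
  obtain ⟨qH, hqH⟩ := Emb.exists_quadForm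
    (Emb.ofTwist P (Emb.ofTransform L (EF.hom EG hF hV))) Q fun p T hT ↦
      detQuad_mem_reg hδ₁ hQ (by rw [hlat]; exact hT)
  refine ⟨hF₁, hG₁, qH, δ₁, q₁, Ψ, fun U h U' i a ↦ function_ext fun hη ↦ ?_, hq₁,
    fun U ψ ↦ function_ext fun hη ↦ ?_⟩
  · have h1 : (EF.hom EG hF hV).j hη (heckeTransform.incl (ev h i a)) = _ :=
      (Emb.j_smul_ofTwist P (Emb.ofTransform L (EF.hom EG hF hV)) (i hη) h i hη a).symm
    have h2 := (isDetForm_iff hδ hQ).1 hq U' hη (heckeTransform.incl (ev h i a))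
    rw [h1, QuadraticMap.map_smul] at h2
    refine h2.trans ?_
    rw [map_mul, map_pow, sq, germ_resO]
    exact congrArg _ (hqH U (i hη) h).symm
  · rw [(isDetForm_iff hδ₁ hQ).1 hq₁ U hη ψ, ← hΨ]
    exact hqH U hη _

end HeckeCriterion

/-! ### Bases rescaled by powers of the local parameter -/

section ScaledLattices
variable {X : Scheme.{u}} [IsIntegral X] {x : X} {M N : X.Modules} {V W : Type u}
  [AddCommGroup V] [Module X.functionField V] [AddCommGroup W] [Module X.functionField W] {r : ℕ}

namespace LocalParameter

/-- The basis with vectors `τ^{α i} • b i`. -/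
def scale (P : LocalParameter x) (α : Fin r → ℤ) (b : Module.Basis (Fin r) X.functionField V) :
    Module.Basis (Fin r) X.functionField V :=
  b.unitsSMul fun i ↦ Units.mk0 (P.τ ^ α i) (zpow_ne_zero _ P.τ_ne_zero)

variable (P : LocalParameter x) (α : Fin r → ℤ) (b : Module.Basis (Fin r) X.functionField V)

theorem scale_apply (i : Fin r) : P.scale α b i = P.τ ^ α i • b i :=
  b.unitsSMul_apply i

theorem scale_repr (v : V) (i : Fin r) :
    (P.scale α b).repr v i = P.τ ^ (-α i) * b.repr v i := by
  rw [scale, Module.Basis.repr_unitsSMul, Units.smul_def, Units.val_inv_eq_inv_val, zpow_neg]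
  rfl

end LocalParameter

/-- A modification of a bundle at `x` is a bundle. -/
theorem Emb.isVectorBundle_of_scale [NeZero r] (hx : IsClosed {x}) (P : LocalParameter x)
    {E : Emb M V} {E₁ : Emb N V} (hM : IsVectorBundle M r)
    (hV : Module.finrank X.functionField V = r)
    {b : Module.Basis (Fin r) X.functionField V} {α : Fin r → ℤ}
    (hb : ∀ v, v ∈ E.lat x ↔ ∀ i, b.repr v i ∈ reg x) (h : ∀ p ≠ x, E₁.lat p = E.lat p)
    (hb₁ : ∀ v, v ∈ E₁.lat x ↔ ∀ i, (P.scale α b).repr v i ∈ reg x) : IsVectorBundle N r := by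
  refine Emb.isVectorBundle (E := E₁) fun p ↦ ?_
  by_cases hp : p = x
  · subst hp
    obtain ⟨U, hU, hbU⟩ := E.exists_framed_of_lat hM hV hb
    refine ⟨U ⊓ P.U, mem_inf hU P.mem, P.scale α b, fun p' hp' v ↦ ?_⟩
    by_cases hpp : p' = p
    · subst hpp
      exact hb₁ v
    · rw [h p' hpp, hbU p' hp'.1]
      -- Away from the point all powers of `τ` are regular, so the rescaling does not change the
      -- lattice.
      refine forall_congr' fun i ↦ ?_
      rw [P.scale_repr]
      constructor
      · exact fun h ↦ mul_mem (P.τ_zpow_mem_reg hp'.2 hpp _) h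
      · intro h
        have := mul_mem (P.τ_zpow_mem_reg hp'.2 hpp (α i)) h
        rwa [← mul_assoc, ← zpow_add₀ P.τ_ne_zero, add_neg_cancel, zpow_zero, one_mul] at this
  · obtain ⟨U, hU, b, hb⟩ := E.exists_framed_at hM hV p
    refine ⟨U ⊓ puncture hx, mem_inf hU hp, b, fun p' hp' v ↦ ?_⟩
    rw [h p' hp'.2]
    exact hb p' hp'.1 v

theorem Emb.mem_lat_hom_iff_repr [NeZero r] {E : Emb M V} {E' : Emb N W} {hM : IsVectorBundle M r}
    {hV : Module.finrank X.functionField V = r} {p : X}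
    {b : Module.Basis (Fin r) X.functionField V} {b' : Module.Basis (Fin r) X.functionField W}
    (hb : ∀ v, v ∈ E.lat p ↔ ∀ i, b.repr v i ∈ reg p)
    (hb' : ∀ v, v ∈ E'.lat p ↔ ∀ i, b'.repr v i ∈ reg p) {T : V →ₗ[X.functionField] W} :
    T ∈ (E.hom E' hM hV).lat p ↔ ∀ i j, b'.repr (T (b j)) i ∈ reg p := by
  rw [mem_lat_hom]
  constructor
  · exact fun h i j ↦ (hb' _).1 (h _ ((hb _).2 (repr_self_mem_reg b p j))) i
  · intro h v hv
    rw [← b.sum_repr v, map_sum]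
    refine AddSubgroup.sum_mem _ fun j _ ↦ ?_
    rw [map_smul]
    exact E'.smul_mem_lat ((hb v).1 hv j) ((hb' _).2 fun i ↦ h i j)

end ScaledLattices

section HeckeCriterion
variable {X : Scheme.{u}} [IsIntegral X] {x : X} {F G F₁ G₁ : X.Modules} {V W : Type u}
  [AddCommGroup V] [Module X.functionField V] [AddCommGroup W] [Module X.functionField W]
  {EF : Emb F V} {EG : Emb G W} {EF₁ : Emb F₁ V} {EG₁ : Emb G₁ W}
  {hF : IsVectorBundle F 2} {hG : IsVectorBundle G 2} {hV : Module.finrank X.functionField V = 2}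
  {hW : Module.finrank X.functionField W = 2}
  {ω : V [⋀^Fin 2]→ₗ[X.functionField] X.functionField}
  {ω' : W [⋀^Fin 2]→ₗ[X.functionField] X.functionField} {hω : ω ≠ 0} {hω' : ω' ≠ 0}
  {δ : det F ≅ det G}
  (hδ : ∀ (U : X.Opens) (h : genericPoint X ∈ U) (y : Γ(det F, U)),
    (EG.ofDet ω' hG hW hω').j h (δ.hom.app U y) = (EF.ofDet ω hF hV hω).j h y)
  {Q : QuadraticForm X.functionField (V →ₗ[X.functionField] W)}
  (hQ : ∀ T v w, ω' ![T v, T w] = Q T * ω ![v, w])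
  {q : QuadForm (homSheaf F G)} (hq : IsDetForm δ q) (hx : IsClosed {x}) (P : LocalParameter x)
  {L : Submodule (X.presheaf.stalk x) (Thick (homSheaf F G) x 2)}
include hδ hQ hq hx

/-- In the rescaled bases the entry of `T` at `(i, j)` acquires the factor `τ^(α j - β i)`. The
extra `-1` in the condition on `L` is absorbed by the twist. Equal sums of exponents keep the
determinant lattices equal. -/
theorem heckeEqHom_of_scale {b : Module.Basis (Fin 2) X.functionField V}
    {b' : Module.Basis (Fin 2) X.functionField W} {α β : Fin 2 → ℤ}
    (hαβ : ∑ i, α i = ∑ i, β i)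
    (hb : ∀ v, v ∈ EF.lat x ↔ ∀ i, b.repr v i ∈ reg x)
    (hb' : ∀ v, v ∈ EG.lat x ↔ ∀ i, b'.repr v i ∈ reg x)
    (hF₁ : ∀ p ≠ x, EF₁.lat p = EF.lat p) (hG₁ : ∀ p ≠ x, EG₁.lat p = EG.lat p)
    (hb₁ : ∀ v, v ∈ EF₁.lat x ↔ ∀ i, P.τ ^ (-α i) * b.repr v i ∈ reg x)
    (hb₁' : ∀ v, v ∈ EG₁.lat x ↔ ∀ i, P.τ ^ (-β i) * b'.repr v i ∈ reg x)
    (hL : ∀ T, T ∈ (Emb.ofTransform L (EF.hom EG hF hV)).lat x ↔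
      ∀ i j, P.τ ^ (α j - β i - 1) * b'.repr (T (b j)) i ∈ reg x) :
    HeckeEqHom q L F₁ G₁ := by
  simp only [← P.scale_repr] at hb₁ hb₁'
  have bF₁ := Emb.isVectorBundle_of_scale hx P hF hV hb hF₁ hb₁
  have bG₁ := Emb.isVectorBundle_of_scale hx P hG hW hb' hG₁ hb₁'
  refine heckeEqHom_of_lat hδ hQ hq P (EF₁ := EF₁) (EG₁ := EG₁) bF₁ bG₁ (fun p ↦ ?_) fun p ↦ ?_
  · ext c
    by_cases hp : p = x
    · subst hp
      rw [EF₁.mem_lat_ofDet bF₁ hV hω hb₁, EG₁.mem_lat_ofDet bG₁ hW hω' hb₁']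
      have e : (P.scale α b : Fin 2 → V) = fun i ↦ P.τ ^ α i • b i := funext (P.scale_apply α b)
      have e' : (P.scale β b' : Fin 2 → W) = fun i ↦ P.τ ^ β i • b' i :=
        funext (P.scale_apply β b')
      rw [e, e', AlternatingMap.map_smul_univ, AlternatingMap.map_smul_univ, Fin.prod_univ_two,
        Fin.prod_univ_two, ← zpow_add₀ P.τ_ne_zero, ← zpow_add₀ P.τ_ne_zero]
      rw [Fin.sum_univ_two, Fin.sum_univ_two] at hαβ
      rw [hαβ, smul_eq_mul, smul_eq_mul, ← div_div, ← div_div, ← EF.mem_lat_ofDet hF hV hω hb,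
        ← EG.mem_lat_ofDet hG hW hω' hb', lat_det_eq hδ]
    · obtain ⟨U, hU, b, hb⟩ := EF.exists_framed_at hF hV p
      obtain ⟨U', hU', b', hb'⟩ := EG.exists_framed_at hG hW p
      have h1 := hb p hU
      have h2 := hb' p hU'
      rw [← hF₁ p hp] at h1
      rw [← hG₁ p hp] at h2
      rw [EF₁.mem_lat_ofDet bF₁ hV hω h1, EG₁.mem_lat_ofDet bG₁ hW hω' h2,
        ← EF.mem_lat_ofDet hF hV hω (hb p hU), ← EG.mem_lat_ofDet hG hW hω' (hb' p hU'),
        lat_det_eq hδ]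
  · ext T
    by_cases hp : p = x
    · subst hp
      rw [Emb.mem_lat_hom_iff_repr hb₁ hb₁', Emb.mem_lat_ofTwist, hL]
      refine forall_congr' fun i ↦ forall_congr' fun j ↦ ?_
      rw [P.scale_repr, P.scale_apply, map_smul, map_smul, Finsupp.smul_apply, LinearMap.smul_apply,
        map_smul, Finsupp.smul_apply, smul_eq_mul, smul_eq_mul, ← mul_assoc, ← mul_assoc,
        ← zpow_add₀ P.τ_ne_zero, zpow_sub_one₀ P.τ_ne_zero, inv_mul_cancel_right₀ P.τ_ne_zero,
        neg_add_eq_sub]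
    · rw [Emb.lat_ofTwist_of_ne hx P _ hp, Emb.lat_ofTransform_of_ne L hx _ hp, Emb.mem_lat_hom,
        Emb.mem_lat_hom, hF₁ p hp, hG₁ p hp]

end HeckeCriterion

/-! ### Lagrangian lattices of two-by-two matrices -/

section ResidueAlgebra

/-- The reduction of a local `K`-algebra with principal maximal ideal and residue field `K`. -/
structure Residue (K R : Type*) [Field K] [CommRing R] [Algebra K R] where
  ρ : R →ₐ[K] K
  t : R
  t_ne_zero : t ≠ 0
  eq_zero_iff : ∀ a, ρ a = 0 ↔ t ∣ a
  isUnit : ∀ a, ρ a ≠ 0 → IsUnit a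

/-- The determinant of two vectors in the plane. -/
def bracket {A : Type*} [CommRing A] (u v : Fin 2 → A) : A := u 0 * v 1 - u 1 * v 0

/-- The vectors `w` and `(-q, p)` form a basis of determinant one; the coordinates of `v` are `p v₀
+ q v₁` and the bracket with `w`. -/
theorem bracket_decomposition {A : Type*} [CommRing A] {w : Fin 2 → A} {p q : A}
    (h : p * w 0 + q * w 1 = 1) (v : Fin 2 → A) :
    v 0 = (p * v 0 + q * v 1) * w 0 - q * bracket w v ∧
      v 1 = (p * v 0 + q * v 1) * w 1 + p * bracket w v := by
  unfold bracket
  constructor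
  · linear_combination (-v 0) * h
  · linear_combination (-v 1) * h

/-- The matrices all of whose columns are proportional to `w`. -/
def columnSpace (K : Type*) [Field K] (w : Fin 2 → K) :
    Submodule K (Matrix (Fin 2) (Fin 2) K) where
  carrier := {A | ∀ j, bracket w (A.transpose j) = 0}
  add_mem' {A B} hA hB j := by
    have h1 := hA j
    have h2 := hB j
    simp only [bracket, Matrix.transpose_apply, Matrix.add_apply] at h1 h2 ⊢
    linear_combination h1 + h2
  zero_mem' j := by simp [bracket]
  smul_mem' c A hA j := by
    have h1 := hA j
    simp only [bracket, Matrix.transpose_apply, Matrix.smul_apply, smul_eq_mul] at h1 ⊢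
    linear_combination c * h1

/-- The matrices all of whose rows are proportional to `w`. -/
def rowSpace (K : Type*) [Field K] (w : Fin 2 → K) :
    Submodule K (Matrix (Fin 2) (Fin 2) K) :=
  (columnSpace K w).comap (Matrix.transposeLinearEquiv (Fin 2) (Fin 2) K K).toLinearMap

section Field
variable {K : Type*} [Field K]

theorem exists_coprime {w : Fin 2 → K} (hw : w ≠ 0) : ∃ p q, p * w 0 + q * w 1 = 1 := by
  by_cases h : w 0 = 0
  · have h1 : w 1 ≠ 0 := fun h1 ↦ hw (by ext i; fin_cases i <;> assumption)
    exact ⟨0, (w 1)⁻¹, by simp [h1]⟩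
  · exact ⟨(w 0)⁻¹, 0, by simp [h]⟩

theorem finrank_columnSpace {w : Fin 2 → K} (hw : w ≠ 0) :
    Module.finrank K (columnSpace K w) = 2 := by
  let f : (Fin 2 → K) →ₗ[K] Matrix (Fin 2) (Fin 2) K :=
    { toFun := fun c ↦ Matrix.of fun i j ↦ c j * w i
      map_add' := fun c d ↦ by ext i j; simp [add_mul]
      map_smul' := fun a c ↦ by ext i j; simp [mul_assoc] }
  obtain ⟨p, q, hpq⟩ := exists_coprime hw
  have hf : Function.Injective f := by
    intro c d h
    ext j
    have h0 := congrFun (congrFun h 0) j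
    have h1 := congrFun (congrFun h 1) j
    change c j * w 0 = d j * w 0 at h0
    change c j * w 1 = d j * w 1 at h1
    linear_combination p * h0 + q * h1 - (c j - d j) * hpq
  have hr : LinearMap.range f = columnSpace K w := by
    ext A
    constructor
    · rintro ⟨c, rfl⟩ j
      change w 0 * (c j * w 1) - w 1 * (c j * w 0) = 0
      ring
    · intro hA
      refine ⟨fun j ↦ p * A 0 j + q * A 1 j, ?_⟩
      ext i j
      obtain ⟨e0, e1⟩ := bracket_decomposition hpq (A.transpose j)
      rw [hA j] at e0 e1
      simp only [Matrix.transpose_apply] at e0 e1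
      fin_cases i
      · exact (e0.trans (by simp [f])).symm
      · exact (e1.trans (by simp [f])).symm
  rw [← hr, LinearMap.finrank_range_of_inj hf]
  simp

theorem finrank_rowSpace {w : Fin 2 → K} (hw : w ≠ 0) :
    Module.finrank K (rowSpace K w) = 2 := by
  have e : rowSpace K w =
      (columnSpace K w).map (Matrix.transposeLinearEquiv (Fin 2) (Fin 2) K K).symm.toLinearMap :=
    Submodule.comap_equiv_eq_map_symm _ _
  rw [e, LinearEquiv.finrank_map_eq, finrank_columnSpace hw]

/-- The planes of singular matrices. -/
theorem eq_columnSpace_or_rowSpace {V : Submodule K (Matrix (Fin 2) (Fin 2) K)}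
    (hV : Module.finrank K V = 2) (hdet : ∀ A ∈ V, A.det = 0) :
    (∃ w ≠ 0, V = columnSpace K w) ∨ ∃ w ≠ 0, V = rowSpace K w := by
  have : Module.Finite K V := Module.finite_of_finrank_eq_succ hV
  let b := Module.finBasisOfFinrankEq K V hV
  obtain ⟨A, hA⟩ : ∃ A : Matrix (Fin 2) (Fin 2) K, A = (b 0 : V) := ⟨_, rfl⟩
  obtain ⟨B, hB⟩ : ∃ B : Matrix (Fin 2) (Fin 2) K, B = (b 1 : V) := ⟨_, rfl⟩
  have hAV : A ∈ V := hA ▸ (b 0).2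
  have hBV : B ∈ V := hB ▸ (b 1).2
  have hle : ∀ S : Submodule K (Matrix (Fin 2) (Fin 2) K), A ∈ S → B ∈ S → V ≤ S := by
    intro S hAS hBS C hC
    have := congrArg Subtype.val (b.sum_repr ⟨C, hC⟩)
    rw [Fin.sum_univ_two] at this
    rw [← show _ = C from this]
    refine S.add_mem ?_ ?_
    · exact S.smul_mem _ (hA ▸ hAS)
    · exact S.smul_mem _ (hB ▸ hBS)
  have hA0 : A ≠ 0 := fun h ↦ b.ne_zero 0 (Subtype.ext (hA.symm.trans h))
  have hdA := hdet A hAV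
  have hdB := hdet B hBV
  have hAB := hdet (A + B) (V.add_mem hAV hBV)
  rw [Matrix.det_fin_two] at hdA hdB hAB
  simp only [Matrix.add_apply] at hAB
  -- A nonzero column of the singular matrix `A` serves as `u`, and then `A i j = c j * u i`.
  obtain ⟨u, hu, hAu⟩ : ∃ u ≠ 0, A ∈ columnSpace K u := by
    by_cases h0 : A.transpose 0 = 0
    · have h1 : A.transpose 1 ≠ 0 := fun h1 ↦ hA0 (by
        ext i j
        fin_cases j
        exacts [congrFun h0 i, congrFun h1 i])
      refine ⟨_, h1, fun j ↦ ?_⟩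
      fin_cases j
      · change bracket _ (A.transpose 0) = 0
        rw [h0]; simp [bracket]
      · exact sub_eq_zero.2 (mul_comm _ _)
    · refine ⟨_, h0, fun j ↦ ?_⟩
      fin_cases j
      · exact sub_eq_zero.2 (mul_comm _ _)
      · change A 0 0 * A 1 1 - A 1 0 * A 0 1 = 0
        linear_combination hdA
  obtain ⟨p, q, hpq⟩ := exists_coprime hu
  obtain ⟨c, hc⟩ : ∃ c : Fin 2 → K, ∀ i j, A i j = c j * u i := by
    refine ⟨fun j ↦ p * A 0 j + q * A 1 j, fun i j ↦ ?_⟩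
    obtain ⟨e0, e1⟩ := bracket_decomposition hpq (A.transpose j)
    rw [hAu j] at e0 e1
    fin_cases i
    · simpa using e0
    · simpa using e1
  -- `κ` is the image under `B` of the kernel vector `(c₁, -c₀)` of `A`. Singularity of `A + B`
  -- makes it proportional to `u`. If `κ = 0`, the rows of `B` are proportional to `c`; otherwise
  -- `κ` spans the column space of the singular matrix `B`.
  obtain ⟨κ, hκ⟩ : ∃ κ : Fin 2 → K, ∀ i, κ i = B i 0 * c 1 - B i 1 * c 0 := ⟨_, fun _ ↦ rfl⟩
  have huκ : bracket u κ = 0 := by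
    simp only [hc] at hAB
    rw [bracket, hκ, hκ]
    linear_combination hdB - hAB
  by_cases hκ0 : κ = 0
  · right
    have hc0 : c ≠ 0 := fun h ↦ hA0 (by ext i j; rw [hc, h]; simp)
    refine ⟨c, hc0, Submodule.eq_of_le_of_finrank_eq (hle _ (fun i ↦ ?_) fun i ↦ ?_)
      (hV.trans (finrank_rowSpace hc0).symm)⟩
    · change c 0 * A i 1 - c 1 * A i 0 = 0
      rw [hc, hc]; ring
    · change c 0 * B i 1 - c 1 * B i 0 = 0
      have := hκ i
      rw [hκ0, Pi.zero_apply] at this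
      linear_combination this
  · left
    refine ⟨u, hu, Submodule.eq_of_le_of_finrank_eq (hle _ hAu fun j ↦ ?_)
      (hV.trans (finrank_columnSpace hu).symm)⟩
    obtain ⟨e0, e1⟩ := bracket_decomposition hpq κ
    rw [huκ] at e0 e1
    have h0 : p * κ 0 + q * κ 1 ≠ 0 := fun h ↦ hκ0 (by
      rw [h] at e0 e1
      ext i; fin_cases i
      · simpa using e0
      · simpa using e1)
    refine (mul_eq_zero.1 (?_ : (p * κ 0 + q * κ 1) * _ = 0)).resolve_left h0
    have h1 : bracket κ (B.transpose j) = 0 := by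
      rw [bracket, hκ, hκ]
      fin_cases j
      · change _ * B 1 0 - _ * B 0 0 = 0
        linear_combination c 0 * hdB
      · change _ * B 1 1 - _ * B 0 1 = 0
        linear_combination c 1 * hdB
    rw [bracket] at h1 ⊢
    linear_combination h1 - e0 * B.transpose j 1 + e1 * B.transpose j 0

end Field

namespace Residue
variable {K R : Type*} [Field K] [CommRing R] [Algebra K R] (S : Residue K R)

/-- Reduction of matrices. -/
def red : Matrix (Fin 2) (Fin 2) R →ₗ[K] Matrix (Fin 2) (Fin 2) K := S.ρ.toLinearMap.mapMatrix

theorem red_apply (A : Matrix (Fin 2) (Fin 2) R) (i j : Fin 2) : S.red A i j = S.ρ (A i j) := rfl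

variable (P : Submodule R (Matrix (Fin 2) (Fin 2) R))

/-- The image of `P` modulo `t`. -/
def image : Submodule K (Matrix (Fin 2) (Fin 2) K) := (P.restrictScalars K).map S.red

/-- The image of `t⁻¹ P` modulo `t`. -/
def coimage : Submodule K (Matrix (Fin 2) (Fin 2) K) :=
  ((P.comap (LinearMap.lsmul R (Matrix (Fin 2) (Fin 2) R) S.t)).restrictScalars K).map S.red

variable {P}

theorem image_le_coimage : S.image P ≤ S.coimage P := by
  rintro _ ⟨A, hA, rfl⟩
  exact ⟨A, P.smul_mem _ hA, rfl⟩

theorem ρ_t : S.ρ S.t = 0 := (S.eq_zero_iff _).2 dvd_rfl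

theorem ρ_eq_zero_of_dvd {a : R} (h : S.t ^ 2 ∣ a) : S.ρ a = 0 :=
  (S.eq_zero_iff a).2 ((Dvd.intro_left _ (sq S.t).symm).trans h)

theorem ρ_surjective : Function.Surjective S.ρ := fun c ↦ ⟨algebraMap K R c, by simp⟩

theorem red_surjective : Function.Surjective S.red := fun a ↦
  ⟨a.map (algebraMap K R), by ext i j; simp [red_apply]⟩

theorem exists_red_eq {A B : Matrix (Fin 2) (Fin 2) R} (h : S.red A = S.red B) :
    ∃ C, A = B + S.t • C := by
  have h1 : ∀ i j, ∃ c, A i j - B i j = S.t * c := fun i j ↦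
    (S.eq_zero_iff _).1 (by rw [map_sub, sub_eq_zero]; exact congrFun (congrFun h i) j)
  choose C hC using h1
  refine ⟨Matrix.of C, ?_⟩
  ext i j
  rw [Matrix.add_apply, Matrix.smul_apply, Matrix.of_apply, smul_eq_mul, ← hC]
  ring

/-- Since `P` contains all multiples of `t²`, whether `t A` lies in `P` depends only on `A` modulo
`t`. -/
theorem smul_mem_of_red (hP : ∀ B, S.t ^ 2 • B ∈ P) {A : Matrix (Fin 2) (Fin 2) R}
    (hA : S.red A ∈ S.coimage P) : S.t • A ∈ P := by
  obtain ⟨B, hB, h⟩ := hA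
  obtain ⟨C, rfl⟩ := S.exists_red_eq h.symm
  rw [smul_add, smul_smul, ← sq]
  exact P.add_mem hB (hP C)

theorem det_image (hdet : ∀ A ∈ P, S.t ^ 2 ∣ A.det) : ∀ a ∈ S.image P, a.det = 0 := by
  rintro _ ⟨A, hA, rfl⟩
  have := S.ρ_eq_zero_of_dvd (hdet A hA)
  rw [AlgHom.map_det] at this
  exact this

theorem exists_coprime {w : Fin 2 → R} (hw : (fun i ↦ S.ρ (w i)) ≠ 0) :
    ∃ p q, p * w 0 + q * w 1 = 1 := by
  by_cases h : S.ρ (w 0) = 0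
  · have h1 : S.ρ (w 1) ≠ 0 := fun h1 ↦ hw (by ext i; fin_cases i <;> assumption)
    obtain ⟨v, hv⟩ := (S.isUnit _ h1).exists_left_inv
    exact ⟨0, v, by simp [hv]⟩
  · obtain ⟨v, hv⟩ := (S.isUnit _ h).exists_left_inv
    exact ⟨v, 0, by simp [hv]⟩

/-- The matrices all of whose columns are proportional to `w` modulo `t²`. -/
def columnLattice (w : Fin 2 → R) : Submodule R (Matrix (Fin 2) (Fin 2) R) where
  carrier := {A | ∀ j, S.t ^ 2 ∣ bracket w (A.transpose j)}
  add_mem' {A B} hA hB j := by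
    have h := dvd_add (hA j) (hB j)
    convert h using 1
    simp only [bracket, Matrix.transpose_apply, Matrix.add_apply]
    ring
  zero_mem' j := by simp [bracket]
  smul_mem' c A hA j := by
    have h := (hA j).mul_left c
    convert h using 1
    simp only [bracket, Matrix.transpose_apply, Matrix.smul_apply, smul_eq_mul]
    ring

/-- The matrices all of whose rows are proportional to `w` modulo `t²`. -/
def rowLattice (w : Fin 2 → R) : Submodule R (Matrix (Fin 2) (Fin 2) R) :=
  (S.columnLattice w).comap (Matrix.transposeLinearEquiv (Fin 2) (Fin 2) R R).toLinearMap

theorem mem_columnLattice {w : Fin 2 → R} {A : Matrix (Fin 2) (Fin 2) R} :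
    A ∈ S.columnLattice w ↔ ∀ j, S.t ^ 2 ∣ bracket w (A.transpose j) := Iff.rfl

theorem mem_rowLattice {w : Fin 2 → R} {A : Matrix (Fin 2) (Fin 2) R} :
    A ∈ S.rowLattice w ↔ ∀ i, S.t ^ 2 ∣ bracket w (A i) := Iff.rfl

/-- Lift `(u | 0)` and `(0 | u)` to `a` and `b` in `P`, and let `w` be the first column of `a`.
Polarising the determinant against `a` bounds the second columns of `P`, and against `b` the first
columns. For the reverse inclusion `a` and `b` are corrected by elements of `t M₂(R) ∩ P`, which the
coimage describes. -/
theorem eq_columnLattice [IsDomain R] (hP : ∀ B, S.t ^ 2 • B ∈ P)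
    (hdet : ∀ A ∈ P, S.t ^ 2 ∣ A.det) {u : Fin 2 → K} (hu : u ≠ 0)
    (hV : S.image P = columnSpace K u) (hW : S.coimage P = columnSpace K u) :
    ∃ w : Fin 2 → R, (fun i ↦ S.ρ (w i)) = u ∧ P = S.columnLattice w := by
  have h0 : Matrix.of ![![u 0, 0], ![u 1, 0]] ∈ S.image P := by
    rw [hV]
    intro j
    fin_cases j <;> simp [bracket, mul_comm]
  have h1 : Matrix.of ![![0, u 0], ![0, u 1]] ∈ S.image P := by
    rw [hV]
    intro j
    fin_cases j <;> simp [bracket, mul_comm]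
  obtain ⟨a, ha, hau⟩ := h0
  obtain ⟨b, hb, hbu⟩ := h1
  have hau' := fun i j ↦ congrFun (congrFun hau i) j
  have hbu' := fun i j ↦ congrFun (congrFun hbu i) j
  simp only [red_apply] at hau' hbu'
  obtain ⟨w, hwa⟩ : ∃ w : Fin 2 → R, ∀ i, w i = a i 0 := ⟨_, fun _ ↦ rfl⟩
  have hwu : (fun i ↦ S.ρ (w i)) = u := by
    ext i
    rw [hwa, hau']
    fin_cases i <;> rfl
  obtain ⟨p, q, hpq⟩ := S.exists_coprime (w := w) (by rwa [hwu])
  have hdec := fun v ↦ bracket_decomposition hpq v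
  obtain ⟨a₁, ha₁⟩ : ∃ v : Fin 2 → R, ∀ i, a i 1 = S.t * v i := by
    choose v hv using fun i ↦ (S.eq_zero_iff (a i 1)).1 (by rw [hau']; fin_cases i <;> rfl)
    exact ⟨v, hv⟩
  obtain ⟨b₀, hb₀⟩ : ∃ v : Fin 2 → R, ∀ i, b i 0 = S.t * v i := by
    choose v hv using fun i ↦ (S.eq_zero_iff (b i 0)).1 (by rw [hbu']; fin_cases i <;> rfl)
    exact ⟨v, hv⟩
  have hPmod : ∀ A ∈ P, ∀ j, S.t ∣ bracket w (A.transpose j) := by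
    intro A hA j
    rw [← S.eq_zero_iff]
    have h : S.red A ∈ columnSpace K u := hV ▸ ⟨A, hA, rfl⟩
    have h2 := h j
    rw [← hwu] at h2
    simpa [bracket, red_apply] using h2
  have hpolar : ∀ A ∈ P, ∀ B ∈ P, S.t ^ 2 ∣
      A 0 0 * B 1 1 + B 0 0 * A 1 1 - A 0 1 * B 1 0 - B 0 1 * A 1 0 := by
    intro A hA B hB
    have h := dvd_sub (dvd_sub (hdet _ (P.add_mem hA hB)) (hdet A hA)) (hdet B hB)
    convert h using 1
    simp only [Matrix.det_fin_two, Matrix.add_apply]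
    ring
  -- Here `a = (w | t a₁)`, and its determinant is the right-hand side.
  have hwa₁ : S.t ^ 2 ∣ S.t * bracket w a₁ := by
    have h := hdet a ha
    rw [Matrix.det_fin_two, ha₁, ha₁, ← hwa, ← hwa] at h
    convert h using 1
    rw [bracket]; ring
  -- The polar form of `A` and `a` is this bracket plus `t` times the bracket of the first column of
  -- `A` with `a₁`. That column is a multiple of `w` modulo `t`, so the second term is divisible by
  -- `t²`.
  have hcol1 : ∀ A ∈ P, S.t ^ 2 ∣ bracket w (A.transpose 1) := by
    intro A hA
    obtain ⟨c, hc⟩ := hPmod A hA 0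
    obtain ⟨d, hd⟩ := hwa₁
    obtain ⟨f, hf⟩ := hpolar A hA a ha
    obtain ⟨e0, e1⟩ := hdec (A.transpose 0)
    rw [hc] at e0 e1
    rw [ha₁, ha₁, ← hwa, ← hwa] at hf
    simp only [bracket, Matrix.transpose_apply] at hf hd e0 e1 ⊢
    refine ⟨f - (p * A 0 0 + q * A 1 0) * d + c * (q * a₁ 1 + p * a₁ 0), ?_⟩
    linear_combination hf - (p * A 0 0 + q * A 1 0) * hd - S.t * a₁ 1 * e0 + S.t * a₁ 0 * e1
  obtain ⟨c₁, hc₁⟩ := hcol1 b hb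
  obtain ⟨eb0, eb1⟩ := hdec (b.transpose 1)
  rw [hc₁] at eb0 eb1
  simp only [Matrix.transpose_apply] at eb0 eb1
  -- The second column of `b` is `l w` modulo `t²`; as it reduces to `u ≠ 0`, the factor `l` is a
  -- unit.
  obtain ⟨l, hl⟩ : ∃ l, l = p * b 0 1 + q * b 1 1 := ⟨_, rfl⟩
  rw [← hl] at eb0 eb1
  have hlu : IsUnit l := S.isUnit _ fun h ↦ hu (by
    have e0 := congrArg S.ρ eb0
    have e1 := congrArg S.ρ eb1
    simp only [map_sub, map_add, map_mul, map_pow, h, S.ρ_t, hbu'] at e0 e1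
    ext i
    fin_cases i
    · simpa using e0
    · simpa using e1)
  have hwb₀ : S.t ^ 2 ∣ S.t * bracket w b₀ := by
    obtain ⟨f, hf⟩ := hdet b hb
    rw [Matrix.det_fin_two, hb₀, hb₀, eb0, eb1] at hf
    rw [← hlu.dvd_mul_left]
    refine ⟨S.t * (q * b₀ 1 * c₁ + p * b₀ 0 * c₁) - f, ?_⟩
    rw [bracket]
    linear_combination -hf
  -- The same polarisation against `b`, with the columns exchanged and the unit `l` in front.
  have hcol0 : ∀ A ∈ P, S.t ^ 2 ∣ bracket w (A.transpose 0) := by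
    intro A hA
    obtain ⟨c, hc⟩ := hcol1 A hA
    obtain ⟨d, hd⟩ := hwb₀
    obtain ⟨f, hf⟩ := hpolar A hA b hb
    obtain ⟨e0, e1⟩ := hdec (A.transpose 1)
    rw [hc] at e0 e1
    rw [hb₀, hb₀, eb0, eb1] at hf
    rw [← hlu.dvd_mul_left]
    simp only [bracket, Matrix.transpose_apply] at hf hd e0 e1 ⊢
    refine ⟨A 0 0 * p * c₁ + A 1 0 * q * c₁ - (p * A 0 1 + q * A 1 1) * d - f
      + S.t * c * (p * b₀ 0 + q * b₀ 1), ?_⟩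
    linear_combination -hf - (p * A 0 1 + q * A 1 1) * hd + S.t * b₀ 0 * e1 - S.t * b₀ 1 * e0
  refine ⟨w, hwu, le_antisymm (fun A hA j ↦ ?_) fun A hA ↦ ?_⟩
  · fin_cases j
    exacts [hcol0 A hA, hcol1 A hA]
  have hmod : ∀ A B : Matrix (Fin 2) (Fin 2) R, B ∈ P → (∀ i j, S.t ^ 2 ∣ A i j - B i j) →
      A ∈ P := by
    intro A B hB h
    choose C hC using h
    have : A = B + S.t ^ 2 • Matrix.of C := by
      ext i j
      rw [Matrix.add_apply, Matrix.smul_apply, Matrix.of_apply, smul_eq_mul, ← hC]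
      ring
    rw [this]
    exact P.add_mem hB (hP _)
  have hdvd : ∀ v : Fin 2 → R, ∀ c : R, S.t ^ 2 ∣ c * bracket w v →
      ∀ i, S.t ^ 2 ∣ c * (v i - (p * v 0 + q * v 1) * w i) := by
    intro v c hc i
    obtain ⟨d, hd⟩ := hc
    obtain ⟨e0, e1⟩ := hdec v
    fin_cases i
    · exact ⟨-q * d, by simp only [Fin.zero_eta]; linear_combination c * e0 - q * hd⟩
    · exact ⟨p * d, by simp only [Fin.mk_one]; linear_combination c * e1 + p * hd⟩
  -- Its reduction before multiplication by `t` lies in the coimage, so `smul_mem_of_red` applies.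
  have ht0 : S.t • !![w 0, 0; w 1, 0] ∈ P := by
    refine S.smul_mem_of_red hP ?_
    rw [hW, ← hwu]
    intro j
    fin_cases j <;> simp [bracket, red_apply, mul_comm]
  have ht1 : S.t • !![0, w 0; 0, w 1] ∈ P := by
    refine S.smul_mem_of_red hP ?_
    rw [hW, ← hwu]
    intro j
    fin_cases j <;> simp [bracket, red_apply, mul_comm]
  have hE0 : !![w 0, 0; w 1, 0] ∈ P := by
    -- Modulo `t²` the second column `t a₁` of `a` is a multiple of `t w`, which the subtraction
    -- removes.
    refine hmod _ _ (P.sub_mem ha (P.smul_mem (p * a₁ 0 + q * a₁ 1) ht1)) fun i j ↦ ?_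
    fin_cases j
    · fin_cases i <;> simp [hwa]
    · have h := (dvd_neg (a := S.t ^ 2)).2 (hdvd a₁ S.t hwa₁ i)
      convert h using 1
      fin_cases i <;> simp [ha₁] <;> ring
  have hE1 : !![0, w 0; 0, w 1] ∈ P := by
    obtain ⟨v, hv⟩ := hlu.exists_left_inv
    refine hmod _ _ (P.smul_mem v (P.sub_mem hb (P.smul_mem (p * b₀ 0 + q * b₀ 1) ht0)))
      fun i j ↦ ?_
    fin_cases j
    · have h := (hdvd b₀ S.t hwb₀ i).mul_left (-v)
      convert h using 1
      fin_cases i <;> simp [hb₀] <;> exact Or.inl (by ring)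
    · refine (?_ : S.t ^ 2 ∣ ![w 0, w 1] i - v * b i 1).trans (dvd_of_eq ?_)
      · have h1 := hdvd (b.transpose 1) 1 ⟨c₁, by rw [one_mul, hc₁]⟩ i
        have h2 := h1.mul_left (-v)
        convert h2 using 1
        simp only [Matrix.transpose_apply, ← hl]
        have : ![w 0, w 1] i = w i := by fin_cases i <;> rfl
        rw [this]
        linear_combination -w i * hv
      · fin_cases i <;> simp
  refine hmod A ((p * A 0 0 + q * A 1 0) • !![w 0, 0; w 1, 0] +
    (p * A 0 1 + q * A 1 1) • !![0, w 0; 0, w 1])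
    (P.add_mem (P.smul_mem _ hE0) (P.smul_mem _ hE1)) fun i j ↦ ?_
  have h := hdvd (A.transpose j) 1 (by rw [one_mul]; exact hA j) i
  convert h using 1
  fin_cases j <;> fin_cases i <;> simp

theorem image_comap_transpose : S.image (P.comap
    (Matrix.transposeLinearEquiv (Fin 2) (Fin 2) R R).toLinearMap) = (S.image P).comap
      (Matrix.transposeLinearEquiv (Fin 2) (Fin 2) K K).toLinearMap := by
  ext a
  constructor
  · rintro ⟨A, hA, rfl⟩
    exact ⟨A.transpose, hA, rfl⟩
  · rintro ⟨A, hA, h⟩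
    refine ⟨A.transpose, hA, Matrix.transpose_injective ?_⟩
    exact h

theorem coimage_comap_transpose : S.coimage (P.comap
    (Matrix.transposeLinearEquiv (Fin 2) (Fin 2) R R).toLinearMap) = (S.coimage P).comap
      (Matrix.transposeLinearEquiv (Fin 2) (Fin 2) K K).toLinearMap :=
  S.image_comap_transpose (P := P.comap (LinearMap.lsmul R (Matrix (Fin 2) (Fin 2) R) S.t))

/-- A Lagrangian lattice with two-dimensional reduction is a lattice of matrices with proportional
columns or with proportional rows. -/
theorem eq_columnLattice_or_rowLattice [IsDomain R] (hP : ∀ B, S.t ^ 2 • B ∈ P)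
    (hdet : ∀ A ∈ P, S.t ^ 2 ∣ A.det) (hV : Module.finrank K (S.image P) = 2)
    (hW : Module.finrank K (S.coimage P) = 2) :
    (∃ w : Fin 2 → R, (fun i ↦ S.ρ (w i)) ≠ 0 ∧ P = S.columnLattice w) ∨
      ∃ w : Fin 2 → R, (fun i ↦ S.ρ (w i)) ≠ 0 ∧ P = S.rowLattice w := by
  -- The image is contained in the coimage, and both have dimension two.
  have hVW := Submodule.eq_of_le_of_finrank_eq S.image_le_coimage (hV.trans hW.symm)
  obtain ⟨u, hu, h⟩ | ⟨u, hu, h⟩ := eq_columnSpace_or_rowSpace hV (S.det_image hdet)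
  · obtain ⟨w, hw, h'⟩ := S.eq_columnLattice hP hdet hu h (hVW ▸ h)
    exact Or.inl ⟨w, by rwa [hw], h'⟩
  -- The row case is the column case for the transposed lattice.
  · obtain ⟨w, hw, h'⟩ := S.eq_columnLattice
      (P := P.comap (Matrix.transposeLinearEquiv (Fin 2) (Fin 2) R R).toLinearMap)
      (fun B ↦ hP B.transpose) (fun A hA ↦ by rw [← Matrix.det_transpose]; exact hdet _ hA) hu
      (by rw [image_comap_transpose, h]; rfl) (by rw [coimage_comap_transpose, ← hVW, h]; rfl)
    refine Or.inr ⟨w, by rwa [hw], ?_⟩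
    rw [rowLattice, ← h']
    rfl

theorem image_columnLattice {w : Fin 2 → R} (hw : (fun i ↦ S.ρ (w i)) ≠ 0) :
    S.image (S.columnLattice w) = columnSpace K fun i ↦ S.ρ (w i) := by
  obtain ⟨p, q, hpq⟩ := S.exists_coprime hw
  ext a
  constructor
  · rintro ⟨A, hA, rfl⟩ j
    have := S.ρ_eq_zero_of_dvd (hA j)
    simpa [bracket, red_apply] using this
  · intro ha
    obtain ⟨A, rfl⟩ := S.red_surjective a
    -- Projecting the columns of an arbitrary lift to the line of `w` makes the brackets zero
    -- without changing the reduction.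
    refine ⟨Matrix.of fun i j ↦ (p * A 0 j + q * A 1 j) * w i, fun j ↦ ?_, ?_⟩
    · exact ⟨0, by simp only [bracket, Matrix.transpose_apply, Matrix.of_apply]; ring⟩
    · ext i j
      obtain ⟨e0, e1⟩ := bracket_decomposition hpq (A.transpose j)
      have h := ha j
      simp only [bracket, Matrix.transpose_apply, red_apply] at h e0 e1
      have e0 := congrArg S.ρ e0
      have e1 := congrArg S.ρ e1
      simp only [red_apply, Matrix.of_apply, map_add, map_sub, map_mul] at h e0 e1 ⊢
      rw [h] at e0 e1
      fin_cases i
      · simpa using e0.symm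
      · simpa using e1.symm

theorem coimage_columnLattice [IsDomain R] {w : Fin 2 → R} (hw : (fun i ↦ S.ρ (w i)) ≠ 0) :
    S.coimage (S.columnLattice w) = columnSpace K fun i ↦ S.ρ (w i) := by
  refine le_antisymm ?_ ?_
  · rintro _ ⟨A, hA, rfl⟩ j
    obtain ⟨c, hc⟩ := hA j
    have h1 : bracket w (A.transpose j) = S.t * c := by
      refine mul_left_cancel₀ S.t_ne_zero ?_
      rw [← mul_assoc, ← sq, ← hc]
      simp only [bracket, Matrix.transpose_apply, LinearMap.lsmul_apply, Matrix.smul_apply,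
        smul_eq_mul]
      ring
    have h2 := congrArg S.ρ h1
    rw [map_mul, S.ρ_t, zero_mul] at h2
    simpa [bracket, red_apply] using h2
  · rw [← S.image_columnLattice hw]
    exact S.image_le_coimage

/-- Modulo `t²` both columns are multiples of the same vector `w`. -/
theorem dvd_det_of_mem_columnLattice {w : Fin 2 → R} (hw : (fun i ↦ S.ρ (w i)) ≠ 0)
    {A : Matrix (Fin 2) (Fin 2) R} (hA : A ∈ S.columnLattice w) : S.t ^ 2 ∣ A.det := by
  obtain ⟨p, q, hpq⟩ := S.exists_coprime hw
  obtain ⟨c, hc⟩ := hA 0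
  obtain ⟨d, hd⟩ := hA 1
  obtain ⟨e0, e1⟩ := bracket_decomposition hpq (A.transpose 0)
  refine ⟨(p * A 0 0 + q * A 1 0) * d - c * (p * A 0 1 + q * A 1 1), ?_⟩
  simp only [bracket, Matrix.transpose_apply] at hc hd e0 e1
  rw [Matrix.det_fin_two]
  linear_combination A 1 1 * e0 - A 0 1 * e1 + (p * A 0 0 + q * A 1 0) * hd
    - (p * A 0 1 + q * A 1 1) * hc

/-- A Lagrangian lattice with one-dimensional reduction, in adapted coordinates. -/
theorem exists_normalForm_of_finrank_one [IsDomain R] (hP : ∀ B, S.t ^ 2 • B ∈ P)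
    (hdet : ∀ A ∈ P, S.t ^ 2 ∣ A.det) (hV : Module.finrank K (S.image P) = 1)
    (hW : Module.finrank K (S.coimage P) = 3) :
    ∃ g h : Matrix (Fin 2) (Fin 2) R, IsUnit g.det ∧ IsUnit h.det ∧ ∀ A, A ∈ P ↔
      S.t ∣ (g * A * h) 0 1 ∧ S.t ∣ (g * A * h) 1 0 ∧ S.t ^ 2 ∣ (g * A * h) 1 1 := by
  obtain ⟨⟨_, A, hA, rfl⟩, hA0, hAV⟩ := finrank_eq_one_iff'.1 hV
  have hA0' : S.red A ≠ 0 := fun h ↦ hA0 (Subtype.ext h)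
  have hAV' : ∀ B ∈ P, ∃ c : K, c • S.red A = S.red B := fun B hB ↦ by
    obtain ⟨c, hc⟩ := hAV ⟨S.red B, B, hB, rfl⟩
    exact ⟨c, congrArg Subtype.val hc⟩
  have hpol : ∀ B C : Matrix (Fin 2) (Fin 2) R, QuadraticMap.polar Matrix.det B C =
      B 0 0 * C 1 1 + C 0 0 * B 1 1 - B 0 1 * C 1 0 - C 0 1 * B 1 0 := fun B C ↦ by
    simp only [QuadraticMap.polar, Matrix.det_fin_two, Matrix.add_apply]
    ring
  have hPA : ∀ B ∈ P, S.t ^ 2 ∣ QuadraticMap.polar Matrix.det A B := fun B hB ↦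
    dvd_sub (dvd_sub (hdet _ (P.add_mem hA hB)) (hdet A hA)) (hdet B hB)
  -- The coimage lies in the hyperplane polar to the reduction of `A`. Both have dimension three, so
  -- every `B` that is polar to `A` modulo `t` is allowed.
  have htA : ∀ B, S.t ∣ QuadraticMap.polar Matrix.det A B → S.t • B ∈ P := by
    let a := S.red A
    let f : Matrix (Fin 2) (Fin 2) K →ₗ[K] K :=
      { toFun := fun c ↦ a 0 0 * c 1 1 + c 0 0 * a 1 1 - a 0 1 * c 1 0 - c 0 1 * a 1 0
        map_add' := fun c d ↦ by simp only [Matrix.add_apply]; ring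
        map_smul' := fun r c ↦ by
          simp only [Matrix.smul_apply, smul_eq_mul, RingHom.id_apply]; ring }
    have hf0 : f ≠ 0 := fun h ↦ hA0' (by
      have h00 := LinearMap.congr_fun h !![0, 0; 0, 1]
      have h01 := LinearMap.congr_fun h !![0, 0; 1, 0]
      have h10 := LinearMap.congr_fun h !![0, 1; 0, 0]
      have h11 := LinearMap.congr_fun h !![1, 0; 0, 0]
      simp [f, a] at h00 h01 h10 h11
      ext i j
      fin_cases i <;> fin_cases j <;> assumption)
    have hle : S.coimage P ≤ LinearMap.ker f := by
      rintro _ ⟨B, hB, rfl⟩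
      obtain ⟨c, hc⟩ := hPA _ hB
      rw [hpol] at hc
      have h1 : A 0 0 * B 1 1 + B 0 0 * A 1 1 - A 0 1 * B 1 0 - B 0 1 * A 1 0 = S.t * c := by
        refine mul_left_cancel₀ S.t_ne_zero ?_
        rw [← mul_assoc, ← sq, ← hc]
        simp only [LinearMap.lsmul_apply, Matrix.smul_apply, smul_eq_mul]
        ring
      have h2 := congrArg S.ρ h1
      rw [map_mul, S.ρ_t, zero_mul] at h2
      simp only [map_add, map_sub, map_mul] at h2
      exact h2
    have hker : Module.finrank K (LinearMap.ker f) = 3 := by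
      have h1 := LinearMap.finrank_range_add_finrank_ker f
      rw [LinearMap.range_eq_top.2 (LinearMap.surjective hf0), finrank_top,
        Module.finrank_matrix] at h1
      simp at h1
      omega
    have heq := Submodule.eq_of_le_of_finrank_eq hle (hW.trans hker.symm)
    intro B hB
    refine S.smul_mem_of_red hP ?_
    rw [heq]
    have h2 := (S.eq_zero_iff _).2 hB
    rw [hpol] at h2
    simp only [map_add, map_sub, map_mul] at h2
    exact h2
  -- Since `A` does not reduce to zero, some entry is a unit. It is moved to the corner by swaps and
  -- used to clear its row and column.
  obtain ⟨g, h, hg, hh, hgh⟩ : ∃ g h : Matrix (Fin 2) (Fin 2) R, IsUnit g.det ∧ IsUnit h.det ∧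
      (g * A * h) 0 0 = 1 ∧ (g * A * h) 0 1 = 0 ∧ (g * A * h) 1 0 = 0 := by
    have key : ∀ B : Matrix (Fin 2) (Fin 2) R, IsUnit (B 0 0) →
        ∃ g h : Matrix (Fin 2) (Fin 2) R, IsUnit g.det ∧ IsUnit h.det ∧
          (g * B * h) 0 0 = 1 ∧ (g * B * h) 0 1 = 0 ∧ (g * B * h) 1 0 = 0 := fun B hB ↦ by
      obtain ⟨v, hv⟩ := hB.exists_left_inv
      have hvu : IsUnit v := IsUnit.of_mul_eq_one _ hv
      refine ⟨!![v, 0; -B 1 0 * v, 1], !![1, -B 0 1 * v; 0, 1], by simpa [Matrix.det_fin_two],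
        by simp [Matrix.det_fin_two], ?_, ?_, ?_⟩ <;>
        simp [Matrix.mul_apply, Fin.sum_univ_two, Matrix.vecMul, dotProduct]
      · exact hv
      · linear_combination (-v * B 0 1) * hv
      · linear_combination (-B 1 0) * hv
    obtain ⟨i, j, hij⟩ : ∃ i j, IsUnit (A i j) := by
      by_contra! h
      refine hA0' ?_
      ext i j
      by_contra h'
      exact h i j (S.isUnit _ h')
    let s : Fin 2 → Matrix (Fin 2) (Fin 2) R := ![1, !![0, 1; 1, 0]]
    have hs : ∀ i, IsUnit (s i).det := by
      intro i
      fin_cases i <;> simp [s, Matrix.det_fin_two]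
    obtain ⟨g, h, hg, hh, e⟩ := key (s i * A * s j) (by
      fin_cases i <;> fin_cases j <;>
        simpa [s, Matrix.mul_apply, Fin.sum_univ_two, Matrix.vecMul, dotProduct] using hij)
    refine ⟨g * s i, s j * h, by rw [Matrix.det_mul]; exact hg.mul (hs i),
      by rw [Matrix.det_mul]; exact (hs j).mul hh, ?_⟩
    simpa only [Matrix.mul_assoc] using e
  obtain ⟨h00, h01, h10⟩ := hgh
  have hpgh : ∀ B, QuadraticMap.polar Matrix.det (g * A * h) (g * B * h) =
      g.det * h.det * QuadraticMap.polar Matrix.det A B := fun B ↦ by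
    rw [QuadraticMap.polar, ← Matrix.add_mul, ← Matrix.mul_add]
    simp only [QuadraticMap.polar, Matrix.det_mul]
    ring
  have hgu := hg.mul hh
  -- After elimination this entry is the determinant.
  have h11 : S.t ^ 2 ∣ (g * A * h) 1 1 := by
    have h2 : S.t ^ 2 ∣ (g * A * h).det := by
      rw [Matrix.det_mul, Matrix.det_mul]
      exact ((hdet A hA).mul_left _).mul_right _
    rwa [Matrix.det_fin_two, h00, h01, one_mul, zero_mul, sub_zero] at h2
  obtain ⟨d, hd⟩ := h11
  have hpolB : ∀ B, QuadraticMap.polar Matrix.det (g * A * h) (g * B * h) =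
      (g * B * h) 1 1 + (g * B * h) 0 0 * (S.t ^ 2 * d) := fun B ↦ by
    rw [hpol, h00, h01, h10, hd]
    ring
  refine ⟨g, h, hg, hh, fun B ↦ ⟨fun hB ↦ ?_, ?_⟩⟩
  · obtain ⟨c, hc⟩ := hAV' B hB
    obtain ⟨c, rfl⟩ := S.ρ_surjective c
    -- Modulo `t` every element of `P` is a multiple of `A`, which controls the off-diagonal
    -- entries. The last entry is controlled modulo `t²` by the polar form with `A`.
    obtain ⟨C, hC⟩ := S.exists_red_eq (A := B) (B := c • A) (by
      rw [← hc]; ext i j; simp [red_apply])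
    have e : g * B * h = c • (g * A * h) + S.t • (g * C * h) := by
      rw [hC, Matrix.mul_add, Matrix.add_mul]
      simp only [Matrix.mul_smul, Matrix.smul_mul]
    refine ⟨?_, ?_, ?_⟩
    · rw [e, Matrix.add_apply, Matrix.smul_apply, h01, smul_zero, zero_add]
      exact ⟨_, rfl⟩
    · rw [e, Matrix.add_apply, Matrix.smul_apply, h10, smul_zero, zero_add]
      exact ⟨_, rfl⟩
    · have h1 := (hPA B hB).mul_left (g.det * h.det)
      rw [← hpgh, hpolB] at h1
      exact (dvd_add_left ⟨(g * B * h) 0 0 * d, by ring⟩).1 h1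
  · rintro ⟨⟨y, hy⟩, ⟨z, hz⟩, ⟨c, hc⟩⟩
    have hgi : g⁻¹ * g = 1 := Matrix.nonsing_inv_mul g hg
    have hgi' : g * g⁻¹ = 1 := Matrix.mul_nonsing_inv g hg
    have hhi : h * h⁻¹ = 1 := Matrix.mul_nonsing_inv h hh
    have hhi' : h⁻¹ * h = 1 := Matrix.nonsing_inv_mul h hh
    -- `C` is what remains of `g B h` after subtracting a multiple of `g A h` and dividing by `t`.
    -- It is polar to `g A h` modulo `t`, so `t C`, transported back, lies in `P`.
    obtain ⟨C, hC⟩ : ∃ C : Matrix (Fin 2) (Fin 2) R,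
      C = !![0, y; z, S.t * (c - (g * B * h) 0 0 * d)] := ⟨_, rfl⟩
    have e : g * (g⁻¹ * C * h⁻¹) * h = C := by
      rw [← Matrix.mul_assoc, ← Matrix.mul_assoc, hgi', Matrix.one_mul, Matrix.mul_assoc, hhi',
        Matrix.mul_one]
    have h1 : S.t • (g⁻¹ * C * h⁻¹) ∈ P := by
      refine htA _ ?_
      rw [← hgu.dvd_mul_left, ← hpgh, hpolB, e, hC]
      exact ⟨c - (g * B * h) 0 0 * d, by simp⟩
    have h2 : g * B * h = (g * B * h) 0 0 • (g * A * h) + S.t • C := by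
      ext i j
      rw [Matrix.add_apply, Matrix.smul_apply, Matrix.smul_apply, hC]
      fin_cases i <;> fin_cases j <;> simp [h00, h01, h10, hd, hy, hz, hc]
      ring
    have h3 : ∀ M : Matrix (Fin 2) (Fin 2) R, g⁻¹ * (g * M * h) * h⁻¹ = M := fun M ↦ by
      rw [← Matrix.mul_assoc, ← Matrix.mul_assoc, hgi, Matrix.one_mul, Matrix.mul_assoc, hhi,
        Matrix.mul_one]
    have h4 : B = (g * B * h) 0 0 • A + S.t • (g⁻¹ * C * h⁻¹) := by
      conv_lhs => rw [← h3 B, h2, Matrix.mul_add, Matrix.add_mul, Matrix.mul_smul,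
        Matrix.smul_mul, h3, Matrix.mul_smul, Matrix.smul_mul]
    rw [h4]
    exact P.add_mem (P.smul_mem _ hA) h1

end Residue

end ResidueAlgebra

/-! ### Matrix coordinates on stalks and dimension counts -/

section StalkCoordinates
variable {X : Scheme.{u}} {x : X} (K : Type u) [Field K] [X.Over (Spec (.of K))]

theorem exists_residue [IsAlgClosed K] [IsIntegral X] [IsProper (X ↘ Spec (.of K))]
    (hx : IsClosed {x}) (P : LocalParameter x) :
    ∃ S : Residue K (X.presheaf.stalk x), S.t = P.stalk := by
  let e : K ≃ₐ[K] IsLocalRing.ResidueField (X.presheaf.stalk x) :=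
    AlgEquiv.ofBijective (Algebra.ofId K _) (bijective_algebraMap_residueField x hx)
  refine ⟨⟨e.symm.toAlgHom.comp (IsScalarTower.toAlgHom K (X.presheaf.stalk x) _), P.stalk,
    fun h ↦ P.τ_ne_zero (by rw [← P.algebraMap_stalk, h, map_zero]), fun a ↦ ?_, fun a ha ↦ ?_⟩, rfl⟩
  · refine (map_eq_zero_iff e.symm e.symm.injective).trans ?_
    refine (IsLocalRing.residue_eq_zero_iff a).trans ?_
    rw [P.maximalIdeal_eq]
    exact Ideal.mem_span_singleton
  · by_contra h
    refine ha ((map_eq_zero_iff e.symm e.symm.injective).2 ?_)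
    exact (IsLocalRing.residue_eq_zero_iff a).2 h

variable {K} (S : Residue K (X.presheaf.stalk x))

namespace Residue

theorem maximalIdeal_eq : IsLocalRing.maximalIdeal (X.presheaf.stalk x) = Ideal.span {S.t} := by
  ext a
  rw [Ideal.mem_span_singleton, ← S.eq_zero_iff, IsLocalRing.mem_maximalIdeal, mem_nonunits_iff]
  constructor
  · intro h
    by_contra h'
    exact h (S.isUnit a h')
  · intro h h'
    exact (h'.map S.ρ).ne_zero h

theorem mem_mPow {n : ℕ} {a : X.presheaf.stalk x} : a ∈ mPow x n ↔ S.t ^ n ∣ a := by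
  rw [mPow, S.maximalIdeal_eq, Ideal.span_singleton_pow, Ideal.mem_span_singleton]

variable {M : X.Modules} {ι : Type*} [Fintype ι]
  (b : Module.Basis ι (X.presheaf.stalk x) (Stalk M x))

theorem mk_eq_zero_iff {n : ℕ} {m : Stalk M x} :
    Thick.mk M x n m = 0 ↔ ∀ i, S.t ^ n ∣ b.repr m i := by
  refine (Submodule.Quotient.mk_eq_zero _).trans ⟨fun h i ↦ ?_, fun h ↦ ?_⟩
  · refine Submodule.smul_induction_on h (fun c hc m _ ↦ ?_) fun m m' h h' ↦ ?_
    · rw [map_smul, Finsupp.smul_apply]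
      exact (S.mem_mPow.1 hc).mul_right _
    · rw [map_add, Finsupp.add_apply]
      exact dvd_add h h'
  · rw [← b.sum_repr m]
    exact Submodule.sum_mem _ fun i _ ↦
      Submodule.smul_mem_smul (S.mem_mPow.2 (h i)) trivial

/-- The class of the other basis vector `b j` is a generator. -/
theorem finrank_eq_one_of_coord {b : Module.Basis (Fin 2) (X.presheaf.stalk x) (Stalk M x)}
    {i j : Fin 2} (hij : i ≠ j) {D : Submodule (X.presheaf.stalk x) (Thick M x 1)}
    (hD : ∀ m, Thick.mk M x 1 m ∈ D ↔ S.t ∣ b.repr m i) : Module.finrank K D = 1 := by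
  have hj : Thick.mk M x 1 (b j) ∈ D := by
    rw [hD, b.repr_self, Finsupp.single_apply, if_neg hij.symm]
    exact dvd_zero _
  refine finrank_eq_one_iff'.2 ⟨⟨_, hj⟩, fun h ↦ ?_, fun ⟨w, hw⟩ ↦ ?_⟩
  · have h1 := (S.mk_eq_zero_iff b).1 (congrArg Subtype.val h) j
    rw [b.repr_self, Finsupp.single_apply, if_pos rfl, pow_one, ← S.eq_zero_iff, map_one] at h1
    exact one_ne_zero h1
  · obtain ⟨m, rfl⟩ := Thick.mk_surjective w
    refine ⟨S.ρ (b.repr m j), Subtype.ext ?_⟩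
    change S.ρ (b.repr m j) • Thick.mk M x 1 (b j) = Thick.mk M x 1 m
    rw [← algebraMap_smul (X.presheaf.stalk x) (S.ρ (b.repr m j)), ← map_smul, ← sub_eq_zero,
      ← map_sub, S.mk_eq_zero_iff b]
    intro k
    rw [pow_one, ← S.eq_zero_iff, map_sub, map_smul, b.repr_self, Finsupp.sub_apply,
      Finsupp.smul_apply, Finsupp.single_apply, map_sub, smul_eq_mul, map_mul,
      AlgHom.commutes, Algebra.algebraMap_self, RingHom.id_apply]
    split_ifs with hk
    · rw [hk]; simp
    · have : k = i := by omega
      rw [map_zero, mul_zero, zero_sub, neg_eq_zero, S.eq_zero_iff, this]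
      exact (hD m).1 hw

end Residue

/-- Both images are the quotient of `P` by the same kernel. This compares reductions of matrices
with images in `ℋom(F, G)_{nx}` without constructing an isomorphism of the targets. -/
theorem finrank_map_eq_of_ker_eq {k N A B : Type*} [Field k] [AddCommGroup N] [Module k N]
    [AddCommGroup A] [Module k A] [AddCommGroup B] [Module k B] (P : Submodule k N)
    (f : N →ₗ[k] A) (g : N →ₗ[k] B) (h : LinearMap.ker f = LinearMap.ker g) :
    Module.finrank k (P.map f) = Module.finrank k (P.map g) := by
  rw [← LinearMap.range_domRestrict, ← LinearMap.range_domRestrict]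
  have hk : LinearMap.ker (f.domRestrict P) = LinearMap.ker (g.domRestrict P) := by
    rw [LinearMap.ker_domRestrict, LinearMap.ker_domRestrict, h]
  exact ((f.domRestrict P).quotKerEquivRange.symm.trans
    ((Submodule.quotEquivOfEq _ _ hk).trans (g.domRestrict P).quotKerEquivRange)).finrank_eq

section Hom
variable [IsIntegral X] {F G : X.Modules}

/-- Germs of homomorphisms of bundles are homomorphisms of stalks. -/
theorem bijective_stalkEv {r : ℕ} [NeZero r] (hF : IsVectorBundle F r) (hG : IsVectorBundle G r) :
    Function.Bijective (stalkEv F G x) := by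
  obtain ⟨U, hU, e, he⟩ := hF x
  obtain ⟨b, -⟩ := IsFrame.exists_basis_stalk he hU
  obtain ⟨c, hc, hcr, hlat⟩ := hF.emb.exists_basis_of_stalk hF.finrank_stalk b
  set H := hF.emb.hom hG.emb hF hF.finrank_stalk
  constructor
  · rw [injective_iff_map_eq_zero]
    intro φ hφ
    refine (injective_iff_map_eq_zero _).1 (H.stalkMap_injective x) _ (c.ext fun i ↦ ?_)
    rw [hc, Emb.hom_stalkMap_apply, hφ]
    exact map_zero _
  · intro T
    -- The extension of `T` to the generic fibres. It preserves the lattices at `x`, hence is the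
    -- germ of a homomorphism.
    let T' := c.constr ℤ fun i ↦ hG.emb.stalkMap x (T (b i))
    have hT' : ∀ m, T' (hF.emb.stalkMap x m) = hG.emb.stalkMap x (T m) := fun m ↦ by
      rw [← b.sum_repr m, map_sum, map_sum, map_sum, map_sum]
      refine Finset.sum_congr rfl fun i _ ↦ ?_
      rw [Emb.stalkMap_smul, map_smul, ← hc, c.constr_basis, map_smul, Emb.stalkMap_smul]
    have hmem : T' ∈ H.lat x := by
      rw [Emb.mem_lat_hom]
      intro v hv
      obtain ⟨m, rfl⟩ := hF.emb.mem_lat_iff_stalkMap.1 hv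
      rw [hT', hG.emb.mem_lat_iff_stalkMap]
      exact ⟨_, rfl⟩
    obtain ⟨φ, hφ⟩ := H.mem_lat_iff_stalkMap.1 hmem
    refine ⟨φ, LinearMap.ext fun m ↦ hG.emb.stalkMap_injective x ?_⟩
    rw [← Emb.hom_stalkMap_apply hF.emb hG.emb hF hF.finrank_stalk, hφ, hT']

variable (hF : IsVectorBundle F 2) (hG : IsVectorBundle G 2)
  (e : Module.Basis (Fin 2) (X.presheaf.stalk x) (Stalk F x))
  (f : Module.Basis (Fin 2) (X.presheaf.stalk x) (Stalk G x))

/-- The matrix of a germ of homomorphisms. -/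
def stalkMatrix : Stalk (homSheaf F G) x ≃ₗ[X.presheaf.stalk x]
    Matrix (Fin 2) (Fin 2) (X.presheaf.stalk x) :=
  (LinearEquiv.ofBijective _ (bijective_stalkEv hF hG)).trans (LinearMap.toMatrix e f)

theorem stalkMatrix_apply (φ : Stalk (homSheaf F G) x) (i j : Fin 2) :
    stalkMatrix hF hG e f φ i j = f.repr (stalkEv F G x φ (e j)) i :=
  LinearMap.toMatrix_apply e f _ i j

theorem repr_stalkEv (φ : Stalk (homSheaf F G) x) (m : Stalk F x) (i : Fin 2) :
    f.repr (stalkEv F G x φ m) i = ∑ j, stalkMatrix hF hG e f φ i j * e.repr m j := by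
  conv_lhs => rw [← e.sum_repr m, map_sum, map_sum, Finsupp.finsetSum_apply]
  refine Finset.sum_congr rfl fun j _ ↦ ?_
  rw [map_smul, map_smul, Finsupp.smul_apply, stalkMatrix_apply, smul_eq_mul, mul_comm]

variable {n : ℕ}

theorem mk_eq_zero_iff_stalkMatrix {φ : Stalk (homSheaf F G) x} :
    Thick.mk _ x n φ = 0 ↔ ∀ i j, S.t ^ n ∣ stalkMatrix hF hG e f φ i j := by
  rw [S.mk_eq_zero_iff ((Matrix.stdBasis (X.presheaf.stalk x) (Fin 2) (Fin 2)).map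
    (stalkMatrix hF hG e f).symm), Prod.forall]
  refine forall_congr' fun i ↦ forall_congr' fun j ↦ ?_
  rw [Module.Basis.map_repr, LinearEquiv.trans_apply, LinearEquiv.symm_symm]
  rfl

/-- The matrices of the germs with class in `L`. -/
def coordLattice (L : Submodule (X.presheaf.stalk x) (Thick (homSheaf F G) x n)) :
    Submodule (X.presheaf.stalk x) (Matrix (Fin 2) (Fin 2) (X.presheaf.stalk x)) :=
  L.comap ((Thick.mk _ x n).comp (stalkMatrix hF hG e f).symm.toLinearMap)

variable {L : Submodule (X.presheaf.stalk x) (Thick (homSheaf F G) x n)}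

theorem stalkMatrix_mem_coordLattice {φ : Stalk (homSheaf F G) x} :
    stalkMatrix hF hG e f φ ∈ coordLattice hF hG e f L ↔ Thick.mk _ x n φ ∈ L := by
  change Thick.mk _ x n ((stalkMatrix hF hG e f).symm _) ∈ L ↔ _
  rw [LinearEquiv.symm_apply_apply]

theorem mem_coordLattice {A : Matrix (Fin 2) (Fin 2) (X.presheaf.stalk x)} :
    A ∈ coordLattice hF hG e f L ↔ Thick.mk _ x n ((stalkMatrix hF hG e f).symm A) ∈ L := Iff.rfl

theorem smul_mem_coordLattice (A : Matrix (Fin 2) (Fin 2) (X.presheaf.stalk x)) :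
    S.t ^ n • A ∈ coordLattice hF hG e f L := by
  rw [mem_coordLattice, map_smul, Thick.mk_smul_eq_zero _ (S.mem_mPow.2 dvd_rfl)]
  exact L.zero_mem

/-- The class in `ℋom(F, G)_{nx}` of a matrix. -/
def ofMatrix (n : ℕ) : Matrix (Fin 2) (Fin 2) (X.presheaf.stalk x) →ₗ[X.presheaf.stalk x]
    Thick (homSheaf F G) x n :=
  (Thick.mk _ x n).comp (stalkMatrix hF hG e f).symm.toLinearMap

theorem ofMatrix_surjective (n : ℕ) : Function.Surjective (ofMatrix hF hG e f n) :=
  Thick.mk_surjective.comp (stalkMatrix hF hG e f).symm.surjective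

theorem ofMatrix_eq_zero_iff {A : Matrix (Fin 2) (Fin 2) (X.presheaf.stalk x)} :
    ofMatrix hF hG e f n A = 0 ↔ ∀ i j, S.t ^ n ∣ A i j := by
  have h := mk_eq_zero_iff_stalkMatrix S hF hG e f (n := n) (φ := (stalkMatrix hF hG e f).symm A)
  rwa [LinearEquiv.apply_symm_apply] at h

theorem map_coordLattice : (coordLattice hF hG e f L).map (ofMatrix hF hG e f n) = L :=
  Submodule.map_comap_eq_of_surjective (ofMatrix_surjective hF hG e f n) L

theorem Residue.ker_red : LinearMap.ker S.red =
    LinearMap.ker ((ofMatrix hF hG e f 1).restrictScalars K) := by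
  ext A
  rw [LinearMap.mem_ker, LinearMap.mem_ker]
  refine Iff.trans ?_ (ofMatrix_eq_zero_iff S hF hG e f).symm
  rw [pow_one]
  simp only [← S.eq_zero_iff]
  exact ⟨fun h i j ↦ congrFun (congrFun h i) j, fun h ↦ by ext i j; exact h i j⟩

/-- The matrices with entries in `K ⊕ K t`. -/
def Residue.dual : (Matrix (Fin 2) (Fin 2) K × Matrix (Fin 2) (Fin 2) K) →ₗ[K]
    Matrix (Fin 2) (Fin 2) (X.presheaf.stalk x) :=
  LinearMap.coprod (Algebra.linearMap K (X.presheaf.stalk x)).mapMatrix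
    (((LinearMap.lsmul (X.presheaf.stalk x) _ S.t).restrictScalars K).comp
      (Algebra.linearMap K (X.presheaf.stalk x)).mapMatrix)

omit [IsIntegral X] in
theorem Residue.dual_apply (a b : Matrix (Fin 2) (Fin 2) K) (i j : Fin 2) :
    S.dual (a, b) i j = algebraMap K _ (a i j) + S.t * algebraMap K _ (b i j) := rfl

theorem ofMatrix_dual_surjective :
    Function.Surjective (((ofMatrix hF hG e f 2).restrictScalars K).comp S.dual) := by
  intro a
  obtain ⟨A, rfl⟩ := ofMatrix_surjective hF hG e f 2 a
  -- The expansion of each entry in powers of `t`, with coefficients in `K` up to first order.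
  have h : ∀ i j, ∃ a b : K, ∃ c, A i j = algebraMap K _ a + S.t * algebraMap K _ b + S.t ^ 2 * c :=
    fun i j ↦ by
      obtain ⟨d, hd⟩ := (S.eq_zero_iff (A i j - algebraMap K _ (S.ρ (A i j)))).1 (by simp)
      obtain ⟨c, hc⟩ := (S.eq_zero_iff (d - algebraMap K _ (S.ρ d))).1 (by simp)
      exact ⟨S.ρ (A i j), S.ρ d, c, by linear_combination hd + S.t * hc⟩
  choose a b c h using h
  refine ⟨(Matrix.of a, Matrix.of b), ?_⟩
  change ofMatrix hF hG e f 2 (S.dual _) = _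
  rw [← sub_eq_zero, ← map_sub, ofMatrix_eq_zero_iff S]
  intro i j
  rw [Matrix.sub_apply, S.dual_apply, h i j]
  exact ⟨-c i j, by simp only [Matrix.of_apply]; ring⟩

include S hF hG in
theorem finite_thick : Module.Finite K (Thick (homSheaf F G) x 2) := by
  obtain ⟨U, hU, e, he⟩ := hF x
  obtain ⟨e, -⟩ := IsFrame.exists_basis_stalk he hU
  obtain ⟨U', hU', f, hf⟩ := hG x
  obtain ⟨f, -⟩ := IsFrame.exists_basis_stalk hf hU'
  exact Module.Finite.of_surjective _ (ofMatrix_dual_surjective S hF hG e f)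

theorem finrank_map_π {L : Submodule (X.presheaf.stalk x) (Thick (homSheaf F G) x 2)} :
    Module.finrank K (L.map (Thick.π _ x)) =
      Module.finrank K (S.image (coordLattice hF hG e f L)) := by
  have h := finrank_map_eq_of_ker_eq ((coordLattice hF hG e f L).restrictScalars K) _ _
    (S.ker_red hF hG e f)
  refine Eq.trans ?_ h.symm
  have e : (L.map (Thick.π _ x)).restrictScalars K =
      ((coordLattice hF hG e f L).restrictScalars K).map
        ((ofMatrix hF hG e f 1).restrictScalars K) := by
    conv_lhs => rw [← map_coordLattice hF hG e f (L := L), ← Submodule.map_comp]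
    rfl
  rw [← e]
  rfl

/-- Rank and nullity for the projection of `L` to the fibre. Its kernel consists of the classes in
`L` that are divisible by `t`, and division by `t` identifies it with the coimage. -/
theorem finrank_lagrangian {L : Submodule (X.presheaf.stalk x) (Thick (homSheaf F G) x 2)} :
    Module.finrank K L = Module.finrank K (S.image (coordLattice hF hG e f L)) +
      Module.finrank K (S.coimage (coordLattice hF hG e f L)) := by
  have := finite_thick S hF hG
  have : Module.Finite K L :=
    inferInstanceAs (Module.Finite K (L.restrictScalars K))
  let p := ((Thick.π (homSheaf F G) x).restrictScalars K).domRestrict (L.restrictScalars K)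
  have h1 := LinearMap.finrank_range_add_finrank_ker p
  have hr : Module.finrank K (LinearMap.range p) =
      Module.finrank K (S.image (coordLattice hF hG e f L)) := by
    rw [← finrank_map_π S hF hG e f, LinearMap.range_domRestrict]
    rfl
  -- Multiplication by `t` followed by the class modulo `t²`; its kernel is that of reduction modulo
  -- `t`.
  let g : Matrix (Fin 2) (Fin 2) (X.presheaf.stalk x) →ₗ[K] Thick (homSheaf F G) x 2 :=
    ((ofMatrix hF hG e f 2).comp (LinearMap.lsmul _ _ S.t)).restrictScalars K
  have hg : LinearMap.ker S.red = LinearMap.ker g := by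
    rw [S.ker_red hF hG e f]
    ext A
    refine (ofMatrix_eq_zero_iff S hF hG e f).trans
      (Iff.trans ?_ (ofMatrix_eq_zero_iff S hF hG e f).symm)
    refine forall_congr' fun i ↦ forall_congr' fun j ↦ ?_
    change _ ↔ S.t ^ 2 ∣ S.t * A i j
    rw [pow_one, sq, mul_dvd_mul_iff_left S.t_ne_zero]
  have hk : Module.finrank K (LinearMap.ker p) =
      Module.finrank K (S.coimage (coordLattice hF hG e f L)) := by
    rw [Residue.coimage, finrank_map_eq_of_ker_eq _ _ _ hg,
      ← Submodule.finrank_map_subtype_eq (L.restrictScalars K) (LinearMap.ker p)]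
    suffices h : (LinearMap.ker p).map (L.restrictScalars K).subtype =
        ((((coordLattice hF hG e f L).comap (LinearMap.lsmul (X.presheaf.stalk x)
          (Matrix (Fin 2) (Fin 2) (X.presheaf.stalk x)) S.t)).restrictScalars K).map g) by rw [h]
    ext a
    constructor
    · rintro ⟨⟨a, ha⟩, hap, rfl⟩
      obtain ⟨A, rfl⟩ := ofMatrix_surjective hF hG e f 2 a
      have h2 : ofMatrix hF hG e f 1 A = 0 := hap
      rw [ofMatrix_eq_zero_iff S] at h2
      choose B hB using h2
      have h3 : A = S.t • Matrix.of B := by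
        ext i j
        rw [hB, pow_one]
        rfl
      exact ⟨Matrix.of B, by
        change S.t • Matrix.of B ∈ coordLattice hF hG e f L; rw [← h3]; exact ha, by
        change ofMatrix hF hG e f 2 (S.t • Matrix.of B) = ofMatrix hF hG e f 2 A
        rw [← h3]⟩
    · rintro ⟨A, hA, rfl⟩
      refine ⟨⟨ofMatrix hF hG e f 2 (S.t • A), hA⟩, ?_, rfl⟩
      refine (ofMatrix_eq_zero_iff S hF hG e f).2 fun i j ↦ ?_
      rw [pow_one]
      exact ⟨A i j, rfl⟩
  rw [← hr, ← hk, h1]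
  rfl

end Hom

end StalkCoordinates

/-! ### Hecke transforms and twists as rescalings of a basis -/

section Modifications
variable {X : Scheme.{u}} [IsIntegral X] {x : X} {K : Type u} [Field K] [X.Over (Spec (.of K))]
  (S : Residue K (X.presheaf.stalk x)) (P : LocalParameter x)

theorem Residue.dvd_iff_mem_reg {n : ℕ} {a : X.presheaf.stalk x} :
    S.t ^ n ∣ a ↔ P.τ ^ (-n : ℤ) * algebraMap _ X.functionField a ∈ reg x := by
  rw [← S.mem_mPow, P.mem_mPow_iff]

theorem LocalParameter.mem_reg_of_zpow_mul_mem {n : ℕ} {c : X.functionField}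
    (h : P.τ ^ (-n : ℤ) * c ∈ reg x) : c ∈ reg x := by
  have := mul_mem (pow_mem (P.τ_mem_reg P.mem) n) h
  rwa [← mul_assoc, zpow_neg, zpow_natCast, mul_inv_cancel₀ (pow_ne_zero n P.τ_ne_zero),
    one_mul] at this

variable {M M₁ : X.Modules} {V : Type u} [AddCommGroup V] [Module X.functionField V] {r : ℕ}

/-- The lattices of `M₁` are those of `M`, except that at `x` the `i`-th basis vector is multiplied
by `τ^{α i}`. -/
structure IsModification (E : Emb M V) (E₁ : Emb M₁ V)
    (b : Module.Basis (Fin r) (X.presheaf.stalk x) (Stalk M x)) (α : Fin r → ℤ) : Prop where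
  lat_eq : ∀ p ≠ x, E₁.lat p = E.lat p
  mem_lat : ∀ c : Module.Basis (Fin r) X.functionField V,
    (∀ m i, c.repr (E.stalkMap x m) i = algebraMap _ X.functionField (b.repr m i)) →
    (∀ v, v ∈ E.lat x ↔ ∀ i, c.repr v i ∈ reg x) →
    ∀ v, v ∈ E₁.lat x ↔ ∀ i, P.τ ^ (-α i) * c.repr v i ∈ reg x

variable (E : Emb M V) (b : Module.Basis (Fin r) (X.presheaf.stalk x) (Stalk M x))

theorem isModification_self : IsModification P E E b 0 :=
  ⟨fun _ _ ↦ rfl, fun c _ hc v ↦ by simpa using hc v⟩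

include S

theorem isModification_ofTransform (hx : IsClosed {x}) {n : ℕ}
    {N : Submodule (X.presheaf.stalk x) (Thick M x n)} {k : Fin r → ℕ}
    (hN : ∀ m, Thick.mk M x n m ∈ N ↔ ∀ i, S.t ^ k i ∣ b.repr m i) :
    IsModification P E (Emb.ofTransform N E) b fun i ↦ k i := by
  refine ⟨fun p hp ↦ Emb.lat_ofTransform_of_ne N hx E hp, fun c hcb hc v ↦ ?_⟩
  rw [Emb.mem_lat_ofTransform]
  constructor
  · rintro ⟨m, hm, rfl⟩ i
    rw [hcb, ← S.dvd_iff_mem_reg]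
    exact (hN m).1 hm i
  · intro h
    obtain ⟨m, rfl⟩ := E.mem_lat_iff_stalkMap.1
      ((hc v).2 fun i ↦ P.mem_reg_of_zpow_mul_mem (h i))
    refine ⟨m, (hN m).2 fun i ↦ ?_, rfl⟩
    rw [S.dvd_iff_mem_reg P, ← hcb]
    exact h i

/-- Twisting by the point allows one more power of `τ` in the denominator, which lowers each
exponent by one. -/
theorem isModification_ofTwist (hx : IsClosed {x}) {n : ℕ}
    {N : Submodule (X.presheaf.stalk x) (Thick M x n)} {k : Fin r → ℕ}
    (hN : ∀ m, Thick.mk M x n m ∈ N ↔ ∀ i, S.t ^ k i ∣ b.repr m i) :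
    IsModification P E (Emb.ofTwist P (Emb.ofTransform N E)) b fun i ↦ k i - 1 := by
  have h := isModification_ofTransform S P E b hx hN
  refine ⟨fun p hp ↦ (Emb.lat_ofTwist_of_ne hx P _ hp).trans (h.lat_eq p hp), fun c hcb hc v ↦ ?_⟩
  rw [Emb.mem_lat_ofTwist, h.mem_lat c hcb hc]
  refine forall_congr' fun i ↦ ?_
  rw [map_smul, Finsupp.smul_apply, smul_eq_mul, ← mul_assoc, neg_sub, sub_eq_add_neg,
    zpow_one_add₀ P.τ_ne_zero, mul_comm P.τ]

end Modifications

/-! ### Lagrangian submodules and Hecke transforms in coordinates -/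

section Coordinates
variable {X : Scheme.{u}} [IsIntegral X] {x : X} {K : Type u} [Field K] [X.Over (Spec (.of K))]
  (S : Residue K (X.presheaf.stalk x)) {F G F₁ G₁ : X.Modules} {hF : IsVectorBundle F 2}
  {hG : IsVectorBundle G 2} (e : Module.Basis (Fin 2) (X.presheaf.stalk x) (Stalk F x))
  (f : Module.Basis (Fin 2) (X.presheaf.stalk x) (Stalk G x)) {δ : det F ≅ det G}
  {q : QuadForm (homSheaf F G)} (hq : IsDetForm δ q)

omit [IsIntegral X] in
theorem exists_alternating_ne_zero {k V : Type*} [Field k] [AddCommGroup V] [Module k V]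
    (hV : Module.finrank k V = 2) : ∃ ω : V [⋀^Fin 2]→ₗ[k] k, ω ≠ 0 := by
  have : Module.Finite k V := Module.finite_of_finrank_eq_succ hV
  let b := Module.finBasisOfFinrankEq k V hV
  refine ⟨b.det, fun h ↦ ?_⟩
  have := b.det_self
  rw [h] at this
  exact zero_ne_one this

include hq

/-- The form `q` at `x` is the determinant up to a unit. -/
theorem exists_isUnit_germ_eq_det : ∃ u : X.presheaf.stalk x, IsUnit u ∧
    ∀ (U : X.Opens) (hU : x ∈ U) (s : Γ(homSheaf F G, U)),
      X.presheaf.germ U x hU (q.form U s) =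
        (stalkMatrix hF hG e f (germ _ hU s)).det * u := by
  obtain ⟨ω', hω'⟩ := exists_alternating_ne_zero hG.finrank_stalk
  obtain ⟨ω, hω, hδ⟩ := exists_volumeForm hF.emb hG.emb hF hG hF.finrank_stalk hG.finrank_stalk
    hω' δ
  obtain ⟨Q, hQ⟩ := exists_detQuad hF.finrank_stalk hω ω'
  obtain ⟨c, hc, hcr, hcl⟩ := hF.emb.exists_basis_of_stalk hF.finrank_stalk e
  obtain ⟨d, hd, hdr, hdl⟩ := hG.emb.exists_basis_of_stalk hG.finrank_stalk f
  have hωc := (ω.map_basis_ne_zero_iff c).2 hω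
  have hωd := (ω'.map_basis_ne_zero_iff d).2 hω'
  -- The unit compares the volumes of the two bases. It and its inverse are regular because the
  -- determinant lattices agree.
  obtain ⟨u, hu⟩ : ω' d / ω c ∈ reg x := by
    rw [← hF.emb.mem_lat_ofDet hF hF.finrank_stalk hω hcl, lat_det_eq hδ,
      hG.emb.mem_lat_ofDet hG hG.finrank_stalk hω' hdl, div_self hωd]
    exact one_mem _
  obtain ⟨v, hv⟩ : ω c / ω' d ∈ reg x := by
    rw [← hG.emb.mem_lat_ofDet hG hG.finrank_stalk hω' hdl, ← lat_det_eq hδ,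
      hF.emb.mem_lat_ofDet hF hF.finrank_stalk hω hcl, div_self hωc]
    exact one_mem _
  have hinj := IsFractionRing.injective (X.presheaf.stalk x) X.functionField
  refine ⟨u, IsUnit.of_mul_eq_one v (hinj ?_), fun U hU s ↦ hinj ?_⟩
  · rw [map_mul, map_one, hu, hv, div_mul_div_cancel₀ hωc, div_self hωd]
  · rw [algebraMap_germ, (isDetForm_iff hδ hQ).1 hq U (genericPoint_mem hU) s, detQuad_eq hω hQ c,
      ω'.eq_smul_basis_det d, AlternatingMap.smul_apply, smul_eq_mul, mul_comm, mul_div_assoc,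
      map_mul, hu]
    congr 1
    rw [← Emb.stalkMap_germ _ hU, Module.Basis.det_apply, Matrix.det_fin_two, Matrix.det_fin_two,
      map_sub, map_mul, map_mul]
    simp only [Module.Basis.toMatrix_apply, Matrix.cons_val_zero, Matrix.cons_val_one, hc,
      Emb.hom_stalkMap_apply, hdr, stalkMatrix_apply]

theorem dvd_det_iff {U : X.Opens} (hU : x ∈ U) (s : Γ(homSheaf F G, U)) :
    X.presheaf.germ U x hU (q.form U s) ∈ mPow x 2 ↔
      S.t ^ 2 ∣ (stalkMatrix hF hG e f (germ _ hU s)).det := by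
  obtain ⟨u, hu, h⟩ := exists_isUnit_germ_eq_det (hF := hF) (hG := hG) e f hq
  rw [S.mem_mPow, h, hu.dvd_mul_right]

/-- Lagrangian submodules in terms of matrices. -/
theorem isLagrangian_iff {L : Submodule (X.presheaf.stalk x) (Thick (homSheaf F G) x 2)} :
    IsLagrangian K q x 4 L ↔ (∀ A ∈ coordLattice hF hG e f L, S.t ^ 2 ∣ A.det) ∧
      Module.finrank K (S.image (coordLattice hF hG e f L)) +
        Module.finrank K (S.coimage (coordLattice hF hG e f L)) = 4 := by
  rw [← finrank_lagrangian S hF hG e f]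
  constructor
  · rintro ⟨h1, h2⟩
    refine ⟨fun A hA ↦ ?_, h2⟩
    obtain ⟨φ, rfl⟩ := (stalkMatrix hF hG e f).surjective A
    obtain ⟨U, hU, s, rfl⟩ := exists_germ _ φ
    rw [← dvd_det_iff S e f hq hU]
    exact h1 U hU s ((stalkMatrix_mem_coordLattice hF hG e f).1 hA)
  · rintro ⟨h1, h2⟩
    refine ⟨fun U hU s hs ↦ ?_, h2⟩
    rw [dvd_det_iff S (hF := hF) (hG := hG) e f hq hU]
    exact h1 _ ((stalkMatrix_mem_coordLattice hF hG e f).2 hs)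

theorem mem_oSigma_iff {L : Submodule (X.presheaf.stalk x) (Thick (homSheaf F G) x 2)} {i : ℕ} :
    L ∈ OSigma K q x 4 i ↔ (∀ A ∈ coordLattice hF hG e f L, S.t ^ 2 ∣ A.det) ∧
      Module.finrank K (S.image (coordLattice hF hG e f L)) = i ∧
        i + Module.finrank K (S.coimage (coordLattice hF hG e f L)) = 4 := by
  rw [OSigma, Set.mem_ofPred_eq, isLagrangian_iff S (hF := hF) (hG := hG) e f hq,
    finrank_map_π S hF hG e f, and_assoc]
  refine and_congr_right fun _ ↦ ⟨fun h ↦ ⟨h.2, h.2 ▸ h.1⟩, fun h ↦ ⟨h.1 ▸ h.2, h.1⟩⟩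

/-- Matrices from the lattice with exponents `α` to the one with exponents `β` have entries
divisible by `t^(β i - α j)`. The `+1` in `n` is the power of `t` removed by the twist in the
orthogonal Hecke transform. -/
theorem heckeEqHom_of_coord (hx : IsClosed {x}) (P : LocalParameter x)
    {L : Submodule (X.presheaf.stalk x) (Thick (homSheaf F G) x 2)} {α β : Fin 2 → ℤ}
    {n : Fin 2 → Fin 2 → ℕ} (hn : ∀ i j, (n i j : ℤ) = β i - α j + 1)
    (hαβ : ∑ i, α i = ∑ i, β i)
    (hL : ∀ φ, Thick.mk _ x 2 φ ∈ L ↔ ∀ i j, S.t ^ n i j ∣ stalkMatrix hF hG e f φ i j)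
    {EF₁ : Emb F₁ (Stalk F (genericPoint X))} {EG₁ : Emb G₁ (Stalk G (genericPoint X))}
    (hF₁ : IsModification P hF.emb EF₁ e α) (hG₁ : IsModification P hG.emb EG₁ f β) :
    HeckeEqHom q L F₁ G₁ := by
  obtain ⟨ω', hω'⟩ := exists_alternating_ne_zero hG.finrank_stalk
  obtain ⟨ω, hω, hδ⟩ := exists_volumeForm hF.emb hG.emb hF hG hF.finrank_stalk hG.finrank_stalk
    hω' δ
  obtain ⟨Q, hQ⟩ := exists_detQuad hF.finrank_stalk hω ω'
  obtain ⟨c, hc, hcr, hcl⟩ := hF.emb.exists_basis_of_stalk hF.finrank_stalk e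
  obtain ⟨d, hd, hdr, hdl⟩ := hG.emb.exists_basis_of_stalk hG.finrank_stalk f
  refine heckeEqHom_of_scale hδ hQ hq hx P hαβ hcl hdl hF₁.lat_eq hG₁.lat_eq
    (hF₁.mem_lat c hcr hcl) (hG₁.mem_lat d hdr hdl) fun T ↦ ?_
  have key : ∀ φ i j, d.repr ((hF.emb.hom hG.emb hF hF.finrank_stalk).stalkMap x φ (c j)) i =
      algebraMap _ X.functionField (stalkMatrix hF hG e f φ i j) := fun φ i j ↦ by
    rw [hc, Emb.hom_stalkMap_apply, hdr, stalkMatrix_apply]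
  have hn' : ∀ i j, α j - β i - 1 = -(n i j : ℤ) := fun i j ↦ by rw [hn]; ring
  simp only [hn']
  rw [Emb.mem_lat_ofTransform]
  constructor
  · rintro ⟨φ, hφ, rfl⟩ i j
    rw [key, ← S.dvd_iff_mem_reg]
    exact (hL φ).1 hφ i j
  · intro h
    have hT : T ∈ (hF.emb.hom hG.emb hF hF.finrank_stalk).lat x :=
      (Emb.mem_lat_hom_iff_repr hcl hdl).2 fun i j ↦ P.mem_reg_of_zpow_mul_mem (h i j)
    obtain ⟨φ, rfl⟩ := Emb.mem_lat_iff_stalkMap _ |>.1 hT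
    refine ⟨φ, (hL φ).2 fun i j ↦ ?_, rfl⟩
    rw [S.dvd_iff_mem_reg P, ← key]
    exact h i j

omit hq

/-- Column operations change the basis of the source and row operations that of the target. The
matrix `g` enters through its inverse, hence the `symm` in the definition of `f'`. -/
theorem exists_bases {g h : Matrix (Fin 2) (Fin 2) (X.presheaf.stalk x)} (hg : IsUnit g.det)
    (hh : IsUnit h.det) : ∃ (e' : Module.Basis (Fin 2) (X.presheaf.stalk x) (Stalk F x))
      (f' : Module.Basis (Fin 2) (X.presheaf.stalk x) (Stalk G x)),
      ∀ φ, stalkMatrix hF hG e' f' φ = g * stalkMatrix hF hG e f φ * h := by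
  let e' := e.map (Matrix.toLinearEquiv e h hh)
  let f' := f.map (Matrix.toLinearEquiv f g hg).symm
  have h1 : e.toMatrix e' = h := by
    ext i j
    rw [Module.Basis.toMatrix_apply, Module.Basis.map_apply]
    change e.repr (Matrix.toLin e e h (e j)) i = _
    rw [← LinearMap.toMatrix_apply, LinearMap.toMatrix_toLin]
  have h2 : f'.toMatrix f = g := by
    ext i j
    rw [Module.Basis.toMatrix_apply, Module.Basis.map_repr, LinearEquiv.trans_apply,
      LinearEquiv.symm_symm]
    change f.repr (Matrix.toLin f f g (f j)) i = _
    rw [← LinearMap.toMatrix_apply, LinearMap.toMatrix_toLin]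
  refine ⟨e', f', fun φ ↦ ?_⟩
  refine (basis_toMatrix_mul_linearMap_toMatrix_mul_basis_toMatrix e' e f' f _).symm.trans ?_
  rw [h1, h2]
  rfl

end Coordinates

/-! ### The two types of Lagrangian submodules in the second stratum -/

section Strata
variable {X : Scheme.{u}} {x : X} {K : Type u} [Field K] [X.Over (Spec (.of K))]
  (S : Residue K (X.presheaf.stalk x)) {F G M : X.Modules}

theorem IsVectorBundle.nonempty_basis_stalk {r : ℕ} (hM : IsVectorBundle M r) (x : X) :
    Nonempty (Module.Basis (Fin r) (X.presheaf.stalk x) (Stalk M x)) := by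
  obtain ⟨U, hU, e, he⟩ := hM x
  obtain ⟨b, -⟩ := IsFrame.exists_basis_stalk he hU
  exact ⟨b⟩

theorem eval_mk {n : ℕ} (φ : Stalk (homSheaf F G) x) (m : Stalk F x) :
    Thick.eval x n F G (Thick.mk _ x n φ) (Thick.mk _ x n m) = Thick.mk _ x n (stalkEv F G x φ m) :=
  rfl

/-- The submodule of `M_{nx}` given by divisibility conditions on the coordinates. -/
def Residue.coordThick {ι : Type*} (b : Module.Basis ι (X.presheaf.stalk x) (Stalk M x))
    (k : ι → ℕ) (n : ℕ) : Submodule (X.presheaf.stalk x) (Thick M x n) :=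
  Submodule.map (Thick.mk M x n)
    { carrier := {m | ∀ i, S.t ^ k i ∣ b.repr m i}
      add_mem' := fun h h' i ↦ by
        rw [map_add, Finsupp.add_apply]
        exact dvd_add (h i) (h' i)
      zero_mem' := fun i ↦ by rw [map_zero]; exact dvd_zero _
      smul_mem' := fun c m h i ↦ by
        rw [map_smul, Finsupp.smul_apply]
        exact (h i).mul_left c }

theorem Residue.mk_mem_coordThick {ι : Type*} [Fintype ι]
    {b : Module.Basis ι (X.presheaf.stalk x) (Stalk M x)} {k : ι → ℕ} {n : ℕ} (hk : ∀ i, k i ≤ n)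
    {m : Stalk M x} : Thick.mk M x n m ∈ S.coordThick b k n ↔ ∀ i, S.t ^ k i ∣ b.repr m i := by
  constructor
  · rintro ⟨m', hm', h⟩ i
    rw [← sub_eq_zero, ← map_sub, S.mk_eq_zero_iff b] at h
    have h1 := (pow_dvd_pow S.t (hk i)).trans (h i)
    rw [map_sub, Finsupp.sub_apply] at h1
    exact (dvd_sub_right (hm' i)).1 h1
  · exact fun h ↦ ⟨m, h, rfl⟩

variable [IsIntegral X] {hF : IsVectorBundle F 2} {hG : IsVectorBundle G 2}

section
variable (e : Module.Basis (Fin 2) (X.presheaf.stalk x) (Stalk F x))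
  (f : Module.Basis (Fin 2) (X.presheaf.stalk x) (Stalk G x))

theorem stalkMatrix_symm_apply (A : Matrix (Fin 2) (Fin 2) (X.presheaf.stalk x)) (i j : Fin 2) :
    stalkMatrix hF hG e f ((stalkMatrix hF hG e f).symm A) i j = A i j := by
  rw [LinearEquiv.apply_symm_apply]

/-- `φ` maps every vector to a multiple of `n`. -/
theorem exists_rank_one {r : ℕ} [NeZero r] (hF : IsVectorBundle F r) (hG : IsVectorBundle G r)
    (e : Module.Basis (Fin r) (X.presheaf.stalk x) (Stalk F x)) (i : Fin r) (n : Stalk G x) :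
    ∃ φ : Stalk (homSheaf F G) x, ∀ m, stalkEv F G x φ m = e.repr m i • n := by
  obtain ⟨φ, hφ⟩ := (bijective_stalkEv hF hG).2 ((LinearMap.toSpanSingleton _ _ n).comp (e.coord i))
  exact ⟨φ, fun m ↦ by rw [hφ]; rfl⟩

end

/-- An element of `N` is recovered as a value of a rank-one homomorphism into `N`. -/
theorem homInto_injective {r : ℕ} [NeZero r] (hF : IsVectorBundle F r) (hG : IsVectorBundle G r) {n : ℕ}
    {N N' : Submodule (X.presheaf.stalk x) (Thick G x n)}
    (h : homInto F N = homInto F N') : N = N' := by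
  obtain ⟨e⟩ := hF.nonempty_basis_stalk x
  have key : ∀ {N N' : Submodule (X.presheaf.stalk x) (Thick G x n)},
      homInto F N = homInto F N' → N ≤ N' := by
    intro N N' h w hw
    obtain ⟨m, rfl⟩ := Thick.mk_surjective w
    obtain ⟨φ, hφ⟩ := exists_rank_one hF hG e 0 m
    have h1 : Thick.mk _ x n φ ∈ homInto F N := by
      intro v
      obtain ⟨v, rfl⟩ := Thick.mk_surjective v
      rw [eval_mk, hφ, map_smul]
      exact N.smul_mem _ hw
    rw [h] at h1
    have h2 := h1 (Thick.mk _ x n (e 0))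
    rwa [eval_mk, hφ, e.repr_self, Finsupp.single_eq_same, one_smul] at h2
  exact le_antisymm (key h) (key h.symm)

/-- A rank-one homomorphism with image `D` can be chosen not to vanish on `D'`: use a coordinate
that is a unit on a generator of `D'`. -/
theorem not_hasImageLine_and_hasKernelLine {r : ℕ} [NeZero r] (hF : IsVectorBundle F r)
    (hG : IsVectorBundle G r) (S : Residue K (X.presheaf.stalk x))
    {L : Submodule (X.presheaf.stalk x) (Thick (homSheaf F G) x 2)}
    (h : HasImageLine K L) (h' : HasKernelLine K L) : False := by
  obtain ⟨D, hD, hDL⟩ := h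
  obtain ⟨D', hD', hDL'⟩ := h'
  obtain ⟨⟨w, hw⟩, hw0, -⟩ := finrank_eq_one_iff'.1 hD
  obtain ⟨⟨v, hv⟩, hv0, -⟩ := finrank_eq_one_iff'.1 hD'
  obtain ⟨n, rfl⟩ := Thick.mk_surjective w
  obtain ⟨m, rfl⟩ := Thick.mk_surjective v
  obtain ⟨e⟩ := hF.nonempty_basis_stalk x
  obtain ⟨i, hi⟩ : ∃ i, IsUnit (e.repr m i) := by
    by_contra! h
    refine hv0 (Subtype.ext ((S.mk_eq_zero_iff e).2 fun i ↦ ?_))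
    rw [pow_one, ← S.eq_zero_iff]
    by_contra h'
    exact h i (S.isUnit _ h')
  obtain ⟨φ, hφ⟩ := exists_rank_one hF hG e i n
  have h1 : Thick.mk _ x 1 φ ∈ homInto F D := by
    intro v
    obtain ⟨v, rfl⟩ := Thick.mk_surjective v
    rw [eval_mk, hφ, map_smul]
    exact D.smul_mem _ hw
  rw [← hDL, hDL'] at h1
  have h2 := h1 _ hv
  rw [eval_mk, hφ, map_smul] at h2
  exact hw0 (Subtype.ext (hi.smul_eq_zero.1 h2))

/-- In suitable bases, `L` consists of the matrices whose second row vanishes modulo `t²`. -/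
def IsColumnForm (hF : IsVectorBundle F 2) (hG : IsVectorBundle G 2)
    (S : Residue K (X.presheaf.stalk x))
    (L : Submodule (X.presheaf.stalk x) (Thick (homSheaf F G) x 2)) : Prop :=
  ∃ (e : Module.Basis (Fin 2) (X.presheaf.stalk x) (Stalk F x))
    (f : Module.Basis (Fin 2) (X.presheaf.stalk x) (Stalk G x)),
    ∀ φ, Thick.mk _ x 2 φ ∈ L ↔ ∀ j, S.t ^ 2 ∣ stalkMatrix hF hG e f φ 1 j

/-- In suitable bases, `L` consists of the matrices whose second column vanishes modulo `t²`. -/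
def IsRowForm (hF : IsVectorBundle F 2) (hG : IsVectorBundle G 2)
    (S : Residue K (X.presheaf.stalk x))
    (L : Submodule (X.presheaf.stalk x) (Thick (homSheaf F G) x 2)) : Prop :=
  ∃ (e : Module.Basis (Fin 2) (X.presheaf.stalk x) (Stalk F x))
    (f : Module.Basis (Fin 2) (X.presheaf.stalk x) (Stalk G x)),
    ∀ φ, Thick.mk _ x 2 φ ∈ L ↔ ∀ i, S.t ^ 2 ∣ stalkMatrix hF hG e f φ i 1

variable {L : Submodule (X.presheaf.stalk x) (Thick (homSheaf F G) x 2)}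

variable {S}

/-- Completing `w` to a unimodular matrix gives a row operation whose second row is the bracket with
`w`. -/
theorem isColumnForm_of_coordLattice
    {e : Module.Basis (Fin 2) (X.presheaf.stalk x) (Stalk F x)}
    {f : Module.Basis (Fin 2) (X.presheaf.stalk x) (Stalk G x)} {w : Fin 2 → X.presheaf.stalk x}
    (hw : (fun i ↦ S.ρ (w i)) ≠ 0) (hL : coordLattice hF hG e f L = S.columnLattice w) :
    IsColumnForm hF hG S L := by
  obtain ⟨p, r, hpr⟩ := S.exists_coprime hw
  obtain ⟨e', f', h⟩ := exists_bases (hF := hF) (hG := hG) e f (g := !![p, r; -w 1, w 0]) (h := 1)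
    (by rw [Matrix.det_fin_two_of, show p * w 0 - r * -w 1 = 1 by linear_combination hpr]
        exact isUnit_one) (by rw [Matrix.det_one]; exact isUnit_one)
  refine ⟨e', f', fun φ ↦ ?_⟩
  rw [← stalkMatrix_mem_coordLattice hF hG e f, hL, Residue.mem_columnLattice]
  refine forall_congr' fun j ↦ ?_
  rw [h, Matrix.mul_one, Matrix.mul_apply, Fin.sum_univ_two, bracket]
  simp only [Matrix.of_apply, Matrix.cons_val_zero, Matrix.cons_val_one, Matrix.transpose_apply]
  rw [neg_mul, neg_add_eq_sub]

theorem isRowForm_of_coordLattice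
    {e : Module.Basis (Fin 2) (X.presheaf.stalk x) (Stalk F x)}
    {f : Module.Basis (Fin 2) (X.presheaf.stalk x) (Stalk G x)} {w : Fin 2 → X.presheaf.stalk x}
    (hw : (fun i ↦ S.ρ (w i)) ≠ 0) (hL : coordLattice hF hG e f L = S.rowLattice w) :
    IsRowForm hF hG S L := by
  obtain ⟨p, r, hpr⟩ := S.exists_coprime hw
  obtain ⟨e', f', h⟩ := exists_bases (hF := hF) (hG := hG) e f (h := !![p, -w 1; r, w 0]) (g := 1)
    (by rw [Matrix.det_one]; exact isUnit_one)
    (by rw [Matrix.det_fin_two_of, show p * w 0 - -w 1 * r = 1 by linear_combination hpr]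
        exact isUnit_one)
  refine ⟨e', f', fun φ ↦ ?_⟩
  rw [← stalkMatrix_mem_coordLattice hF hG e f, hL, Residue.mem_rowLattice]
  refine forall_congr' fun j ↦ ?_
  rw [h, Matrix.one_mul, Matrix.mul_apply, Fin.sum_univ_two, bracket]
  simp only [Matrix.of_apply, Matrix.cons_val_zero, Matrix.cons_val_one]
  rw [mul_neg, neg_add_eq_sub, mul_comm, mul_comm (w 1)]

theorem mk_eq_mk_of_dvd {n : ℕ} {e : Module.Basis (Fin 2) (X.presheaf.stalk x) (Stalk F x)}
    {f : Module.Basis (Fin 2) (X.presheaf.stalk x) (Stalk G x)} {φ ψ : Stalk (homSheaf F G) x}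
    (h : ∀ i j, S.t ^ n ∣ stalkMatrix hF hG e f φ i j - stalkMatrix hF hG e f ψ i j) :
    Thick.mk _ x n φ = Thick.mk _ x n ψ := by
  rw [← sub_eq_zero, ← map_sub, mk_eq_zero_iff_stalkMatrix S hF hG e f]
  intro i j
  rw [map_sub]
  exact h i j

/-- The homomorphisms with image in `N`, and the matrices. -/
theorem mk_mem_homInto_iff {n : ℕ} {e : Module.Basis (Fin 2) (X.presheaf.stalk x) (Stalk F x)}
    {f : Module.Basis (Fin 2) (X.presheaf.stalk x) (Stalk G x)} {φ : Stalk (homSheaf F G) x} :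
    Thick.mk _ x n φ ∈ homInto F (S.coordThick f ![0, n] n) ↔
      ∀ j, S.t ^ n ∣ stalkMatrix hF hG e f φ 1 j := by
  have hk : ∀ i, (![0, n] : Fin 2 → ℕ) i ≤ n := by intro i; fin_cases i <;> simp
  constructor
  · intro h j
    have h1 := h (Thick.mk _ x n (e j))
    rw [eval_mk, S.mk_mem_coordThick hk] at h1
    rw [stalkMatrix_apply]
    exact h1 1
  · intro h m
    obtain ⟨m, rfl⟩ := Thick.mk_surjective m
    rw [eval_mk, S.mk_mem_coordThick hk]
    intro i
    fin_cases i
    · simp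
    · rw [repr_stalkEv hF hG e f]
      exact Finset.dvd_sum fun j _ ↦ (h j).mul_right _

/-- The exponents `![n, 0]` describe the span of `e 1`, so the second column is the image of its
generator. -/
theorem mk_mem_homKilling_iff {n : ℕ}
    {e : Module.Basis (Fin 2) (X.presheaf.stalk x) (Stalk F x)}
    {f : Module.Basis (Fin 2) (X.presheaf.stalk x) (Stalk G x)} {φ : Stalk (homSheaf F G) x} :
    Thick.mk _ x n φ ∈ homKilling G (S.coordThick e ![n, 0] n) ↔
      ∀ i, S.t ^ n ∣ stalkMatrix hF hG e f φ i 1 := by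
  have hk : ∀ i, (![n, 0] : Fin 2 → ℕ) i ≤ n := by intro i; fin_cases i <;> simp
  constructor
  · intro h i
    have h1 := h (Thick.mk _ x n (e 1)) ((S.mk_mem_coordThick hk).2 fun i ↦ by
      fin_cases i <;> simp)
    rw [eval_mk, S.mk_eq_zero_iff f] at h1
    rw [stalkMatrix_apply]
    exact h1 i
  · intro h m hm
    obtain ⟨m, rfl⟩ := Thick.mk_surjective m
    rw [S.mk_mem_coordThick hk] at hm
    rw [eval_mk, S.mk_eq_zero_iff f]
    intro i
    rw [repr_stalkEv hF hG e f, Fin.sum_univ_two]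
    exact dvd_add ((hm 0).mul_left _) ((h i).mul_right _)

namespace IsColumnForm

theorem exists_eq (h : IsColumnForm hF hG S L) :
    ∃ f : Module.Basis (Fin 2) (X.presheaf.stalk x) (Stalk G x),
      L = homInto F (S.coordThick f ![0, 2] 2) := by
  obtain ⟨e, f, hL⟩ := h
  refine ⟨f, ?_⟩
  ext a
  obtain ⟨φ, rfl⟩ := Thick.mk_surjective a
  rw [hL, mk_mem_homInto_iff (hF := hF) (hG := hG) (e := e)]

theorem existsUnique (h : IsColumnForm hF hG S L) :
    ∃! N : Submodule (X.presheaf.stalk x) (Thick G x 2), L = homInto F N := by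
  obtain ⟨f, hf⟩ := h.exists_eq
  exact ⟨_, hf, fun N hN ↦ homInto_injective hF hG (hN.symm.trans hf)⟩

theorem hasImageLine (h : IsColumnForm hF hG S L) : HasImageLine K L := by
  obtain ⟨e, f, hL⟩ := h
  refine ⟨S.coordThick f ![0, 1] 1, S.finrank_eq_one_of_coord (b := f) (i := 1) (j := 0)
    (by decide) fun m ↦ ?_, ?_⟩
  · rw [S.mk_mem_coordThick (by intro i; fin_cases i <;> simp), Fin.forall_fin_two]
    simp
  · ext a
    obtain ⟨φ, rfl⟩ := Thick.mk_surjective a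
    rw [mk_mem_homInto_iff (hF := hF) (hG := hG) (e := e)]
    constructor
    · rintro ⟨b, hb, hba⟩ j
      obtain ⟨ψ, rfl⟩ := Thick.mk_surjective b
      have h1 : Thick.mk (homSheaf F G) x 1 (ψ - φ) = 0 := by
        rw [map_sub, sub_eq_zero]; exact hba
      have h2 := (mk_eq_zero_iff_stalkMatrix S hF hG e f).1 h1 1 j
      rw [map_sub] at h2
      rw [pow_one] at h2 ⊢
      exact (dvd_sub_right ((Dvd.intro_left _ (sq S.t).symm).trans ((hL ψ).1 hb j))).1 h2
    · intro h
      -- Replacing the second row, which vanishes modulo `t`, by zero gives a lift that lies in `L`.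
      refine ⟨Thick.mk _ x 2 ((stalkMatrix hF hG e f).symm
        !![stalkMatrix hF hG e f φ 0 0, stalkMatrix hF hG e f φ 0 1; 0, 0]), (hL _).2 fun j ↦ ?_,
        mk_eq_mk_of_dvd (S := S) (hF := hF) (hG := hG) (e := e) (f := f) fun i j ↦ ?_⟩
      · rw [stalkMatrix_symm_apply]
        fin_cases j <;> simp
      · rw [stalkMatrix_symm_apply]
        fin_cases i
        · fin_cases j <;> simp
        · have := (dvd_neg (a := S.t ^ 1)).2 (h j)
          fin_cases j <;> simpa using this

end IsColumnForm

namespace IsRowForm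

theorem exists_eq (h : IsRowForm hF hG S L) :
    ∃ e : Module.Basis (Fin 2) (X.presheaf.stalk x) (Stalk F x),
      L = homKilling G (S.coordThick e ![2, 0] 2) := by
  obtain ⟨e, f, hL⟩ := h
  refine ⟨e, ?_⟩
  ext a
  obtain ⟨φ, rfl⟩ := Thick.mk_surjective a
  rw [hL, mk_mem_homKilling_iff (hF := hF) (hG := hG) (f := f)]

theorem hasKernelLine (h : IsRowForm hF hG S L) : HasKernelLine K L := by
  obtain ⟨e, f, hL⟩ := h
  refine ⟨S.coordThick e ![1, 0] 1, S.finrank_eq_one_of_coord (b := e) (i := 0) (j := 1)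
    (by decide) fun m ↦ ?_, ?_⟩
  · rw [S.mk_mem_coordThick (by intro i; fin_cases i <;> simp), Fin.forall_fin_two]
    simp
  · ext a
    obtain ⟨φ, rfl⟩ := Thick.mk_surjective a
    rw [mk_mem_homKilling_iff (hF := hF) (hG := hG) (f := f)]
    constructor
    · rintro ⟨b, hb, hba⟩ j
      obtain ⟨ψ, rfl⟩ := Thick.mk_surjective b
      have h1 : Thick.mk (homSheaf F G) x 1 (ψ - φ) = 0 := by
        rw [map_sub, sub_eq_zero]; exact hba
      have h2 := (mk_eq_zero_iff_stalkMatrix S hF hG e f).1 h1 j 1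
      rw [map_sub] at h2
      rw [pow_one] at h2 ⊢
      exact (dvd_sub_right ((Dvd.intro_left _ (sq S.t).symm).trans ((hL ψ).1 hb j))).1 h2
    · intro h
      refine ⟨Thick.mk _ x 2 ((stalkMatrix hF hG e f).symm
        !![stalkMatrix hF hG e f φ 0 0, 0; stalkMatrix hF hG e f φ 1 0, 0]), (hL _).2 fun j ↦ ?_,
        mk_eq_mk_of_dvd (S := S) (hF := hF) (hG := hG) (e := e) (f := f) fun i j ↦ ?_⟩
      · rw [stalkMatrix_symm_apply]
        fin_cases j <;> simp
      · rw [stalkMatrix_symm_apply]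
        fin_cases j
        · fin_cases i <;> simp
        · have := (dvd_neg (a := S.t ^ 1)).2 (h i)
          fin_cases i <;> simpa using this

/-- Uniqueness is a double-annihilator argument. The homomorphisms in `L` force `N` into the span of
`e 1`. If `N` were smaller, further homomorphisms, divisible by `t` but not by `t²`, would kill it.
-/
theorem existsUnique (h : IsRowForm hF hG S L) :
    ∃! N : Submodule (X.presheaf.stalk x) (Thick F x 2), L = homKilling G N := by
  obtain ⟨e, he⟩ := h.exists_eq
  obtain ⟨f⟩ := hG.nonempty_basis_stalk x
  have hL : ∀ φ, Thick.mk _ x 2 φ ∈ L ↔ ∀ i, S.t ^ 2 ∣ stalkMatrix hF hG e f φ i 1 := fun φ ↦ by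
    rw [he, mk_mem_homKilling_iff]
  have hk : ∀ i, (![2, 0] : Fin 2 → ℕ) i ≤ 2 := by intro i; fin_cases i <;> simp
  refine ⟨_, he, fun N hN ↦ ?_⟩
  have h1 : ∀ m, Thick.mk _ x 2 m ∈ N → S.t ^ 2 ∣ e.repr m 0 := by
    intro m hm
    -- This homomorphism reads off the first coordinate, which must therefore vanish on `N`.
    have h1 : Thick.mk _ x 2 ((stalkMatrix hF hG e f).symm !![1, 0; 0, 0]) ∈ L := by
      rw [hL]
      intro i
      rw [stalkMatrix_symm_apply]
      fin_cases i <;> simp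
    rw [hN] at h1
    have h2 := h1 _ hm
    rw [eval_mk, S.mk_eq_zero_iff f] at h2
    have h3 := h2 0
    rw [repr_stalkEv hF hG e f, Fin.sum_univ_two, stalkMatrix_symm_apply,
      stalkMatrix_symm_apply] at h3
    simpa using h3
  have h2 : ∀ m, S.t ^ 2 ∣ e.repr m 0 →
      Thick.mk _ x 2 m = e.repr m 1 • Thick.mk _ x 2 (e 1) := by
    intro m hm
    rw [← map_smul, ← sub_eq_zero, ← map_sub, S.mk_eq_zero_iff e]
    intro i
    fin_cases i
    · simpa using hm
    · simp
  have h3 : Thick.mk _ x 2 (e 1) ∈ N := by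
    by_contra h
    have h3 : ∀ m, Thick.mk _ x 2 m ∈ N → S.t ∣ e.repr m 1 := by
      intro m hm
      rw [← S.eq_zero_iff]
      by_contra h'
      obtain ⟨v, hv⟩ := (S.isUnit _ h').exists_left_inv
      have h4 := N.smul_mem v hm
      rw [h2 m (h1 m hm), smul_smul, hv, one_smul] at h4
      exact h h4
    -- If `e 1 ∉ N`, the second coordinates on `N` are divisible by `t`, so this matrix kills `N`.
    -- Its second column is nonzero modulo `t²`, so it does not lie in `L`.
    have h4 : Thick.mk _ x 2 ((stalkMatrix hF hG e f).symm !![0, S.t; 0, 0]) ∈ homKilling G N := by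
      intro m hm
      obtain ⟨m, rfl⟩ := Thick.mk_surjective m
      rw [eval_mk, S.mk_eq_zero_iff f]
      intro i
      rw [repr_stalkEv hF hG e f, Fin.sum_univ_two, stalkMatrix_symm_apply, stalkMatrix_symm_apply]
      obtain ⟨c, hc⟩ := h3 m hm
      fin_cases i
      · exact ⟨c, by simp [hc, sq, mul_assoc]⟩
      · simp
    rw [← hN, hL] at h4
    have h5 := h4 0
    rw [stalkMatrix_symm_apply] at h5
    have h6 : S.t * S.t ∣ S.t * 1 := by simpa [sq] using h5
    rw [mul_dvd_mul_iff_left S.t_ne_zero, ← S.eq_zero_iff, map_one] at h6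
    exact one_ne_zero h6
  ext v
  obtain ⟨m, rfl⟩ := Thick.mk_surjective v
  rw [S.mk_mem_coordThick hk, Fin.forall_fin_two]
  constructor
  · exact fun hm ↦ ⟨h1 m hm, by simp⟩
  · intro hm
    rw [h2 m hm.1]
    exact N.smul_mem _ h3

end IsRowForm

end Strata

/-! ### The orthogonal Hecke transforms in normal form -/

section HeckeTransforms
variable {X : Scheme.{u}} [IsIntegral X] {x : X} {K : Type u} [Field K] [X.Over (Spec (.of K))]
  {S : Residue K (X.presheaf.stalk x)} {F G : X.Modules} {hF : IsVectorBundle F 2}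
  {hG : IsVectorBundle G 2} {δ : det F ≅ det G} {q : QuadForm (homSheaf F G)}
  (hq : IsDetForm δ q) {L : Submodule (X.presheaf.stalk x) (Thick (homSheaf F G) x 2)}
include hq

theorem isColumnForm_or_isRowForm (hL : L ∈ OSigma K q x 4 2) :
    IsColumnForm hF hG S L ∨ IsRowForm hF hG S L := by
  obtain ⟨e⟩ := hF.nonempty_basis_stalk x
  obtain ⟨f⟩ := hG.nonempty_basis_stalk x
  obtain ⟨h1, h2, h3⟩ := (mem_oSigma_iff S (hF := hF) (hG := hG) e f hq).1 hL
  obtain ⟨w, hw, h⟩ | ⟨w, hw, h⟩ := S.eq_columnLattice_or_rowLattice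
    (smul_mem_coordLattice S hF hG e f) h1 h2 (by omega)
  · exact Or.inl (isColumnForm_of_coordLattice hw h)
  · exact Or.inr (isRowForm_of_coordLattice hw h)

variable (hx : IsClosed {x}) (P : LocalParameter x)
include hx P

/-- The exponents are `α = (0, 0)` and `β = (0, 2) - (1, 1) = (-1, 1)`, so `n` is `0` in the first
row and `2` in the second. -/
theorem IsColumnForm.heckeEqHom (h : IsColumnForm hF hG S L)
    (N : Submodule (X.presheaf.stalk x) (Thick G x 2)) (hN : L = homInto F N) :
    HeckeEqHom q L F (twist (heckeTransform G x N) x) := by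
  obtain ⟨f, hf⟩ := h.exists_eq
  obtain ⟨e⟩ := hF.nonempty_basis_stalk x
  obtain rfl := homInto_injective hF hG (hN.symm.trans hf)
  have hk : ∀ i, (![0, 2] : Fin 2 → ℕ) i ≤ 2 := by intro i; fin_cases i <;> simp
  refine heckeEqHom_of_coord S (hF := hF) (hG := hG) e f hq hx P (n := ![![0, 0], ![2, 2]])
    (fun i j ↦ ?_) ?_ (fun φ ↦ ?_) (isModification_self P hF.emb e)
    (isModification_ofTwist S P hG.emb f hx fun m ↦ S.mk_mem_coordThick hk)
  · fin_cases i <;> fin_cases j <;> rfl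
  · rfl
  · rw [hN, mk_mem_homInto_iff (hF := hF) (hG := hG) (e := e)]
    simp [Fin.forall_fin_two]

/-- The exponents are `α = (2, 0) - (1, 1) = (1, -1)` and `β = (0, 0)`, so `n` is `0` in the first
column and `2` in the second. -/
theorem IsRowForm.heckeEqHom (h : IsRowForm hF hG S L)
    (N : Submodule (X.presheaf.stalk x) (Thick F x 2)) (hN : L = homKilling G N) :
    HeckeEqHom q L (twist (heckeTransform F x N) x) G := by
  obtain ⟨e, he⟩ := h.exists_eq
  obtain ⟨f⟩ := hG.nonempty_basis_stalk x
  obtain rfl := h.existsUnique.unique hN he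
  have hk : ∀ i, (![2, 0] : Fin 2 → ℕ) i ≤ 2 := by intro i; fin_cases i <;> simp
  refine heckeEqHom_of_coord S (hF := hF) (hG := hG) e f hq hx P (n := ![![0, 2], ![0, 2]])
    (fun i j ↦ ?_) ?_ (fun φ ↦ ?_)
    (isModification_ofTwist S P hF.emb e hx fun m ↦ S.mk_mem_coordThick hk)
    (isModification_self P hG.emb f)
  · fin_cases i <;> fin_cases j <;> rfl
  · rfl
  · rw [hN, mk_mem_homKilling_iff (hF := hF) (hG := hG) (f := f)]
    simp [Fin.forall_fin_two]

include S hF hG in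
theorem heckeEqHom_of_mem_oSigma_one (hL : L ∈ OSigma K q x 4 1) :
    (∃ φ : Thick (homSheaf F G) x 1, L.map (Thick.π _ x) = Submodule.span _ {φ}) ∧
    ∀ φ : Thick (homSheaf F G) x 1, L.map (Thick.π _ x) = Submodule.span _ {φ} →
      Module.finrank K (LinearMap.ker (Thick.eval x 1 F G φ)) = 1 ∧
      Module.finrank K (LinearMap.range (Thick.eval x 1 F G φ)) = 1 ∧
      HeckeEqHom q L (heckeTransform F x (LinearMap.ker (Thick.eval x 1 F G φ)))
        (heckeTransform G x (LinearMap.range (Thick.eval x 1 F G φ))) := by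
  obtain ⟨e₀⟩ := hF.nonempty_basis_stalk x
  obtain ⟨f₀⟩ := hG.nonempty_basis_stalk x
  obtain ⟨h1, h2, h3⟩ := (mem_oSigma_iff S (hF := hF) (hG := hG) e₀ f₀ hq).1 hL
  obtain ⟨g, h, hg, hh, hgh⟩ := S.exists_normalForm_of_finrank_one
    (smul_mem_coordLattice S hF hG e₀ f₀) h1 h2 (by omega)
  obtain ⟨e, f, hef⟩ := exists_bases (hF := hF) (hG := hG) e₀ f₀ hg hh
  have hLφ : ∀ φ, Thick.mk _ x 2 φ ∈ L ↔ S.t ∣ stalkMatrix hF hG e f φ 0 1 ∧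
      S.t ∣ stalkMatrix hF hG e f φ 1 0 ∧ S.t ^ 2 ∣ stalkMatrix hF hG e f φ 1 1 := fun φ ↦ by
    rw [← stalkMatrix_mem_coordLattice hF hG e₀ f₀, hgh, hef]
  have ht2 : ∀ {a}, S.t ^ 2 ∣ a → S.t ∣ a := fun h ↦ (Dvd.intro_left _ (sq S.t).symm).trans h
  -- In the normal form the image of `L` in the fibre is spanned by this elementary matrix.
  set φ₀ := (stalkMatrix hF hG e f).symm !![1, 0; 0, 0] with hφ₀
  have hφ₀L : Thick.mk _ x 2 φ₀ ∈ L := by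
    rw [hLφ, stalkMatrix_symm_apply, stalkMatrix_symm_apply, stalkMatrix_symm_apply]
    simp
  have hφ₀π : Thick.mk _ x 1 φ₀ ∈ L.map (Thick.π _ x) := ⟨_, hφ₀L, rfl⟩
  refine ⟨⟨Thick.mk _ x 1 φ₀, le_antisymm ?_ ?_⟩, fun φ hφ ↦ ?_⟩
  · rintro _ ⟨a, ha, rfl⟩
    obtain ⟨φ, rfl⟩ := Thick.mk_surjective a
    obtain ⟨h01, h10, h11⟩ := (hLφ φ).1 ha
    refine Submodule.mem_span_singleton.2 ⟨stalkMatrix hF hG e f φ 0 0, ?_⟩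
    rw [← map_smul]
    refine mk_eq_mk_of_dvd (S := S) (hF := hF) (hG := hG) (e := e) (f := f) fun i j ↦ ?_
    rw [map_smul, Matrix.smul_apply, stalkMatrix_symm_apply, pow_one, ← dvd_neg]
    fin_cases i <;> fin_cases j <;> simp [h01, h10, ht2 h11]
  · rw [Submodule.span_singleton_le_iff_mem]
    exact hφ₀π
  · obtain ⟨a, ha, rfl⟩ : φ ∈ L.map (Thick.π _ x) := hφ ▸ Submodule.mem_span_singleton_self φ
    obtain ⟨ψ, rfl⟩ := Thick.mk_surjective a
    have hπ : Thick.π _ x (Thick.mk _ x 2 ψ) = Thick.mk (homSheaf F G) x 1 ψ := rfl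
    rw [hπ] at hφ ⊢
    obtain ⟨h01, h10, h11⟩ := (hLφ ψ).1 ha
    -- The given generator spans the class of `φ₀`, so its corner entry cannot reduce to zero. Its
    -- kernel and image are then the coordinate lines.
    have h00 : IsUnit (stalkMatrix hF hG e f ψ 0 0) := by
      rw [hφ] at hφ₀π
      obtain ⟨c, hc⟩ := Submodule.mem_span_singleton.1 hφ₀π
      rw [← map_smul, ← sub_eq_zero, ← map_sub, mk_eq_zero_iff_stalkMatrix S hF hG e f] at hc
      have hc := hc 0 0
      rw [map_sub, map_smul, Matrix.sub_apply, stalkMatrix_symm_apply, Matrix.smul_apply, pow_one,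
        ← S.eq_zero_iff] at hc
      refine S.isUnit _ fun h0 ↦ ?_
      simp [h0] at hc
    obtain ⟨v, hv⟩ := h00.exists_left_inv
    have hker : ∀ m, Thick.mk F x 1 m ∈ LinearMap.ker (Thick.eval x 1 F G (Thick.mk _ x 1 ψ)) ↔
        S.t ∣ e.repr m 0 := by
      intro m
      rw [LinearMap.mem_ker, eval_mk, S.mk_eq_zero_iff f, Fin.forall_fin_two, pow_one,
        repr_stalkEv hF hG e f, repr_stalkEv hF hG e f, Fin.sum_univ_two, Fin.sum_univ_two,
        dvd_add_left (h01.mul_right _), h00.dvd_mul_left]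
      exact and_iff_left (dvd_add (h10.mul_right _) ((ht2 h11).mul_right _))
    have hrange : ∀ n, Thick.mk G x 1 n ∈
        LinearMap.range (Thick.eval x 1 F G (Thick.mk _ x 1 ψ)) ↔ S.t ∣ f.repr n 1 := by
      intro n
      constructor
      · rintro ⟨m, hm⟩
        obtain ⟨m, rfl⟩ := Thick.mk_surjective m
        rw [eval_mk, ← sub_eq_zero, ← map_sub, S.mk_eq_zero_iff f] at hm
        have h1 := hm 1
        rw [map_sub, Finsupp.sub_apply, pow_one, repr_stalkEv hF hG e f, Fin.sum_univ_two] at h1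
        exact (dvd_sub_right (dvd_add (h10.mul_right _) ((ht2 h11).mul_right _))).1 h1
      · intro hn
        refine ⟨Thick.mk _ x 1 ((f.repr n 0 * v) • e 0), ?_⟩
        rw [eval_mk, ← sub_eq_zero, ← map_sub, S.mk_eq_zero_iff f]
        intro i
        rw [map_sub, Finsupp.sub_apply, pow_one, repr_stalkEv hF hG e f, Fin.sum_univ_two]
        fin_cases i
        · refine ⟨0, ?_⟩
          simp only [map_smul, e.repr_self, Finsupp.smul_apply, Finsupp.single_apply, smul_eq_mul]
          simp
          linear_combination f.repr n 0 * hv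
        · refine dvd_sub ?_ hn
          simp only [map_smul, e.repr_self, Finsupp.smul_apply, Finsupp.single_apply, smul_eq_mul]
          simpa using h10.mul_right _
    refine ⟨S.finrank_eq_one_of_coord zero_ne_one hker, S.finrank_eq_one_of_coord one_ne_zero hrange,
      -- Here `α = (1, 0)` and `β = (0, 1)`: the kernel is the line of `e 1`, and the image is the
      -- line of `f 0`.
      heckeEqHom_of_coord S (hF := hF) (hG := hG) e f hq hx P (n := ![![0, 1], ![1, 2]])
      (fun i j ↦ ?_) ?_ (fun φ ↦ ?_)
      (isModification_ofTransform S P hF.emb e hx (k := ![1, 0]) fun m ↦ ?_)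
      (isModification_ofTransform S P hG.emb f hx (k := ![0, 1]) fun m ↦ ?_)⟩
    · fin_cases i <;> fin_cases j <;> rfl
    · rfl
    · rw [hLφ]
      simp [Fin.forall_fin_two]
    · rw [hker]
      simp [Fin.forall_fin_two]
    · rw [hrange]
      simp [Fin.forall_fin_two]

end HeckeTransforms

/-! ### Connected and closed subsets of the Grassmannian -/

section Grassmannians
variable {K W : Type*} [Field K] [AddCommGroup W] [Module K W] {d : ℕ}

/-- On an affine line a polynomial function is a polynomial in the parameter, so it vanishes at
finitely many parameters or identically. Affine lines are therefore continuous for the cofinite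
topology. -/
theorem exists_eval_eq {p : W → K} (hp : p ∈ polynomialFunctions K W) (a b : W) :
    ∃ P : Polynomial K, ∀ s, P.eval s = p (a + s • b) := by
  induction hp using Algebra.adjoin_induction with
  | mem p hp =>
    obtain ⟨l, rfl⟩ := hp
    exact ⟨Polynomial.C (l a) + Polynomial.X * Polynomial.C (l b), fun s ↦ by
      simp only [Polynomial.eval_add, Polynomial.eval_C, Polynomial.eval_mul, Polynomial.eval_X,
        map_add, map_smul, smul_eq_mul]⟩
  | algebraMap c => exact ⟨Polynomial.C c, fun s ↦ by simp⟩
  | add p p' _ _ h h' =>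
    obtain ⟨P, hP⟩ := h
    obtain ⟨P', hP'⟩ := h'
    exact ⟨P + P', fun s ↦ by simp [hP, hP']⟩
  | mul p p' _ _ h h' =>
    obtain ⟨P, hP⟩ := h
    obtain ⟨P', hP'⟩ := h'
    exact ⟨P * P', fun s ↦ by simp [hP, hP']⟩

/-- The subspaces spanned by the frames on an affine line form a connected set. -/
theorem isPreconnected_range_span [Infinite K] (a b : Fin d → W) {T : Set K} (hT : Tᶜ.Finite)
    (h : ∀ s ∈ T, LinearIndependent K (a + s • b)) :
    IsPreconnected (Set.range fun s : T ↦ Frame.span K W ⟨a + s.1 • b, h s s.2⟩) := by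
  let κ : CofiniteTopology K ≃ K := CofiniteTopology.of.symm
  let T' : Set (CofiniteTopology K) := κ ⁻¹' T
  -- Finitely many cofinite subsets of an infinite field have a common point.
  have hT' : IsPreirreducible T' := by
    intro u v hu hv ⟨y, _, hy⟩ ⟨z, _, hz⟩
    have h1 := CofiniteTopology.isOpen_iff.1 hu ⟨y, hy⟩
    have h2 := CofiniteTopology.isOpen_iff.1 hv ⟨z, hz⟩
    have h3 : (T'ᶜ ∪ (uᶜ ∪ vᶜ)).Finite :=
      Set.Finite.union (hT.preimage κ.injective.injOn) (h1.union h2)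
    have : Infinite (CofiniteTopology K) := κ.infinite_iff.2 inferInstance
    obtain ⟨s, hs⟩ := h3.infinite_compl.nonempty
    simp only [Set.compl_union, compl_compl] at hs
    exact ⟨s, hs⟩
  have : PreconnectedSpace T' := Subtype.preconnectedSpace hT'.isPreconnected
  let γ : T' → Frame K W d := fun s ↦ ⟨a + κ s.1 • b, h _ s.2⟩
  have hγ : Continuous γ := by
    refine continuous_generateFrom_iff.2 ?_
    rintro _ ⟨p, hp, rfl⟩
    obtain ⟨P, hP⟩ := exists_eval_eq hp a b
    refine ⟨{s | P.eval (κ s) ≠ 0}, ?_, ?_⟩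
    · refine CofiniteTopology.isOpen_iff.2 fun ⟨s, hs⟩ ↦ ?_
      have hP0 : P ≠ 0 := fun h ↦ hs (by rw [h, Polynomial.eval_zero])
      refine ((P.finite_setOfPred_isRoot hP0).preimage κ.injective.injOn).subset fun s hs ↦ ?_
      exact not_not.1 hs
    · ext s
      exact not_congr (by rw [hP])
  have hspan : Continuous (Frame.span K W (d := d)) := continuous_coinduced_rng
  have h4 := isPreconnected_range (hspan.comp hγ)
  convert h4 using 1
  ext N
  constructor
  · rintro ⟨s, rfl⟩
    refine ⟨⟨κ.symm s, by simp [T']⟩, congrArg (Frame.span K W) (Subtype.ext ?_)⟩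
    exact congrArg (fun c ↦ a + c • b) (κ.apply_symm_apply s.1)
  · rintro ⟨s, rfl⟩
    exact ⟨⟨κ s.1, s.2⟩, rfl⟩

/-- A bilinear condition defines a closed subset of the Grassmannian. -/
theorem isClosed_bilinear (l₁ l₂ l₃ l₄ : Module.Dual K W) :
    IsClosed {N : Grassmannian K W d | ∀ a ∈ N.1, ∀ b ∈ N.1, l₁ a * l₂ b - l₃ a * l₄ b = 0} := by
  refine isClosed_coinduced.2 ?_
  -- By bilinearity the condition need only be tested on pairs of frame vectors, where it is
  -- polynomial.
  have h : Frame.span K W ⁻¹'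
      {N : Grassmannian K W d | ∀ a ∈ N.1, ∀ b ∈ N.1, l₁ a * l₂ b - l₃ a * l₄ b = 0} =
      ⋂ (i : Fin d) (j : Fin d), {v | l₁ (v.1 i) * l₂ (v.1 j) - l₃ (v.1 i) * l₄ (v.1 j) = 0} := by
    ext v
    simp only [Set.mem_iInter]
    constructor
    · exact fun h i j ↦ h _ (Submodule.subset_span ⟨i, rfl⟩) _ (Submodule.subset_span ⟨j, rfl⟩)
    · intro h a ha b hb
      induction ha using Submodule.span_induction with
      | mem a ha =>
        obtain ⟨i, rfl⟩ := ha
        induction hb using Submodule.span_induction with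
        | mem b hb =>
          obtain ⟨j, rfl⟩ := hb
          exact h i j
        | zero => simp
        | add b b' _ _ h h' =>
          simp only [map_add]
          linear_combination h + h'
        | smul c b _ h =>
          simp only [map_smul, smul_eq_mul]
          linear_combination c * h
      | zero => simp
      | add b b' _ _ h h' =>
        simp only [map_add]
        linear_combination h + h'
      | smul c b _ h =>
        simp only [map_smul, smul_eq_mul]
        linear_combination c * h
  rw [h]
  refine isClosed_iInter fun i ↦ isClosed_iInter fun j ↦ ⟨?_⟩
  have hl : ∀ (l : Module.Dual K W) (i : Fin d),
      (fun v : Fin d → W ↦ l (v i)) ∈ polynomialFunctions K (Fin d → W) := fun l i ↦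
    Algebra.subset_adjoin ⟨l.comp (LinearMap.proj i), rfl⟩
  exact TopologicalSpace.isOpen_generateFrom_of_mem
    ⟨_, sub_mem (mul_mem (hl l₁ i) (hl l₂ j)) (mul_mem (hl l₃ i) (hl l₄ j)), rfl⟩

/-- The closed sets `C` and `D` separate `A` from `B` inside the union, so a connected subset of the
union cannot meet both. The sets `A` and `B` need not be closed themselves. -/
theorem connectedComponentIn_eq_of_isClosed {Y : Type*} [TopologicalSpace Y] {A B C D : Set Y}
    (hA : IsPreconnected A) (hB : IsPreconnected B) (hA₀ : A.Nonempty) (hB₀ : B.Nonempty)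
    (hC : IsClosed C) (hD : IsClosed D) (hAC : A ⊆ C) (hBD : B ⊆ D) (hAD : Disjoint A D)
    (hBC : Disjoint B C) :
    {E | ∃ y ∈ A ∪ B, E = connectedComponentIn (A ∪ B) y} = {A, B} := by
  have key : ∀ {A B C D : Set Y}, IsPreconnected A → IsClosed C → IsClosed D → A ⊆ C → B ⊆ D →
      Disjoint A D → Disjoint B C → ∀ y ∈ A, connectedComponentIn (A ∪ B) y = A := by
    intro A B C D hA hC hD hAC hBD hAD hBC y hy
    refine subset_antisymm ?_ (hA.subset_connectedComponentIn hy Set.subset_union_left)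
    have h1 := isPreconnected_iff_subset_of_disjoint_closed.1
      (isPreconnected_connectedComponentIn (F := A ∪ B) (x := y)) C D hC hD
      ((connectedComponentIn_subset _ _).trans (Set.union_subset_union hAC hBD)) (by
        refine Set.eq_empty_iff_forall_notMem.2 fun z hz ↦ ?_
        obtain hzA | hzB := connectedComponentIn_subset _ _ hz.1
        · exact Set.disjoint_left.1 hAD hzA hz.2.2
        · exact Set.disjoint_left.1 hBC hzB hz.2.1)
    have hyc : y ∈ connectedComponentIn (A ∪ B) y := mem_connectedComponentIn (Or.inl hy)
    have h2 : connectedComponentIn (A ∪ B) y ⊆ C :=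
      h1.resolve_right fun h ↦ Set.disjoint_left.1 hAD hy (h hyc)
    intro z hz
    exact (connectedComponentIn_subset _ _ hz).resolve_right fun hzB ↦
      Set.disjoint_left.1 hBC hzB (h2 hz)
  have hAc := key hA hC hD hAC hBD hAD hBC
  have hBc := key hB hD hC hBD hAC hBC hAD
  rw [Set.union_comm B A] at hBc
  ext E
  constructor
  · rintro ⟨y, hy | hy, rfl⟩
    · exact Or.inl (hAc y hy)
    · exact Or.inr (hBc y hy)
  · rintro (rfl | rfl)
    · obtain ⟨y, hy⟩ := hA₀
      exact ⟨y, Or.inl hy, (hAc y hy).symm⟩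
    · obtain ⟨y, hy⟩ := hB₀
      exact ⟨y, Or.inr hy, (hBc y hy).symm⟩

end Grassmannians

/-! ### Families of Lagrangian spaces with proportional columns -/

section LagrangianFamilies
variable {K R W : Type*} [Field K] [CommRing R] [Algebra K R] (S : Residue K R)
  [AddCommGroup W] [Module K W] [Module R W] [IsScalarTower K R W]
  (θ : Matrix (Fin 2) (Fin 2) R →ₗ[R] W)

/-- The Lagrangian spaces whose matrices have proportional columns. -/
def columnFamily : Set (Grassmannian K W 4) :=
  {N | ∃ L : Submodule R W, (∃ w : Fin 2 → R, (fun i ↦ S.ρ (w i)) ≠ 0 ∧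
    L.comap θ = S.columnLattice w) ∧ L.restrictScalars K = N.1}

/-- A frame that depends linearly on `w`. -/
def columnFrame : (Fin 2 → R) →ₗ[K] Fin 4 → W where
  toFun w := ![θ !![w 0, 0; w 1, 0], θ !![0, w 0; 0, w 1],
    S.t • θ !![w 0, 0; w 1, 0], S.t • θ !![0, w 0; 0, w 1]]
  map_add' v w := by
    have h0 : θ !![(v + w) 0, 0; (v + w) 1, 0] = θ !![v 0, 0; v 1, 0] + θ !![w 0, 0; w 1, 0] := by
      rw [← map_add]
      congr 1
      ext i j; fin_cases i <;> fin_cases j <;> simp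
    have h1 : θ !![0, (v + w) 0; 0, (v + w) 1] = θ !![0, v 0; 0, v 1] + θ !![0, w 0; 0, w 1] := by
      rw [← map_add]
      congr 1
      ext i j; fin_cases i <;> fin_cases j <;> simp
    rw [h0, h1, smul_add, smul_add]
    ext i
    fin_cases i <;> rfl
  map_smul' c w := by
    have h0 : θ !![(c • w) 0, 0; (c • w) 1, 0] = c • θ !![w 0, 0; w 1, 0] := by
      rw [← algebraMap_smul R c (θ _), ← map_smul]
      congr 1
      ext i j; fin_cases i <;> fin_cases j <;> simp [Algebra.smul_def]
    have h1 : θ !![0, (c • w) 0; 0, (c • w) 1] = c • θ !![0, w 0; 0, w 1] := by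
      rw [← algebraMap_smul R c (θ _), ← map_smul]
      congr 1
      ext i j; fin_cases i <;> fin_cases j <;> simp [Algebra.smul_def]
    rw [h0, h1, smul_comm S.t c, smul_comm S.t c]
    ext i
    fin_cases i <;> rfl

theorem sum_columnFrame (w : Fin 2 → R) (c : Fin 4 → K) : ∑ k, c k • columnFrame S θ w k =
    θ (Matrix.of fun i j ↦ (![algebraMap K R (c 0) + S.t * algebraMap K R (c 2),
      algebraMap K R (c 1) + S.t * algebraMap K R (c 3)] j) * w i) := by
  have e : (Matrix.of fun i j ↦ (![algebraMap K R (c 0) + S.t * algebraMap K R (c 2),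
      algebraMap K R (c 1) + S.t * algebraMap K R (c 3)] j) * w i) =
      algebraMap K R (c 0) • !![w 0, 0; w 1, 0] + algebraMap K R (c 1) • !![0, w 0; 0, w 1] +
      algebraMap K R (c 2) • S.t • !![w 0, 0; w 1, 0] +
      algebraMap K R (c 3) • S.t • !![0, w 0; 0, w 1] := by
    ext i j; fin_cases i <;> fin_cases j <;> simp [-algebraMap_smul] <;> ring
  rw [e, Fin.sum_univ_four]
  simp only [map_add, algebraMap_smul, LinearMap.map_smul_of_tower]
  rfl

variable {θ} (hθ₀ : ∀ A, θ A = 0 ↔ ∀ i j, S.t ^ 2 ∣ A i j)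
include hθ₀

theorem linearIndependent_columnFrame [IsDomain R] {w : Fin 2 → R} (hw : (fun i ↦ S.ρ (w i)) ≠ 0) :
    LinearIndependent K (columnFrame S θ w) := by
  rw [Fintype.linearIndependent_iff]
  intro c hc
  rw [sum_columnFrame, hθ₀] at hc
  obtain ⟨p, q, hpq⟩ := S.exists_coprime hw
  -- The elements `1` and `t` are independent over `K` modulo `t²`.
  have key : ∀ a b : K, S.t ^ 2 ∣ algebraMap K R a + S.t * algebraMap K R b → a = 0 ∧ b = 0 := by
    intro a b h
    have ha : a = 0 := by
      have := S.ρ_eq_zero_of_dvd h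
      simpa [S.ρ_t] using this
    rw [ha, map_zero, zero_add] at h
    obtain ⟨d, hd⟩ := h
    have h2 : algebraMap K R b = S.t * d := by
      refine mul_left_cancel₀ S.t_ne_zero ?_
      rw [hd]; ring
    have h3 := congrArg S.ρ h2
    rw [map_mul, S.ρ_t, zero_mul, AlgHom.commutes] at h3
    exact ⟨ha, h3⟩
  have h0 : ∀ j, S.t ^ 2 ∣ ![algebraMap K R (c 0) + S.t * algebraMap K R (c 2),
      algebraMap K R (c 1) + S.t * algebraMap K R (c 3)] j := fun j ↦ by
    have := dvd_add ((hc 0 j).mul_left p) ((hc 1 j).mul_left q)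
    simp only [Matrix.of_apply] at this
    convert this using 1
    linear_combination -(![algebraMap K R (c 0) + S.t * algebraMap K R (c 2),
      algebraMap K R (c 1) + S.t * algebraMap K R (c 3)] j) * hpq
  obtain ⟨h1, h2⟩ := key _ _ (h0 0)
  obtain ⟨h3, h4⟩ := key _ _ (h0 1)
  intro k
  fin_cases k <;> assumption

omit [Module K W] [IsScalarTower K R W] in
theorem comap_map_columnLattice (w : Fin 2 → R) :
    ((S.columnLattice w).map θ).comap θ = S.columnLattice w := by
  rw [Submodule.comap_map_eq, sup_eq_left]
  intro A hA j
  rw [LinearMap.mem_ker, hθ₀] at hA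
  exact dvd_sub ((hA 1 j).mul_left _) ((hA 0 j).mul_left _)

variable (hθ : Function.Surjective θ)
include hθ

/-- Modulo `t²` each column is a scalar multiple of `w`, and each scalar is `c + t d` with `c`, `d`
in `K`. The four coefficients are the coordinates in the frame. -/
theorem span_columnFrame {w : Fin 2 → R} (hw : (fun i ↦ S.ρ (w i)) ≠ 0) {L : Submodule R W}
    (hL : L.comap θ = S.columnLattice w) :
    L.restrictScalars K = Submodule.span K (Set.range (columnFrame S θ w)) := by
  obtain ⟨p, q, hpq⟩ := S.exists_coprime hw
  ext a
  rw [Submodule.mem_span_range_iff_exists_fun]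
  obtain ⟨A, rfl⟩ := hθ a
  constructor
  · intro hA
    have hA : A ∈ S.columnLattice w := hL ▸ hA
    have h : ∀ b : R, ∃ c d : K, S.t ^ 2 ∣ b - (algebraMap K R c + S.t * algebraMap K R d) :=
      fun b ↦ by
        obtain ⟨d, hd⟩ := (S.eq_zero_iff (b - algebraMap K _ (S.ρ b))).1 (by simp)
        obtain ⟨c, hc⟩ := (S.eq_zero_iff (d - algebraMap K _ (S.ρ d))).1 (by simp)
        exact ⟨S.ρ b, S.ρ d, c, by linear_combination hd + S.t * hc⟩
    obtain ⟨c0, c2, h0⟩ := h (p * A 0 0 + q * A 1 0)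
    obtain ⟨c1, c3, h1⟩ := h (p * A 0 1 + q * A 1 1)
    refine ⟨![c0, c1, c2, c3], ?_⟩
    rw [sum_columnFrame, ← sub_eq_zero, ← map_sub, hθ₀]
    have hb : ∀ i j, S.t ^ 2 ∣ A i j - (p * A 0 j + q * A 1 j) * w i := by
      intro i j
      obtain ⟨e0, e1⟩ := bracket_decomposition hpq (A.transpose j)
      obtain ⟨c, hc⟩ := hA j
      rw [hc] at e0 e1
      simp only [Matrix.transpose_apply] at e0 e1
      fin_cases i
      · exact ⟨-q * c, by simp only [Fin.zero_eta]; linear_combination e0⟩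
      · exact ⟨p * c, by simp only [Fin.mk_one]; linear_combination e1⟩
    intro i j
    rw [Matrix.sub_apply, Matrix.of_apply]
    fin_cases j
    · obtain ⟨c, hc⟩ := hb i 0
      obtain ⟨d, hd⟩ := h0
      refine ⟨-c - d * w i, ?_⟩
      simp
      linear_combination -hc - w i * hd
    · obtain ⟨c, hc⟩ := hb i 1
      obtain ⟨d, hd⟩ := h1
      refine ⟨-c - d * w i, ?_⟩
      simp
      linear_combination -hc - w i * hd
  · rintro ⟨c, hc⟩
    rw [sum_columnFrame] at hc
    rw [← hc]
    change _ ∈ L.comap θ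
    rw [hL]
    intro j
    simp only [bracket, Matrix.transpose_apply, Matrix.of_apply]
    exact ⟨0, by ring⟩

theorem columnFamily_nonempty [IsDomain R] : (columnFamily S θ).Nonempty := by
  have hw : (fun i ↦ S.ρ ((![1, 0] : Fin 2 → R) i)) ≠ 0 := fun h ↦ by
    have := congrFun h 0
    simp at this
  have hL := comap_map_columnLattice S hθ₀ ![1, 0]
  refine ⟨⟨((S.columnLattice ![1, 0]).map θ).restrictScalars K, ?_⟩, _, ⟨_, hw, hL⟩, rfl⟩
  rw [span_columnFrame S hθ₀ hθ hw hL,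
    finrank_span_eq_card (linearIndependent_columnFrame S hθ₀ hw), Fintype.card_fin]

/-- Two members with vectors `w₁` and `w₂` are joined by the frames of `w₁ + s (w₂ - w₁)`, which
depend affinely on `s` in `K`. -/
theorem isPreconnected_columnFamily [IsDomain R] [Infinite K] : IsPreconnected (columnFamily S θ) := by
  refine isPreconnected_of_forall_pair ?_
  rintro N₁ ⟨L₁, ⟨w₁, hw₁, hL₁⟩, hN₁⟩ N₂ ⟨L₂, ⟨w₂, hw₂, hL₂⟩, hN₂⟩
  let T : Set K := {s | (fun i ↦ S.ρ ((w₁ + s • (w₂ - w₁)) i)) ≠ 0}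
  -- If the reduction of the line vanished for two parameters it would be constantly zero, but it is
  -- nonzero at `w₁`.
  have hT : Tᶜ.Finite := by
    refine Set.Subsingleton.finite fun s hs s' hs' ↦ ?_
    have hs := not_not.1 hs
    have hs' := not_not.1 hs'
    by_contra hne
    refine hw₁ (funext fun i ↦ ?_)
    have h1 := congrFun hs i
    have h2 := congrFun hs' i
    simp only [Pi.add_apply, Pi.smul_apply, map_add, map_smul, Pi.zero_apply, smul_eq_mul] at h1 h2 ⊢
    have h3 := (mul_eq_zero.1 (show (s - s') * S.ρ ((w₂ - w₁) i) = 0 by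
      linear_combination h1 - h2)).resolve_left (sub_ne_zero.2 hne)
    rw [h3] at h1
    simpa using h1
  have hli : ∀ s ∈ T, LinearIndependent K (columnFrame S θ w₁ + s • columnFrame S θ (w₂ - w₁)) := by
    intro s hs
    rw [← map_smul, ← map_add]
    exact linearIndependent_columnFrame S hθ₀ hs
  refine ⟨_, ?_, ?_, ?_, isPreconnected_range_span _ _ hT hli⟩
  · rintro _ ⟨s, rfl⟩
    refine ⟨(S.columnLattice (w₁ + s.1 • (w₂ - w₁))).map θ,
      ⟨_, s.2, comap_map_columnLattice S hθ₀ _⟩, ?_⟩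
    rw [span_columnFrame S hθ₀ hθ s.2 (comap_map_columnLattice S hθ₀ _), map_add, map_smul]
    rfl
  · refine ⟨⟨0, by simpa [T] using hw₁⟩, Subtype.ext ?_⟩
    rw [← hN₁, span_columnFrame S hθ₀ hθ hw₁ hL₁]
    change Submodule.span K (Set.range (_ + (0 : K) • _)) = _
    rw [zero_smul, add_zero]
  · refine ⟨⟨1, by simpa [T] using hw₂⟩, Subtype.ext ?_⟩
    rw [← hN₂, span_columnFrame S hθ₀ hθ hw₂ hL₂]
    change Submodule.span K (Set.range (_ + (1 : K) • _)) = _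
    rw [one_smul, ← map_add, add_sub_cancel]

/-- The Lagrangian spaces with proportional columns are cut out by a closed condition that excludes
those with proportional rows. -/
theorem exists_isClosed_columnFamily : ∃ C : Set (Grassmannian K W 4), IsClosed C ∧
    columnFamily S θ ⊆ C ∧ ∀ (N : Grassmannian K W 4) (L : Submodule R W) (w : Fin 2 → R),
      (fun i ↦ S.ρ (w i)) ≠ 0 → L.comap θ = S.rowLattice w → L.restrictScalars K = N.1 → N ∉ C := by
  -- Reduction modulo `t` factors through `θ`, whose kernel consists of multiples of `t²`. The
  -- closed condition says that column `j` of one reduced element and column `k` of another are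
  -- proportional.
  obtain ⟨l, hl⟩ : ∃ l : W →ₗ[K] Matrix (Fin 2) (Fin 2) K, ∀ A, l (θ A) = S.red A := by
    let θK := θ.restrictScalars K
    have hker : LinearMap.ker θK ≤ LinearMap.ker S.red := by
      intro A hA
      have hA := (hθ₀ A).1 hA
      rw [LinearMap.mem_ker]
      ext i j
      exact S.ρ_eq_zero_of_dvd (hA i j)
    let l' := (LinearMap.ker θK).liftQ S.red hker
    let eq := θK.quotKerEquivOfSurjective hθ
    refine ⟨l'.comp eq.symm.toLinearMap, fun A ↦ ?_⟩
    have : eq.symm (θ A) = Submodule.Quotient.mk A := by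
      rw [LinearEquiv.symm_apply_eq]; rfl
    change l' (eq.symm (θ A)) = _
    rw [this]
    rfl
  have hcl : ∀ i j, ∃ m : Module.Dual K W, ∀ a, m a = l a i j := fun i j ↦
    ⟨(Matrix.entryLinearMap K K i j).comp l, fun _ ↦ rfl⟩
  choose m hm using hcl
  refine ⟨⋂ (j : Fin 2) (k : Fin 2), {N | ∀ a ∈ N.1, ∀ b ∈ N.1,
    m 0 j a * m 1 k b - m 1 j a * m 0 k b = 0}, isClosed_iInter fun j ↦ isClosed_iInter fun k ↦
      isClosed_bilinear (m 0 j) (m 1 k) (m 1 j) (m 0 k), ?_, ?_⟩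
  · rintro N ⟨L, ⟨w, hw, hL⟩, hN⟩
    simp only [Set.mem_iInter]
    intro j k a ha b hb
    obtain ⟨A, rfl⟩ := hθ a
    obtain ⟨B, rfl⟩ := hθ b
    rw [← hN] at ha hb
    have hA : A ∈ S.columnLattice w := hL ▸ ha
    have hB : B ∈ S.columnLattice w := hL ▸ hb
    have hA' := S.ρ_eq_zero_of_dvd (hA j)
    have hB' := S.ρ_eq_zero_of_dvd (hB k)
    simp only [hm, hl, Residue.red_apply]
    obtain ⟨p, q, hpq⟩ := S.exists_coprime hw
    have hpq' := congrArg S.ρ hpq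
    simp only [bracket, Matrix.transpose_apply, map_sub, map_mul, map_add, map_one] at hA' hB' hpq'
    linear_combination (S.ρ p * S.ρ (A 0 j) + S.ρ q * S.ρ (A 1 j)) * hB' -
      (S.ρ p * S.ρ (B 0 k) + S.ρ q * S.ρ (B 1 k)) * hA' -
      (S.ρ (A 0 j) * S.ρ (B 1 k) - S.ρ (A 1 j) * S.ρ (B 0 k)) * hpq'
  · intro N L w hw hL hN hC
    simp only [Set.mem_iInter] at hC
    -- For a coordinate `j` with `w j` nonzero modulo `t`, the matrices with `w` in the first row
    -- and with `w` in the second row have mixed minor `(w j)²`, so the condition fails.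
    obtain ⟨j, hj⟩ := Function.ne_iff.1 hw
    have hA : θ !![w 0, w 1; 0, 0] ∈ N.1 := by
      rw [← hN]
      change _ ∈ L.comap θ
      rw [hL]
      intro i
      fin_cases i <;> simp [bracket, mul_comm]
    have hB : θ !![0, 0; w 0, w 1] ∈ N.1 := by
      rw [← hN]
      change _ ∈ L.comap θ
      rw [hL]
      intro i
      fin_cases i <;> simp [bracket, mul_comm]
    have h := hC j j _ hA _ hB
    simp only [hm, hl, Residue.red_apply] at h
    fin_cases j <;> simp at h hj <;> exact hj h

end LagrangianFamilies

/-! ### Connected components of the second stratum -/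

section Components
variable {X : Scheme.{u}} [IsIntegral X] {x : X} {K : Type u} [Field K] [X.Over (Spec (.of K))]
  (S : Residue K (X.presheaf.stalk x)) {F G : X.Modules} (hF : IsVectorBundle F 2)
  (hG : IsVectorBundle G 2) {δ : det F ≅ det G} {q : QuadForm (homSheaf F G)}
  (hq : IsDetForm δ q) (e : Module.Basis (Fin 2) (X.presheaf.stalk x) (Stalk F x))
  (f : Module.Basis (Fin 2) (X.presheaf.stalk x) (Stalk G x))
  {L : Submodule (X.presheaf.stalk x) (Thick (homSheaf F G) x 2)}

/-- The class in `ℋom(F, G)_{2x}` of the transpose of a matrix. -/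
def ofTranspose : Matrix (Fin 2) (Fin 2) (X.presheaf.stalk x) →ₗ[X.presheaf.stalk x]
    Thick (homSheaf F G) x 2 :=
  (ofMatrix hF hG e f 2).comp (Matrix.transposeLinearEquiv (Fin 2) (Fin 2) _ _).toLinearMap

include hF hG in
theorem isColumnForm_of_hasImageLine (hq : IsDetForm δ q) (hL : L ∈ OSigma K q x 4 2)
    (h : HasImageLine K L) : IsColumnForm hF hG S L :=
  (isColumnForm_or_isRowForm hq hL).resolve_right fun h' ↦
    not_hasImageLine_and_hasKernelLine hF hG S h h'.hasKernelLine

include hF hG in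
theorem isRowForm_of_hasKernelLine (hq : IsDetForm δ q) (hL : L ∈ OSigma K q x 4 2)
    (h : HasKernelLine K L) : IsRowForm hF hG S L :=
  (isColumnForm_or_isRowForm hq hL).resolve_left fun h' ↦
    not_hasImageLine_and_hasKernelLine hF hG S h'.hasImageLine h

include S hF hG in
theorem xor_hasImageLine_hasKernelLine (hq : IsDetForm δ q) (hL : L ∈ OSigma K q x 4 2) :
    Xor (HasImageLine K L) (HasKernelLine K L) := by
  obtain h | h := isColumnForm_or_isRowForm (hF := hF) (hG := hG) (S := S) hq hL
  · exact Or.inl ⟨h.hasImageLine, fun h' ↦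
      not_hasImageLine_and_hasKernelLine hF hG S h.hasImageLine h'⟩
  · exact Or.inr ⟨h.hasKernelLine, fun h' ↦
      not_hasImageLine_and_hasKernelLine hF hG S h' h.hasKernelLine⟩

include hq

theorem mem_oSigma_and_hasImageLine_iff : L ∈ OSigma K q x 4 2 ∧ HasImageLine K L ↔
    ∃ w : Fin 2 → X.presheaf.stalk x, (fun i ↦ S.ρ (w i)) ≠ 0 ∧
      coordLattice hF hG e f L = S.columnLattice w := by
  constructor
  · rintro ⟨hL, h⟩
    obtain ⟨h1, h2, h3⟩ := (mem_oSigma_iff S (hF := hF) (hG := hG) e f hq).1 hL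
    refine (S.eq_columnLattice_or_rowLattice
      (smul_mem_coordLattice S hF hG e f) h1 h2 (by omega)).resolve_right ?_
    rintro ⟨w, hw, h'⟩
    exact not_hasImageLine_and_hasKernelLine hF hG S h
      (isRowForm_of_coordLattice hw h').hasKernelLine
  · rintro ⟨w, hw, h⟩
    refine ⟨(mem_oSigma_iff S (hF := hF) (hG := hG) e f hq).2 ?_,
      (isColumnForm_of_coordLattice hw h).hasImageLine⟩
    rw [h, S.image_columnLattice hw, S.coimage_columnLattice hw, finrank_columnSpace hw]
    exact ⟨fun A hA ↦ S.dvd_det_of_mem_columnLattice hw hA, rfl, rfl⟩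

theorem mem_oSigma_and_hasKernelLine_iff : L ∈ OSigma K q x 4 2 ∧ HasKernelLine K L ↔
    ∃ w : Fin 2 → X.presheaf.stalk x, (fun i ↦ S.ρ (w i)) ≠ 0 ∧
      coordLattice hF hG e f L = S.rowLattice w := by
  constructor
  · rintro ⟨hL, h⟩
    obtain ⟨h1, h2, h3⟩ := (mem_oSigma_iff S (hF := hF) (hG := hG) e f hq).1 hL
    refine (S.eq_columnLattice_or_rowLattice
      (smul_mem_coordLattice S hF hG e f) h1 h2 (by omega)).resolve_left ?_
    rintro ⟨w, hw, h'⟩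
    exact not_hasImageLine_and_hasKernelLine hF hG S
      (isColumnForm_of_coordLattice hw h').hasImageLine h
  · rintro ⟨w, hw, h⟩
    refine ⟨(mem_oSigma_iff S (hF := hF) (hG := hG) e f hq).2 ?_,
      (isRowForm_of_coordLattice hw h).hasKernelLine⟩
    have h1 : S.image (S.rowLattice w) = rowSpace K fun i ↦ S.ρ (w i) := by
      rw [Residue.rowLattice, S.image_comap_transpose, S.image_columnLattice hw]; rfl
    have h2 : S.coimage (S.rowLattice w) = rowSpace K fun i ↦ S.ρ (w i) := by
      rw [Residue.rowLattice, S.coimage_comap_transpose, S.coimage_columnLattice hw]; rfl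
    rw [h, h1, h2, finrank_rowSpace hw]
    refine ⟨fun A hA ↦ ?_, rfl, rfl⟩
    rw [← Matrix.det_transpose]
    exact S.dvd_det_of_mem_columnLattice hw hA

theorem grassmannianSet_hasImageLine : grassmannianSet K 4 {L ∈ OSigma K q x 4 2 | HasImageLine K L} =
    columnFamily S (ofMatrix hF hG e f 2) :=
  Set.ext fun _ ↦ exists_congr fun _ ↦
    and_congr_left' (mem_oSigma_and_hasImageLine_iff S hF hG hq e f)

/-- Transposing the coordinates turns proportional rows into proportional columns, so the results on
`columnFamily` cover both types. -/
theorem grassmannianSet_hasKernelLine :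
    grassmannianSet K 4 {L ∈ OSigma K q x 4 2 | HasKernelLine K L} =
      columnFamily S (ofTranspose hF hG e f) := by
  refine Set.ext fun _ ↦ exists_congr fun _ ↦ and_congr_left'
    ((mem_oSigma_and_hasKernelLine_iff S hF hG hq e f).trans ?_)
  refine exists_congr fun w ↦ and_congr_right' ?_
  constructor
  · intro h
    exact congrArg (Submodule.comap
      (Matrix.transposeLinearEquiv (Fin 2) (Fin 2) _ (X.presheaf.stalk x)).toLinearMap) h
  · intro h
    exact congrArg (Submodule.comap
      (Matrix.transposeLinearEquiv (Fin 2) (Fin 2) _ (X.presheaf.stalk x)).toLinearMap) h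

omit hq in
theorem ofTranspose_surjective : Function.Surjective (ofTranspose hF hG e f) :=
  (ofMatrix_surjective hF hG e f 2).comp (Matrix.transposeLinearEquiv (Fin 2) (Fin 2) _ (X.presheaf.stalk x)).surjective

omit hq in
theorem ofTranspose_eq_zero_iff {A : Matrix (Fin 2) (Fin 2) (X.presheaf.stalk x)} :
    ofTranspose hF hG e f A = 0 ↔ ∀ i j, S.t ^ 2 ∣ A i j :=
  (ofMatrix_eq_zero_iff S hF hG e f).trans forall_comm

include S hF hG

/-- The two types of Lagrangian submodules form the connected components of the second stratum. -/
theorem components_oSigma_two [Infinite K] :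
    {C | ∃ N ∈ grassmannianSet K 4 (OSigma K q x 4 2),
        C = connectedComponentIn (grassmannianSet K 4 (OSigma K q x 4 2)) N} =
      {grassmannianSet K 4 {L ∈ OSigma K q x 4 2 | HasImageLine K L},
        grassmannianSet K 4 {L ∈ OSigma K q x 4 2 | HasKernelLine K L}} ∧
    grassmannianSet K 4 {L ∈ OSigma K q x 4 2 | HasImageLine K L} ≠
      grassmannianSet K 4 {L ∈ OSigma K q x 4 2 | HasKernelLine K L} := by
  obtain ⟨e⟩ := hF.nonempty_basis_stalk x
  obtain ⟨f⟩ := hG.nonempty_basis_stalk x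
  have hunion : grassmannianSet K 4 (OSigma K q x 4 2) =
      columnFamily S (ofMatrix hF hG e f 2) ∪ columnFamily S (ofTranspose hF hG e f) := by
    rw [← grassmannianSet_hasImageLine S hF hG hq e f, ← grassmannianSet_hasKernelLine S hF hG hq e f]
    ext N
    constructor
    · rintro ⟨L, hL, hN⟩
      obtain h | h := xor_hasImageLine_hasKernelLine S hF hG hq hL
      · exact Or.inl ⟨L, ⟨hL, h.1⟩, hN⟩
      · exact Or.inr ⟨L, ⟨hL, h.1⟩, hN⟩
    · rintro (⟨L, hL, hN⟩ | ⟨L, hL, hN⟩)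
      · exact ⟨L, hL.1, hN⟩
      · exact ⟨L, hL.1, hN⟩
  have hs := ofMatrix_surjective hF hG e f 2
  have hs' := ofTranspose_surjective hF hG e f
  have h0 : ∀ A, ofMatrix hF hG e f 2 A = 0 ↔ ∀ i j, S.t ^ 2 ∣ A i j :=
    fun _ ↦ ofMatrix_eq_zero_iff S hF hG e f
  have h0' : ∀ A, ofTranspose hF hG e f A = 0 ↔ ∀ i j, S.t ^ 2 ∣ A i j :=
    fun _ ↦ ofTranspose_eq_zero_iff S hF hG e f
  have hA := grassmannianSet_hasImageLine S hF hG hq e f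
  have hB := grassmannianSet_hasKernelLine S hF hG hq e f
  have hn := columnFamily_nonempty S h0 hs
  have hn' := columnFamily_nonempty S h0' hs'
  obtain ⟨C, hC, hAC, hCr⟩ := exists_isClosed_columnFamily S h0 hs
  obtain ⟨D, hD, hBD, hDr⟩ := exists_isClosed_columnFamily S h0' hs'
  -- In the original coordinates the transposed family has proportional rows, and these are excluded
  -- from `C`. The next claim is the same with the roles exchanged.
  have hBC : Disjoint (columnFamily S (ofTranspose hF hG e f)) C :=
    Set.disjoint_left.2 fun N ⟨L, ⟨w, hw, hL⟩, hN⟩ ↦ hCr N L w hw (congrArg (Submodule.comap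
      (Matrix.transposeLinearEquiv (Fin 2) (Fin 2) _ (X.presheaf.stalk x)).toLinearMap) hL) hN
  have hAD : Disjoint (columnFamily S (ofMatrix hF hG e f 2)) D :=
    Set.disjoint_left.2 fun N ⟨L, ⟨w, hw, hL⟩, hN⟩ ↦ hDr N L w hw (congrArg (Submodule.comap
      (Matrix.transposeLinearEquiv (Fin 2) (Fin 2) _ (X.presheaf.stalk x)).toLinearMap) hL) hN
  rw [hunion, hA, hB]
  refine ⟨connectedComponentIn_eq_of_isClosed (isPreconnected_columnFamily S h0 hs)
    (isPreconnected_columnFamily S h0' hs') hn hn' hC hD hAC hBD hAD hBC, fun h ↦ ?_⟩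
  obtain ⟨N, hN⟩ := hn
  exact Set.disjoint_left.1 hBC (h ▸ hN) (hAC hN)

end Components

theorem nonempty_localParameter {X : Scheme.{u}} {x : X} {K : Type u} [Field K]
    [X.Over (Spec (.of K))] [IsAlgClosed K] [IsIntegral X] [IsProper (X ↘ Spec (.of K))]
    [SmoothOfRelativeDimension 1 (X ↘ Spec (.of K))] (hx : IsClosed {x}) :
    Nonempty (LocalParameter x) := by
  have := isDiscreteValuationRing_stalk (K := K) x hx
  obtain ⟨U, hU, t, h, ht⟩ := exists_uniformizer_nhd (K := K) x hx
  refine ⟨⟨U, hU, t, h, ht, fun h0 ↦ ?_⟩⟩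
  rw [h0, map_zero, Ideal.span_singleton_zero] at h
  exact IsDiscreteValuationRing.not_a_field _ h

end OrthHecke
end

/-! ### The theorem on orthogonal Hecke transforms -/

open OrthHecke
theorem mainTheorem11 {K : Type u} [Field K] [IsAlgClosed K] (hK : ringChar K ≠ 2)
    (X : Scheme.{u}) [X.Over (Spec (.of K))] [IsIntegral X] [IsProper (X ↘ Spec (.of K))]
    [SmoothOfRelativeDimension 1 (X ↘ Spec (.of K))] (x : X) (hx : IsClosed {x})
    (F G : X.Modules) (hF : IsVectorBundle F 2) (hG : IsVectorBundle G 2) (δ : det F ≅ det G) :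
    (∃! q : QuadForm (homSheaf F G), IsDetForm δ q) ∧
    ∀ q : QuadForm (homSheaf F G), IsDetForm δ q →
      -- the stratum of index one
      (∀ L ∈ OSigma K q x 4 1,
        (∃ φ : Thick (homSheaf F G) x 1, L.map (Thick.π _ x) = Submodule.span _ {φ}) ∧
        ∀ φ : Thick (homSheaf F G) x 1, L.map (Thick.π _ x) = Submodule.span _ {φ} →
          Module.finrank K (LinearMap.ker (Thick.eval x 1 F G φ)) = 1 ∧
          Module.finrank K (LinearMap.range (Thick.eval x 1 F G φ)) = 1 ∧
          HeckeEqHom q L (heckeTransform F x (LinearMap.ker (Thick.eval x 1 F G φ)))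
            (heckeTransform G x (LinearMap.range (Thick.eval x 1 F G φ)))) ∧
      -- the stratum of index two: the two types of Lagrangian submodules, and the components
      (∀ L ∈ OSigma K q x 4 2, Xor (HasImageLine K L) (HasKernelLine K L)) ∧
      ({C | ∃ N ∈ grassmannianSet K 4 (OSigma K q x 4 2),
          C = connectedComponentIn (grassmannianSet K 4 (OSigma K q x 4 2)) N} =
        {grassmannianSet K 4 {L ∈ OSigma K q x 4 2 | HasImageLine K L},
          grassmannianSet K 4 {L ∈ OSigma K q x 4 2 | HasKernelLine K L}}) ∧
      (grassmannianSet K 4 {L ∈ OSigma K q x 4 2 | HasImageLine K L} ≠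
        grassmannianSet K 4 {L ∈ OSigma K q x 4 2 | HasKernelLine K L}) ∧
      -- the Hecke transforms in the two cases
      (∀ L ∈ OSigma K q x 4 2, HasImageLine K L →
        (∃! M : Submodule (X.presheaf.stalk x) (Thick G x 2), L = homInto F M) ∧
        ∀ M : Submodule (X.presheaf.stalk x) (Thick G x 2), L = homInto F M →
          HeckeEqHom q L F (twist (heckeTransform G x M) x)) ∧
      (∀ L ∈ OSigma K q x 4 2, HasKernelLine K L →
        (∃! M : Submodule (X.presheaf.stalk x) (Thick F x 2), L = homKilling G M) ∧
        ∀ M : Submodule (X.presheaf.stalk x) (Thick F x 2), L = homKilling G M →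
          HeckeEqHom q L (twist (heckeTransform F x M) x) G) := by
  -- The volume form on the generic fibre of `G` is arbitrary. The isomorphism `δ` then determines
  -- the matching form on that of `F`, and the pair defines `Q`.
  obtain ⟨ω', hω'⟩ := exists_alternating_ne_zero hG.finrank_stalk
  obtain ⟨ω, hω, hδ⟩ := exists_volumeForm hF.emb hG.emb hF hG hF.finrank_stalk hG.finrank_stalk
    hω' δ
  obtain ⟨Q, hQ⟩ := exists_detQuad hF.finrank_stalk hω ω'
  refine ⟨existsUnique_isDetForm hδ hQ, fun q hq ↦ ?_⟩
  obtain ⟨P⟩ := nonempty_localParameter (K := K) hx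
  obtain ⟨S, -⟩ := exists_residue K hx P
  have : Infinite K := IsAlgClosed.instInfinite
  obtain ⟨hcomp, hne⟩ := components_oSigma_two S hF hG hq
  refine ⟨fun L hL ↦ heckeEqHom_of_mem_oSigma_one (S := S) (hF := hF) (hG := hG) hq hx P hL,
    fun L hL ↦ xor_hasImageLine_hasKernelLine S hF hG hq hL, hcomp, hne,
    fun L hL h ↦ ?_, fun L hL h ↦ ?_⟩
  · have hc := isColumnForm_of_hasImageLine S hF hG hq hL h
    exact ⟨hc.existsUnique, hc.heckeEqHom hq hx P⟩
  · have hr := isRowForm_of_hasKernelLine S hF hG hq hL h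
    exact ⟨hr.existsUnique, hr.heckeEqHom hq hx P⟩
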